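/- Let $n,m\ge 1$ be integers, let $1\le r<\infty$, and let $T$ be an $m$-linear operator mapping $L^r(\mathbb R^n)\times\cdots\times L^r(\mathbb R^n)$ (complex-valued functions) into the measurable functions modulo a.e. equality. Assume: 1. $T$ is a singular integral operator with kernel $K(x,y_1,\dots,y_m)$, where $K(x,\cdot)$ is measurable for every $x$: for all bounded compactly supported measurable $f_1,\dots,f_m$ and for a.e. $x\notin\bigcap_{i=1}^m\operatorname{supp} f_i$, $$T(f_1,\dots,f_m)(x)=\int_{(\mathbb R^n)^m}K(x,y_1,\dots,y_m)\prod_{i=1}^m f_i(y_i)\,d\vec y,$$ the integral being absolutely convergent. 2. $T$ is bounded from $L^r\times\cdots\times L^r$ to $L^{r/m,\infty}$. 3. $K$ satisfies the $m$-linear $L^r$-Hörmander condition $$K_r:=\sup_Q\sup_{x,z\in\frac12Q}\sum_{k=1}^\infty|2^kQ|^{\frac mr}\Big(\int_{(2^kQ)^m\setminus(2^{k-1}Q)^m}|K(x,\vec y)-K(z,\vec y)|^{r'}\,d\vec y\Big)^{\frac1{r'}}<\infty ,$$ where $Q$ runs over all axis-parallel cubes, $aQ$ is the concentric dilate of $Q$,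 $Q^m=Q\times\cdots\times Q$ and $1/r+1/r'=1$; for $r=1$ the $L^{r'}$ norm is the essential supremum over $(2^kQ)^m\setminus(2^{k-1}Q)^m$. Let $\vec P=(p_1,\dots,p_m)$ with $r<p_i<\infty$ for all $i$, and let $\frac1p=\sum_{i=1}^m\frac1{p_i}$. Then there is a constant $c=c_{m,n,r,T,\vec P}<\infty$ such that the following holds for every $\vec w=(w_1,\dots,w_m)$ of weights (measurable, positive and finite a.e.) for which, with $v_{\vec w}=\prod_{i=1}^m w_i^{p/p_i}$, $$[\vec w]_{A_{\vec P/r}}:=\sup_Q\Big(\frac1{|Q|}\int_Q v_{\vec w}\Big)\prod_{i=1}^m\Big(\frac1{|Q|}\int_Q w_i^{-\frac r{p_i-r}}\Big)^{\frac{p(p_i-r)}{p_ir}}<\infty .$$ The operator $T$ has an $m$-linear extension to $L^{p_1}(w_1)\times\cdots\times L^{p_m}(w_m)$ with values in $L^p(v_{\vec w})$ (it agrees with $T$ at $(f_1,\dots,f_m)$ whenever $f_i\in L^r\cap L^{p_i}(w_i)$ for all $i$), and this extension satisfies $$\|T\|_{L^{p_1}(w_1)\times\cdots\times L^{p_m}(w_m)\to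 L^p(v_{\vec w})}\le c\,[\vec w]_{A_{\vec P/r}}^{\max\{1,\ \max_i\frac{(p_i/r)'}{p}\}},\qquad (p_i/r)'=\frac{p_i}{p_i-r}.$$ In particular this holds for every $m$-linear Fourier multiplier operator that satisfies assumptions 1–3. -/

import Mathlib

open MeasureTheory
open scoped ENNReal NNReal

namespace SparseHormander

/-- The closed axis-parallel cube in `ℝⁿ` with centre `c` and side length `l`.
The concentric dilate `a Q` of `Q = cube c l` is `cube c (a * l)`. -/
def cube {n : ℕ} (c : Fin n → ℝ) (l : ℝ) : Set (Fin n → ℝ) :=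
  {x | ∀ j, |x j - c j| ≤ l / 2}

/-- The `m`-fold product `Q × ⋯ × Q` of `Q = cube c l`, a subset of `(ℝⁿ)ᵐ`. -/
def cubePow {n : ℕ} (m : ℕ) (c : Fin n → ℝ) (l : ℝ) : Set (Fin m → Fin n → ℝ) :=
  {y | ∀ i, y i ∈ cube c l}

/-- The constant `K_r` of the `m`-linear `L^r`-Hörmander condition: the supremum over all cubes `Q`
(centre `c`, side `l`) and all `x, z ∈ ½ Q` of
`∑_{k ≥ 1} |2^k Q|^{m/r} ‖K(x, ·) - K(z, ·)‖_{L^{r'}((2^k Q)^m \ (2^{k-1} Q)^m)}`.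
For `r = 1` the exponent `r'` is `∞` and the norm is the essential supremum.
The summation index below is `k - 1`. -/
noncomputable def hormanderConst {n m : ℕ} (r : ℝ)
    (K : (Fin n → ℝ) → (Fin m → Fin n → ℝ) → ℂ) : ℝ≥0∞ :=
  ⨆ (c : Fin n → ℝ) (l : ℝ) (_ : 0 < l)
    (x : Fin n → ℝ) (_ : x ∈ cube c (l / 2)) (z : Fin n → ℝ) (_ : z ∈ cube c (l / 2)),
    ∑' k : ℕ, (volume (cube c (2 ^ (k + 1) * l))) ^ ((m : ℝ) / r) *
      eLpNorm (fun y => K x y - K z y) (ENNReal.ofReal r).conjExponent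
        (volume.restrict (cubePow m c (2 ^ (k + 1) * l) \ cubePow m c (2 ^ k * l)))

/-- The weak Lebesgue quasinorm `‖g‖_{L^{q,∞}} = sup_{t > 0} t |{|g| > t}|^{1/q}`. -/
noncomputable def weakLpNorm {n : ℕ} (q : ℝ) (g : (Fin n → ℝ) → ℂ) : ℝ≥0∞ :=
  ⨆ t : ℝ≥0, (t : ℝ≥0∞) * (volume {x | t < ‖g x‖₊}) ^ (1 / q)

/-- `T` is bounded from `L^r × ⋯ × L^r` to `L^{r/m,∞}`. -/
def IsWeakBounded {n m : ℕ} (r : ℝ)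
    (T : MultilinearMap ℂ
      (fun _ : Fin m => Lp ℂ (ENNReal.ofReal r) (volume : Measure (Fin n → ℝ)))
      ((Fin n → ℝ) →ₘ[volume] ℂ)) : Prop :=
  ∃ B : ℝ≥0, ∀ f, weakLpNorm (r / m) (T f) ≤
    B * ∏ i, eLpNorm (f i) (ENNReal.ofReal r) volume

/-- `T`, an `m`-linear operator on `L^r × ⋯ × L^r` with values in measurable functions modulo
a.e. equality, is a singular integral operator with kernel `K`: for bounded compactly supported
`f₁, …, f_m`,
`T(f₁, …, f_m)(x) = ∫ K(x, y₁, …, y_m) f₁(y₁) ⋯ f_m(y_m) dy₁ ⋯ dy_m` (absolutely convergent)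
for a.e. `x ∉ supp f₁ ∩ ⋯ ∩ supp f_m`. -/
structure IsSingularIntegral {n m : ℕ} (r : ℝ)
    (T : MultilinearMap ℂ
      (fun _ : Fin m => Lp ℂ (ENNReal.ofReal r) (volume : Measure (Fin n → ℝ)))
      ((Fin n → ℝ) →ₘ[volume] ℂ))
    (K : (Fin n → ℝ) → (Fin m → Fin n → ℝ) → ℂ) : Prop where
  kernel_measurable : ∀ x, AEStronglyMeasurable (K x) volume
  kernel_repr : ∀ (f : Fin m → (Fin n → ℝ) → ℂ)
    (hf : ∀ i, MemLp (f i) (ENNReal.ofReal r) volume),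
    (∀ i, ∃ B : ℝ, ∀ y, ‖f i y‖ ≤ B) → (∀ i, HasCompactSupport (f i)) →
    ∀ᵐ x, x ∉ ⋂ i, tsupport (f i) →
      Integrable (fun y : Fin m → Fin n → ℝ => K x y * ∏ i, f i (y i)) volume ∧
      T (fun i => (hf i).toLp (f i)) x = ∫ y : Fin m → Fin n → ℝ, K x y * ∏ i, f i (y i)

/-- A weight on `ℝⁿ`: a measurable function that is positive (and finite) almost everywhere.
Local integrability is not required. -/
def IsWeight {n : ℕ} (w : (Fin n → ℝ) → ℝ) : Prop :=
  AEMeasurable w volume ∧ ∀ᵐ x, 0 < w x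

/-- The measure `w(x) dx`, so that `L^s(w) = Lp ℂ s (weightMeasure w)`. -/
noncomputable def weightMeasure {n : ℕ} (w : (Fin n → ℝ) → ℝ) : Measure (Fin n → ℝ) :=
  volume.withDensity (fun x => ENNReal.ofReal (w x))

/-- `v_w = ∏ w_i^{p / p_i}`. -/
noncomputable def productWeight {n m : ℕ} (p : ℝ) (P : Fin m → ℝ)
    (w : Fin m → (Fin n → ℝ) → ℝ) (x : Fin n → ℝ) : ℝ :=
  ∏ i, w i x ^ (p / P i)

/-- The multiple weight constant `[w]_{A_{P/r}}`: the supremum over all cubes `Q` of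
`(⨍_Q v_w) ∏_i (⨍_Q w_i^{-r/(p_i - r)})^{p (p_i - r) / (p_i r)}`. -/
noncomputable def multiApConst {n m : ℕ} (r p : ℝ) (P : Fin m → ℝ)
    (w : Fin m → (Fin n → ℝ) → ℝ) : ℝ≥0∞ :=
  ⨆ (c : Fin n → ℝ) (l : ℝ) (_ : 0 < l),
    (⨍⁻ x in cube c l, ENNReal.ofReal (productWeight p P w x) ∂volume) *
      ∏ i, (⨍⁻ x in cube c l, ENNReal.ofReal (w i x ^ (-(r / (P i - r)))) ∂volume) ^
        (p * (P i - r) / (P i * r))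

end SparseHormander

open SparseHormander

/-! The proof is sparse domination followed by a weighted estimate of the sparse form.

Sparse domination. For a dyadic cube `Q` write `F = f 1_{2Q}` and `a = ∏ ⟨|f_i|^r⟩_{2Q}^{1/r}`, and
fix a height `λ` equal to a large multiple of `a`. A subcube `R` is bad if it lies in a small open
neighbourhood of `{|T F| > λ}`, or if `|T F - T(f 1_{2R})| > 3λ` on a nonnull part of `R`. In the
second case the Hörmander condition permits comparison with a point `z` of `R`: the oscillation of
`T F - T(f 1_{2R})` over `R` is at most `K_r` times a supremum of products of averages of `F` over
dilates of `R`. So one of three things happens: `{|T F| > λ}` fills half of `R`; or `{|T(f 1_{2R})|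
> λ}` fills half of `R`, and the weak type bound makes the averages over `2R` large; or the averages
over some dilate are large. A large product of averages has a large factor, so the bad cubes are
covered by the weak type bound for `T`, packing, and the Vitali covering lemma applied to each
`|F_i|^r`. Their union is at most `2^{-(n+1)} |Q|`. The maximal cubes having a bad child are
themselves not bad and fill at most half of `Q` (`exists_stopping_cubes`). On them `|T F| ≤ 3λ +
|T(f 1_{2P})|`, elsewhere in `Q` one has `|T F| ≤ 3λ` almost everywhere (`exists_local_step`).
Iteration gives `|T f| ≤ A ∑ ∏ ⟨|f_i|^r⟩_{2R}^{1/r} 1_R` with disjoint sets `E_R ⊆ R` of measure at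
least `|R|/2` (`exists_sparse_domination`). The doubles `2R` are then placed in cubes of finitely
many shifted dyadic grids.

Weighted estimate. With `S_i = w_i^{-r/(p_i-r)}` one has `⟨|f_i|^r⟩ = ⟨|f_i|^r / S_i⟩_{S_i} ⟨S_i⟩`.
The averages of `v_w` and the `S_i` over a cube are exchanged for averages over its large subset `E`
at the cost of a power of the weight constant (`weight_average_le`). The exponent must dominate `1`
and each `(p_i/r)'/p`, which is where the maximum comes from. Hölder's inequality and the dyadic
Carleson embedding, valid for an arbitrary measure, finish the proof: for `p ≤ 1` after taking
`p`-th powers termwise, for `p > 1` after writing `G^p = G · G^{p-1}` and absorbing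
(`exists_sparse_bound`).

Extension. The bound is proved for bounded, compactly supported functions. Truncation, continuity of
`T` in measure and completeness of `L^p`, also for `p < 1`, yield the extension
(`exists_extension`). -/

namespace SparseHormander

/-! ### Dyadic grids and packing -/

/-- Labels of dyadic cubes: generation and position. -/
abbrev Label (n : ℕ) := ℕ × (Fin n → ℤ)

/-- Side length of a dyadic cube when the cubes of generation `0` have side `L`. -/
noncomputable def side {n : ℕ} (L : ℝ) (Q : Label n) : ℝ := L / 2 ^ Q.1

/-- The half-open cube with label `Q` in the dyadic grid with origin `t` and top scale `L`. -/
def dcube {n : ℕ} (t : Fin n → ℝ) (L : ℝ) (Q : Label n) : Set (Fin n → ℝ) :=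
  {x | ∀ j, ⌊(x j - t j) / side L Q⌋ = Q.2 j}

/-- The centre of `dcube t L Q`. -/
noncomputable def center {n : ℕ} (t : Fin n → ℝ) (L : ℝ) (Q : Label n) : Fin n → ℝ :=
  fun j => t j + (Q.2 j + 1 / 2) * side L Q

/-- The label of the dyadic cube of generation `i` that contains `x`. -/
noncomputable def labelAt {n : ℕ} (t : Fin n → ℝ) (L : ℝ) (i : ℕ) (x : Fin n → ℝ) : Label n :=
  (i, fun j => ⌊(x j - t j) / (L / 2 ^ i)⌋)

/-- The dyadic parent. -/
def parent {n : ℕ} (Q : Label n) : Label n := (Q.1 - 1, fun j => Q.2 j / 2)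

variable {n : ℕ} {t : Fin n → ℝ} {L : ℝ}

lemma side_pos (hL : 0 < L) (Q : Label n) : 0 < side L Q := by unfold side; positivity

lemma mem_dcube_labelAt (i : ℕ) (x : Fin n → ℝ) : x ∈ dcube t L (labelAt t L i x) := fun _ => rfl

lemma mem_dcube_iff {Q : Label n} {x : Fin n → ℝ} :
    x ∈ dcube t L Q ↔ labelAt t L Q.1 x = Q := by
  constructor
  · intro h
    exact Prod.ext rfl (funext h)
  · intro h j
    exact congrFun (congrArg Prod.snd h) j

lemma dcube_eq_pi (hL : 0 < L) (Q : Label n) : dcube t L Q =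
    Set.pi Set.univ fun j => Set.Ico (t j + Q.2 j * side L Q) (t j + (Q.2 j + 1) * side L Q) := by
  ext x
  have hs := side_pos hL Q
  simp only [dcube, Set.mem_ofPred_eq, Set.mem_pi, Set.mem_univ, true_implies, Set.mem_Ico,
    Int.floor_eq_iff, le_div_iff₀ hs, div_lt_iff₀ hs]
  refine forall_congr' fun j => ?_
  constructor <;> rintro ⟨h1, h2⟩ <;> constructor <;> linarith

lemma measurableSet_dcube (hL : 0 < L) (Q : Label n) : MeasurableSet (dcube t L Q) := by
  rw [dcube_eq_pi hL]
  exact MeasurableSet.univ_pi fun _ => measurableSet_Ico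

lemma volume_dcube (hL : 0 < L) (Q : Label n) :
    volume (dcube t L Q) = ENNReal.ofReal (side L Q) ^ n := by
  rw [dcube_eq_pi hL, volume_pi_pi]
  simp only [Real.volume_Ico]
  have : ∀ j : Fin n, t j + (Q.2 j + 1) * side L Q - (t j + Q.2 j * side L Q) = side L Q := by
    intro j; ring
  simp [this]

lemma volume_dcube_ne_top (hL : 0 < L) (Q : Label n) : volume (dcube t L Q) ≠ ∞ := by
  rw [volume_dcube hL]; exact ENNReal.pow_ne_top ENNReal.ofReal_ne_top

lemma volume_dcube_pos (hL : 0 < L) (Q : Label n) : 0 < volume (dcube t L Q) := by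
  rw [volume_dcube hL]
  exact pos_iff_ne_zero.2 (pow_ne_zero _ (by simpa using side_pos hL Q))

lemma dcube_nonempty (hL : 0 < L) (Q : Label n) : (dcube t L Q).Nonempty :=
  nonempty_of_measure_ne_zero (volume_dcube_pos hL Q).ne'

lemma cube_eq_closedBall (c : Fin n → ℝ) {l : ℝ} (hl : 0 ≤ l) :
    cube c l = Metric.closedBall c (l / 2) := by
  ext x
  simp [cube, Metric.mem_closedBall, dist_pi_le_iff (by linarith : 0 ≤ l / 2), Real.dist_eq]

lemma volume_cube (c : Fin n → ℝ) {l : ℝ} (hl : 0 ≤ l) :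
    volume (cube c l) = ENNReal.ofReal l ^ n := by
  rw [cube_eq_closedBall c hl, Real.volume_pi_closedBall _ (by linarith)]
  rw [ENNReal.ofReal_pow (by linarith)]
  simp [mul_div_cancel₀]

lemma measurableSet_cube (c : Fin n → ℝ) (l : ℝ) : MeasurableSet (cube c l) := by
  have : cube c l = ⋂ j, {x : Fin n → ℝ | |x j - c j| ≤ l / 2} := by ext; simp [cube]
  rw [this]
  refine MeasurableSet.iInter fun j => measurableSet_le ?_ measurable_const
  fun_prop

lemma volume_cube_ne_top (c : Fin n → ℝ) {l : ℝ} (hl : 0 ≤ l) : volume (cube c l) ≠ ∞ := by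
  rw [volume_cube c hl]; exact ENNReal.pow_ne_top ENNReal.ofReal_ne_top

lemma volume_cube_pos (c : Fin n → ℝ) {l : ℝ} (hl : 0 < l) : 0 < volume (cube c l) := by
  rw [volume_cube c hl.le]
  exact pos_iff_ne_zero.2 (pow_ne_zero _ (by simpa using hl))

lemma cube_mono (c : Fin n → ℝ) {l l' : ℝ} (h : l ≤ l') : cube c l ⊆ cube c l' :=
  fun _ hx j => (hx j).trans (by linarith)

lemma dcube_subset_cube (hL : 0 < L) (Q : Label n) :
    dcube t L Q ⊆ cube (center t L Q) (side L Q) := by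
  intro x hx j
  rw [dcube_eq_pi hL] at hx
  obtain ⟨h1, h2⟩ := hx j trivial
  rw [abs_le]
  simp only [center]
  constructor <;> linarith

/-- The coarse position is the fine one divided by `2^d` and rounded down, so it depends on the fine
label only. This is the nesting of the grid. -/
lemma labelAt_labelAt {i d : ℕ} {x y : Fin n → ℝ} (h : labelAt t L (i + d) x = labelAt t L (i + d) y) :
    labelAt t L i x = labelAt t L i y := by
  refine Prod.ext rfl (funext fun j => ?_)
  have h1 := congrFun (congrArg Prod.snd h) j
  simp only [labelAt] at h1 ⊢
  have key : ∀ u : ℝ, ⌊u / (L / 2 ^ i)⌋ = ⌊u / (L / 2 ^ (i + d))⌋ / ((2 ^ d : ℕ) : ℤ) := by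
    intro u
    rw [← Int.floor_div_natCast]
    congr 1
    push_cast
    rw [pow_add, div_div_eq_mul_div, div_div_eq_mul_div]
    field_simp
  rw [key, key, h1]

lemma dcube_subset_of_mem {Q Q' : Label n} (h : Q.1 ≤ Q'.1) {x : Fin n → ℝ}
    (hx : x ∈ dcube t L Q) (hx' : x ∈ dcube t L Q') : dcube t L Q' ⊆ dcube t L Q := by
  intro y hy
  rw [mem_dcube_iff] at *
  obtain ⟨d, hd⟩ := Nat.exists_eq_add_of_le h
  exact (labelAt_labelAt (d := d) (by rw [← hd, hx', hy])).trans hx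

lemma label_eq_of_mem {Q Q' : Label n} (h : Q.1 = Q'.1) {x : Fin n → ℝ}
    (hx : x ∈ dcube t L Q) (hx' : x ∈ dcube t L Q') : Q = Q' := by
  rw [mem_dcube_iff] at *
  rw [← hx, ← hx', h]

/-- Integer division by 2 rounds down, so the formula for the parent is also right at negative
positions. Generation 0 is excluded because it has no parent in the grid: natural subtraction would
leave the generation unchanged. -/
lemma dcube_subset_parent {Q : Label n} (hQ : 0 < Q.1) :
    dcube t L Q ⊆ dcube t L (parent Q) := by
  intro x hx j
  have h1 := hx j
  simp only [side, parent] at h1 ⊢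
  rw [← h1]
  obtain ⟨i, hi⟩ : ∃ i, Q.1 = i + 1 := ⟨Q.1 - 1, by omega⟩
  rw [hi, Nat.add_sub_cancel]
  have : (2 : ℤ) = ((2 : ℕ) : ℤ) := rfl
  rw [this, ← Int.floor_div_natCast]
  congr 1
  push_cast
  rw [pow_succ, div_div_eq_mul_div, div_div_eq_mul_div]
  field_simp

lemma parent_level {Q : Label n} (hQ : 0 < Q.1) : (parent Q).1 + 1 = Q.1 := by
  simp only [parent]; omega

/-- Packing: a lower density bound on each dyadic cube of a family passes to the union. -/
lemma packing_finset (hL : 0 < L) {μ ν : Measure (Fin n → ℝ)} {c : ℝ≥0∞} (F : Finset (Label n))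
    (h : ∀ Q ∈ F, c * μ (dcube t L Q) ≤ ν (dcube t L Q)) :
    c * μ (⋃ Q ∈ F, dcube t L Q) ≤ ν (⋃ Q ∈ F, dcube t L Q) := by
  classical
  induction hk : F.card using Nat.strong_induction_on generalizing F with
  | _ k ih =>
    rcases F.eq_empty_or_nonempty with rfl | hne
    · simp
    -- A cube of least generation swallows every member that meets it, so the union splits into this
    -- cube and the members disjoint from it.
    obtain ⟨Q, hQF, hQ⟩ := F.exists_min_image (fun Q => Q.1) hne
    set F' := F.filter fun R => Disjoint (dcube t L R) (dcube t L Q) with hF'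
    have hQF' : Q ∉ F' := by
      simp only [hF', Finset.mem_filter, not_and, disjoint_self]
      intro _ h0
      exact (dcube_nonempty (t := t) hL Q).ne_empty h0
    have hlt : F'.card < k := by
      rw [← hk]
      exact Finset.card_lt_card
        ⟨Finset.filter_subset _ _, fun hh => hQF' (hh hQF)⟩
    have hU : (⋃ R ∈ F, dcube t L R) = dcube t L Q ∪ ⋃ R ∈ F', dcube t L R := by
      apply Set.Subset.antisymm
      · refine Set.iUnion₂_subset fun R hR => ?_
        by_cases hd : Disjoint (dcube t L R) (dcube t L Q)
        · exact (Set.subset_biUnion_of_mem (u := fun R => dcube t L R)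
            (show R ∈ F' by simp [hF', hR, hd])).trans Set.subset_union_right
        · obtain ⟨x, hx1, hx2⟩ := Set.not_disjoint_iff.1 hd
          exact (dcube_subset_of_mem (hQ R hR) hx2 hx1).trans Set.subset_union_left
      · refine Set.union_subset (Set.subset_biUnion_of_mem (u := fun R => dcube t L R) hQF) ?_
        exact Set.biUnion_subset_biUnion_left (Finset.filter_subset _ _)
    have hdis : Disjoint (dcube t L Q) (⋃ R ∈ F', dcube t L R) := by
      simp only [Set.disjoint_iUnion_right]
      intro R hR
      exact (Finset.mem_filter.1 hR).2.symm
    have hm : MeasurableSet (⋃ R ∈ F', dcube t L R) :=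
      F'.measurableSet_biUnion fun R _ => measurableSet_dcube hL R
    rw [hU, measure_union hdis hm, measure_union hdis hm, mul_add]
    exact add_le_add (h Q hQF) (ih _ hlt F' (fun R hR => h R (Finset.filter_subset _ _ hR)) rfl)

/-- The measure of a directed union is a supremum, so the finite case suffices. -/
lemma packing (hL : 0 < L) {μ ν : Measure (Fin n → ℝ)} {c : ℝ≥0∞} (S : Set (Label n))
    (h : ∀ Q ∈ S, c * μ (dcube t L Q) ≤ ν (dcube t L Q)) :
    c * μ (⋃ Q ∈ S, dcube t L Q) ≤ ν (⋃ Q ∈ S, dcube t L Q) := by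
  classical
  have hU : (⋃ Q ∈ S, dcube t L Q) = ⋃ F : Finset S, ⋃ Q ∈ F.image Subtype.val, dcube t L Q := by
    ext x
    simp only [Set.mem_iUnion, exists_prop]
    constructor
    · rintro ⟨Q, hQ, hx⟩
      exact ⟨{⟨Q, hQ⟩}, Q, by simp, hx⟩
    · rintro ⟨F, Q, hQ, hx⟩
      obtain ⟨⟨Q', h'⟩, -, rfl⟩ := Finset.mem_image.1 hQ
      exact ⟨Q', h', hx⟩
  have hdir : Directed (· ⊆ ·)
      (fun F : Finset S => ⋃ Q ∈ F.image Subtype.val, dcube t L Q) := by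
    refine Monotone.directed_le (fun F G hFG => ?_)
    exact Set.biUnion_subset_biUnion_left (Finset.image_subset_image hFG)
  rw [hU, hdir.measure_iUnion, ENNReal.mul_iSup]
  refine iSup_le fun F => (packing_finset hL _ ?_).trans (measure_mono ?_)
  · intro Q hQ
    obtain ⟨⟨Q', h'⟩, -, rfl⟩ := Finset.mem_image.1 hQ
    exact h _ h'
  · exact Set.subset_iUnion (fun F : Finset S => ⋃ Q ∈ F.image Subtype.val, dcube t L Q) F

lemma exists_dcube_subset_of_isOpen (hL : 0 < L) {U : Set (Fin n → ℝ)} (hU : IsOpen U)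
    {x : Fin n → ℝ} (hx : x ∈ U) (i : ℕ) : ∃ k, i ≤ k ∧ dcube t L (labelAt t L k x) ⊆ U := by
  obtain ⟨ε, hε, hball⟩ := Metric.isOpen_iff.1 hU x hx
  have : Filter.Tendsto (fun k : ℕ => L / 2 ^ k) Filter.atTop (nhds 0) := by
    have := (tendsto_pow_atTop_nhds_zero_of_lt_one (r := (1 / 2 : ℝ)) (by norm_num)
      (by norm_num)).const_mul L
    simpa [div_eq_mul_inv] using this
  obtain ⟨k, hk1, hk2⟩ := ((this.eventually (gt_mem_nhds hε)).and
    (Filter.eventually_ge_atTop i)).exists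
  refine ⟨k, hk2, fun y hy => hball ?_⟩
  rw [Metric.mem_ball]
  refine lt_of_le_of_lt ((dist_pi_le_iff (by positivity)).2 fun j => ?_) hk1
  have hx' := mem_dcube_labelAt (t := t) (L := L) k x
  rw [dcube_eq_pi hL] at hx' hy
  have h1 := hx' j trivial
  have h2 := hy j trivial
  have hs : side L (labelAt t L k x) = L / 2 ^ k := rfl
  rw [hs] at h1 h2
  rw [Real.dist_eq, abs_le]
  constructor <;> linarith [h1.1, h1.2, h2.1, h2.2]

end SparseHormander

/-! ### Dyadic Carleson embedding for an arbitrary measure -/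

namespace SparseHormander

/-- The constant in `tsum_dyadic_lt_le`. -/
noncomputable def geomConst (a : ℝ) : ℝ≥0∞ := (1 - (2 : ℝ≥0∞) ^ (-a))⁻¹

lemma geomConst_ne_top {a : ℝ} (ha : 0 < a) : geomConst a ≠ ∞ := by
  have : (2 : ℝ≥0∞) ^ (-a) < 1 :=
    ENNReal.rpow_lt_one_of_one_lt_of_neg (by norm_num) (by linarith)
  simpa [geomConst, tsub_eq_zero_iff_le] using this

lemma geomConst_ne_zero (a : ℝ) : geomConst a ≠ 0 := by
  simp [geomConst]

lemma exists_rpow_lt_le {G : ℝ≥0∞} (h0 : G ≠ 0) (h1 : G ≠ ∞) :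
    ∃ k : ℤ, (2 : ℝ≥0∞) ^ (k : ℝ) < G ∧ G ≤ (2 : ℝ≥0∞) ^ ((k : ℝ) + 1) := by
  obtain ⟨k, hk1, hk2⟩ := ENNReal.exists_mem_Ioc_zpow h0 h1 (y := 2) (by norm_num) (by simp)
  refine ⟨k, by rwa [ENNReal.rpow_intCast], ?_⟩
  have : ((k : ℝ) + 1) = ((k + 1 : ℤ) : ℝ) := by push_cast; ring
  rwa [this, ENNReal.rpow_intCast]

/-- A geometric series is comparable to its largest term, here at most `G^a`. -/
lemma tsum_dyadic_lt_le {a : ℝ} (ha : 0 < a) (G : ℝ≥0∞) :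
    ∑' k : ℤ, (if (2 : ℝ≥0∞) ^ (k : ℝ) < G then (2 : ℝ≥0∞) ^ ((k : ℝ) * a) else 0) ≤
      geomConst a * G ^ a := by
  rcases eq_or_ne G 0 with rfl | h0
  · simp
  rcases eq_or_ne G ∞ with rfl | h1
  · simp [ENNReal.top_rpow_of_pos ha, ENNReal.mul_top (geomConst_ne_zero a)]
  obtain ⟨k₀, hk1, hk2⟩ := exists_rpow_lt_le h0 h1
  have hinj : Function.Injective fun i : ℕ => k₀ - (i : ℤ) := by
    intro i j h
    have : k₀ - (i : ℤ) = k₀ - j := h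
    omega
  have hsupp : Function.support (fun k : ℤ =>
      if (2 : ℝ≥0∞) ^ (k : ℝ) < G then (2 : ℝ≥0∞) ^ ((k : ℝ) * a) else 0) ⊆
      Set.range fun i : ℕ => k₀ - (i : ℤ) := by
    intro k hk
    have hk' : (2 : ℝ≥0∞) ^ (k : ℝ) < G := by
      by_contra hcon
      exact hk (if_neg hcon)
    have h2 : (2 : ℝ≥0∞) ^ (k : ℝ) < 2 ^ ((k₀ : ℝ) + 1) := hk'.trans_le hk2
    have h3 : (k : ℝ) < k₀ + 1 := by
      by_contra hcon
      exact h2.not_ge (ENNReal.rpow_le_rpow_of_exponent_le (by norm_num) (not_lt.1 hcon))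
    have h4 : k < k₀ + 1 := by exact_mod_cast h3
    exact ⟨(k₀ - k).toNat, by simp only; omega⟩
  rw [← hinj.tsum_eq hsupp]
  have h2 : ∀ i : ℕ, (2 : ℝ≥0∞) ^ (((k₀ - (i : ℤ) : ℤ) : ℝ) * a) =
      2 ^ ((k₀ : ℝ) * a) * (2 ^ (-a)) ^ i := by
    intro i
    rw [← ENNReal.rpow_natCast, ← ENNReal.rpow_mul, ← ENNReal.rpow_add _ _ (by simp) (by simp)]
    congr 1
    push_cast
    ring
  calc _ ≤ ∑' i : ℕ, 2 ^ ((k₀ : ℝ) * a) * ((2 : ℝ≥0∞) ^ (-a)) ^ i := by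
        refine ENNReal.tsum_le_tsum fun i => ?_
        rw [← h2]
        split_ifs <;> simp
    _ = geomConst a * 2 ^ ((k₀ : ℝ) * a) := by
        rw [ENNReal.tsum_mul_left, ENNReal.tsum_geometric, mul_comm, geomConst]
    _ ≤ _ := by
        gcongr
        rw [ENNReal.rpow_mul]
        exact ENNReal.rpow_le_rpow hk1.le ha.le

variable {n : ℕ} {t : Fin n → ℝ} {L : ℝ}

/-- Weak type estimate for the dyadic maximal function, at height `b`. -/
lemma measure_iUnion_lt_laverage_le (hL : 0 < L) (σ : Measure (Fin n → ℝ))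
    {g : (Fin n → ℝ) → ℝ≥0∞} (hg : Measurable g) {b : ℝ≥0∞} (hb0 : b ≠ 0) (hb : b ≠ ∞)
    (S : Set (Label n)) (hS : ∀ Q ∈ S, 2 * b < ⨍⁻ x in dcube t L Q, g x ∂σ) :
    σ (⋃ Q ∈ S, dcube t L Q) ≤ b⁻¹ * ∫⁻ x, {x | b < g x}.indicator g x ∂σ := by
  have hm : MeasurableSet {x | b < g x} := measurableSet_lt measurable_const hg
  have key : b * σ (⋃ Q ∈ S, dcube t L Q) ≤
      (σ.withDensity ({x | b < g x}.indicator g)) (⋃ Q ∈ S, dcube t L Q) := by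
    refine packing hL S fun Q hQ => ?_
    have h1 := hS Q hQ
    rw [setLAverage_eq] at h1
    -- Over a set of infinite measure the average is 0 by the convention for division, which is not
    -- above `2b`.
    have hfin : σ (dcube t L Q) ≠ ∞ := by
      intro h
      simp [h] at h1
    have h2 : 2 * b * σ (dcube t L Q) ≤ ∫⁻ x in dcube t L Q, g x ∂σ :=
      ENNReal.mul_le_of_le_div h1.le
    rw [withDensity_apply _ (measurableSet_dcube hL Q)]
    -- The part where `g ≤ b` contributes at most `b σ(Q)`, which is half of the lower bound; the
    -- part where `g > b` must supply the rest.
    have h3 : ∫⁻ x in dcube t L Q, g x ∂σ ≤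
        ∫⁻ x in dcube t L Q, {x | b < g x}.indicator g x ∂σ + b * σ (dcube t L Q) := by
      rw [← setLIntegral_const, ← lintegral_add_right _ measurable_const]
      refine lintegral_mono fun x => ?_
      by_cases hx : b < g x
      · simp [Set.indicator, hx]
      · rw [Set.indicator_of_notMem (show x ∉ {x | b < g x} from hx), zero_add]
        exact not_lt.1 hx
    have h4 : b * σ (dcube t L Q) ≠ ∞ := ENNReal.mul_ne_top hb hfin
    have h5 : b * σ (dcube t L Q) + b * σ (dcube t L Q) ≤
        ∫⁻ x in dcube t L Q, {x | b < g x}.indicator g x ∂σ + b * σ (dcube t L Q) := by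
      rw [← two_mul, ← mul_assoc]; exact h2.trans h3
    exact (ENNReal.add_le_add_iff_right h4).1 h5
  rw [mul_comm, ← div_eq_mul_inv, ENNReal.le_div_iff_mul_le (Or.inl hb0) (Or.inl hb), mul_comm]
  refine key.trans ((measure_mono (Set.subset_univ _)).trans_eq ?_)
  rw [withDensity_apply _ MeasurableSet.univ, Measure.restrict_univ]

/-- The constant in the dyadic embedding theorem. -/
noncomputable def embedConst (s : ℝ) : ℝ≥0∞ := 2 ^ (2 * s) * geomConst (s - 1)

lemma embedConst_ne_top {s : ℝ} (hs : 1 < s) : embedConst s ≠ ∞ :=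
  ENNReal.mul_ne_top (ENNReal.rpow_ne_top_of_nonneg (by linarith) (by simp))
    (geomConst_ne_top (by linarith))

/-- Carleson embedding for disjoint subsets of dyadic cubes. -/
lemma sum_laverage_rpow_le (hL : 0 < L) (σ : Measure (Fin n → ℝ)) {s : ℝ} (hs : 1 < s)
    {g : (Fin n → ℝ) → ℝ≥0∞} (hg : Measurable g) {ι : Type*} (F : Finset ι) (Q : ι → Label n)
    (E : ι → Set (Fin n → ℝ)) (hE : ∀ j ∈ F, MeasurableSet (E j))
    (hEQ : ∀ j ∈ F, E j ⊆ dcube t L (Q j)) (hdis : (F : Set ι).PairwiseDisjoint E)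
    (hfin : ∀ j ∈ F, ⨍⁻ x in dcube t L (Q j), g x ∂σ ≠ ∞) :
    ∑ j ∈ F, (⨍⁻ x in dcube t L (Q j), g x ∂σ) ^ s * σ (E j) ≤
      embedConst s * ∫⁻ x, g x ^ s ∂σ := by
  classical
  set A : ι → ℝ≥0∞ := fun j => ⨍⁻ x in dcube t L (Q j), g x ∂σ with hA
  have two0 : (2 : ℝ≥0∞) ≠ 0 := by simp
  have twot : (2 : ℝ≥0∞) ≠ ∞ := by simp
  -- The term with `2^k < A j ≤ 2^{k+1}` already suffices; keeping the smaller `k` decouples the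
  -- levels.
  have h1 : ∀ j ∈ F, A j ^ s ≤
      ∑' k : ℤ, if (2 : ℝ≥0∞) ^ (k : ℝ) < A j then (2 : ℝ≥0∞) ^ (((k : ℝ) + 1) * s) else 0 := by
    intro j hj
    rcases eq_or_ne (A j) 0 with h0 | h0
    · rw [h0, ENNReal.zero_rpow_of_pos (by linarith)]; exact zero_le
    obtain ⟨k, hk1, hk2⟩ := exists_rpow_lt_le h0 (hfin j hj)
    refine le_trans ?_ (ENNReal.le_tsum k)
    rw [if_pos hk1, ENNReal.rpow_mul]
    exact ENNReal.rpow_le_rpow hk2 (by linarith)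
  -- At level `k` the disjoint sets `E j` lie in the union of the cubes with average above `2^k = 2
  -- · 2^{k-1}`, so the weak type estimate applies at height `2^{k-1}`.
  have h2 : ∀ k : ℤ, ∑ j ∈ F, (if (2 : ℝ≥0∞) ^ (k : ℝ) < A j then
      (2 : ℝ≥0∞) ^ (((k : ℝ) + 1) * s) else 0) * σ (E j) ≤
      2 ^ (((k : ℝ) + 1) * s) * ((2 ^ ((k : ℝ) - 1))⁻¹ *
        ∫⁻ x, {x | 2 ^ ((k : ℝ) - 1) < g x}.indicator g x ∂σ) := by
    intro k
    set F' := F.filter fun j => (2 : ℝ≥0∞) ^ (k : ℝ) < A j with hF'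
    have e1 : ∑ j ∈ F, (if (2 : ℝ≥0∞) ^ (k : ℝ) < A j then
        (2 : ℝ≥0∞) ^ (((k : ℝ) + 1) * s) else 0) * σ (E j) =
        2 ^ (((k : ℝ) + 1) * s) * ∑ j ∈ F', σ (E j) := by
      rw [Finset.mul_sum, hF', Finset.sum_filter]
      refine Finset.sum_congr rfl fun j _ => ?_
      split_ifs <;> simp
    rw [e1]
    gcongr
    rw [← measure_biUnion_finset (hdis.subset (Finset.coe_subset.2 (Finset.filter_subset _ _)))
      (fun j hj => hE j (Finset.mem_filter.1 hj).1)]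
    refine le_trans (measure_mono ?_) (measure_iUnion_lt_laverage_le (t := t) hL σ hg
      (b := 2 ^ ((k : ℝ) - 1)) (ENNReal.rpow_pos (by simp) twot).ne'
      (ENNReal.rpow_ne_top_of_ne_zero two0 twot)
      (Q '' F') ?_)
    · refine Set.iUnion₂_subset fun j hj => ?_
      exact (hEQ j (Finset.mem_filter.1 hj).1).trans
        (Set.subset_biUnion_of_mem (u := fun R => dcube t L R) ⟨j, hj, rfl⟩)
    · rintro _ ⟨j, hj, rfl⟩
      have := (Finset.mem_filter.1 hj).2
      convert this using 1
      rw [ENNReal.rpow_sub _ _ two0 twot, ENNReal.rpow_one, ENNReal.mul_div_cancel two0 twot]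
  have h3 : ∀ x, ∑' k : ℤ, 2 ^ (((k : ℝ) + 1) * s) * ((2 ^ ((k : ℝ) - 1))⁻¹ *
      {x | 2 ^ ((k : ℝ) - 1) < g x}.indicator g x) ≤ embedConst s * g x ^ s := by
    -- After the shift `k ↦ k + 1` the sum is a multiple of `g(x) ∑ 2^{k(s-1)}` over `2^k < g(x)`;
    -- it converges because `s > 1`.
    intro x
    rw [← (Equiv.addRight (1 : ℤ)).tsum_eq]
    have : ∀ k : ℤ, (2 : ℝ≥0∞) ^ (((((Equiv.addRight (1 : ℤ)) k : ℤ) : ℝ) + 1) * s) *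
        ((2 ^ ((((Equiv.addRight (1 : ℤ)) k : ℤ) : ℝ) - 1))⁻¹ *
        {x | 2 ^ ((((Equiv.addRight (1 : ℤ)) k : ℤ) : ℝ) - 1) < g x}.indicator g x) =
        2 ^ (2 * s) * g x *
          (if (2 : ℝ≥0∞) ^ (k : ℝ) < g x then (2 : ℝ≥0∞) ^ ((k : ℝ) * (s - 1)) else 0) := by
      intro k
      have e : (((Equiv.addRight (1 : ℤ)) k : ℤ) : ℝ) = k + 1 := by simp
      rw [e, add_sub_cancel_right]
      by_cases hx : (2 : ℝ≥0∞) ^ (k : ℝ) < g x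
      · simp only [Set.indicator, Set.mem_ofPred_eq, hx, if_true]
        rw [← ENNReal.rpow_neg, mul_comm _ (g x), mul_left_comm, mul_comm (2 ^ (2 * s)) (g x),
          mul_assoc]
        congr 1
        rw [← ENNReal.rpow_add _ _ two0 twot, ← ENNReal.rpow_add _ _ two0 twot]
        congr 1
        ring
      · rw [Set.indicator_of_notMem (show x ∉ {x | 2 ^ (k : ℝ) < g x} from hx), if_neg hx, mul_zero, mul_zero, mul_zero]
    rw [tsum_congr this, ENNReal.tsum_mul_left]
    calc _ ≤ 2 ^ (2 * s) * g x * (geomConst (s - 1) * g x ^ (s - 1)) := by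
          gcongr
          exact tsum_dyadic_lt_le (by linarith) _
      _ = embedConst s * (g x ^ (1 : ℝ) * g x ^ (s - 1)) := by
          rw [embedConst, ENNReal.rpow_one]; ring
      _ = _ := by
          rw [← ENNReal.rpow_add_of_nonneg _ _ (by norm_num) (by linarith)]
          congr 2; ring
  calc _ ≤ ∑ j ∈ F, (∑' k : ℤ, if (2 : ℝ≥0∞) ^ (k : ℝ) < A j then
        (2 : ℝ≥0∞) ^ (((k : ℝ) + 1) * s) else 0) * σ (E j) :=
        Finset.sum_le_sum fun j hj => mul_le_mul_left (h1 j hj) _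
    _ = ∑' k : ℤ, ∑ j ∈ F, (if (2 : ℝ≥0∞) ^ (k : ℝ) < A j then
        (2 : ℝ≥0∞) ^ (((k : ℝ) + 1) * s) else 0) * σ (E j) := by
        rw [Summable.tsum_finsetSum fun _ _ => ENNReal.summable]
        exact Finset.sum_congr rfl fun j _ => ENNReal.tsum_mul_right.symm
    _ ≤ ∑' k : ℤ, 2 ^ (((k : ℝ) + 1) * s) * ((2 ^ ((k : ℝ) - 1))⁻¹ *
        ∫⁻ x, {x | 2 ^ ((k : ℝ) - 1) < g x}.indicator g x ∂σ) := ENNReal.tsum_le_tsum h2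
    _ = ∫⁻ x, ∑' k : ℤ, 2 ^ (((k : ℝ) + 1) * s) * ((2 ^ ((k : ℝ) - 1))⁻¹ *
        {x | 2 ^ ((k : ℝ) - 1) < g x}.indicator g x) ∂σ := by
        have hmk : ∀ k : ℤ, Measurable fun x => {x | (2 : ℝ≥0∞) ^ ((k : ℝ) - 1) < g x}.indicator g x :=
          fun k => hg.indicator (measurableSet_lt measurable_const hg)
        rw [lintegral_tsum fun k => (((hmk k).const_mul _).const_mul _).aemeasurable]
        refine tsum_congr fun k => ?_
        rw [lintegral_const_mul _ ((hmk k).const_mul _), lintegral_const_mul _ (hmk k)]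
    _ ≤ ∫⁻ x, embedConst s * g x ^ s ∂σ := lintegral_mono h3
    _ = _ := lintegral_const_mul _ (hg.pow_const s)

/-- Carleson embedding for cubes taken from finitely many dyadic grids. -/
lemma sum_laverage_rpow_le_grids {T : Type*} [Fintype T] (t : T → Fin n → ℝ) (hL : 0 < L)
    (σ : Measure (Fin n → ℝ)) {s : ℝ} (hs : 1 < s)
    {g : (Fin n → ℝ) → ℝ≥0∞} (hg : Measurable g) {ι : Type*} (F : Finset ι) (Q : ι → Label n)
    (τ : ι → T) (E : ι → Set (Fin n → ℝ)) (hE : ∀ j ∈ F, MeasurableSet (E j))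
    (hEQ : ∀ j ∈ F, E j ⊆ dcube (t (τ j)) L (Q j)) (hdis : (F : Set ι).PairwiseDisjoint E)
    (hfin : ∀ j ∈ F, ⨍⁻ x in dcube (t (τ j)) L (Q j), g x ∂σ ≠ ∞) :
    ∑ j ∈ F, (⨍⁻ x in dcube (t (τ j)) L (Q j), g x ∂σ) ^ s * σ (E j) ≤
      Fintype.card T * embedConst s * ∫⁻ x, g x ^ s ∂σ := by
  classical
  rw [← Finset.sum_fiberwise_of_maps_to (s := F) (t := Finset.univ) (g := τ) (fun _ _ => by simp)]
  calc _ ≤ ∑ _c : T, embedConst s * ∫⁻ x, g x ^ s ∂σ := by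
        refine Finset.sum_le_sum fun c _ => ?_
        have hmem : ∀ j, j ∈ F.filter (fun j => τ j = c) ↔ j ∈ F ∧ τ j = c := by simp
        refine le_trans (le_of_eq (Finset.sum_congr rfl fun j hj => ?_))
          (sum_laverage_rpow_le (t := t c) hL σ hs hg (F.filter fun j => τ j = c) Q E
            (fun j hj => hE j ((hmem j).1 hj).1)
            (fun j hj => ((hmem j).1 hj).2 ▸ hEQ j ((hmem j).1 hj).1)
            (hdis.subset (Finset.coe_subset.2 (Finset.filter_subset _ _)))
            (fun j hj => ((hmem j).1 hj).2 ▸ hfin j ((hmem j).1 hj).1))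
        rw [((hmem j).1 hj).2]
    _ = _ := by simp [mul_assoc]

end SparseHormander

/-! ### Averages of the weights and Hölder inequalities -/

namespace SparseHormander

/-- The exponential as a map into `ℝ≥0∞`. -/
noncomputable def eexp (a : ℝ) : ℝ≥0∞ := ENNReal.ofReal (Real.exp a)

lemma exists_eexp {x : ℝ≥0∞} (h0 : x ≠ 0) (h1 : x ≠ ∞) : ∃ a, x = eexp a := by
  refine ⟨Real.log x.toReal, ?_⟩
  rw [eexp, Real.exp_log (ENNReal.toReal_pos h0 h1), ENNReal.ofReal_toReal h1]

lemma eexp_add (a b : ℝ) : eexp a * eexp b = eexp (a + b) := by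
  rw [eexp, eexp, eexp, Real.exp_add, ENNReal.ofReal_mul (Real.exp_pos _).le]

lemma eexp_rpow (a b : ℝ) : eexp a ^ b = eexp (a * b) := by
  rw [eexp, eexp, ENNReal.ofReal_rpow_of_pos (Real.exp_pos _), Real.exp_mul]

lemma eexp_prod {ι : Type*} (s : Finset ι) (a : ι → ℝ) :
    ∏ i ∈ s, eexp (a i) = eexp (∑ i ∈ s, a i) := by
  simp only [eexp]
  rw [Real.exp_sum, ENNReal.ofReal_prod_of_nonneg fun i _ => (Real.exp_pos _).le]

lemma eexp_le {a b : ℝ} : eexp a ≤ eexp b ↔ a ≤ b := by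
  rw [eexp, eexp, ENNReal.ofReal_le_ofReal_iff (Real.exp_pos _).le, Real.exp_le_exp]

lemma one_eq_eexp : (1 : ℝ≥0∞) = eexp 0 := by simp [eexp]

/-- The logarithmically linear inequality between the averages of the weights over a cube
(`v`, `s i`) and over a large subset (`v'`, `s' i`). -/
lemma weight_average_le {ι : Type*} [Fintype ι] {c d e : ι → ℝ} {b h : ℝ}
    (hb : 1 ≤ b) (hd : ∀ i, d i ≤ b * c i) (he : ∀ i, e i = d i - (1 - h) * c i)
    (hh : 0 ≤ b - (1 - h))
    {v v' A κ : ℝ≥0∞} {s s' : ι → ℝ≥0∞} (hv : v ≠ 0) (hv1 : v ≠ ∞) (hv' : v' ≠ 0) (hv1' : v' ≠ ∞)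
    (hs : ∀ i, s i ≠ 0) (hs1 : ∀ i, s i ≠ ∞) (hs' : ∀ i, s' i ≠ 0) (hs1' : ∀ i, s' i ≠ ∞)
    (hκ : κ ≠ 0) (hκ1 : κ ≠ ∞) (hA1 : A ≠ ∞)
    (h1 : v * ∏ i, s i ^ c i ≤ A) (h2 : 1 ≤ v' * ∏ i, s' i ^ c i)
    (h3 : v' ≤ κ * v) (h4 : ∀ i, s' i ≤ κ * s i) :
    v * ∏ i, s i ^ d i ≤
      κ ^ (b - 1 + ∑ i, (b * c i - d i)) * A ^ b * (v' ^ h * ∏ i, s' i ^ e i) := by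
  have hA : A ≠ 0 := by
    rintro rfl
    rw [nonpos_iff_eq_zero, mul_eq_zero, Finset.prod_eq_zero_iff] at h1
    rcases h1 with h1 | ⟨i, -, h1⟩
    · exact hv h1
    · exact (ENNReal.rpow_pos (pos_iff_ne_zero.2 (hs i)) (hs1 i)).ne' h1
  -- All quantities are positive and finite, so logarithms make the claim linear. Multiplicatively:
  -- extract `(v ∏ s^c)^b ≤ A^b`; what remains are the nonpositive exponents `1 - b` and `d - b c`,
  -- so `v` and `s` may be replaced by `v'/κ` and `s'/κ`; then multiply by `(v' ∏ s'^c)^{b-(1-h)} ≥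
  -- 1`.
  obtain ⟨v, rfl⟩ := exists_eexp hv hv1
  obtain ⟨v', rfl⟩ := exists_eexp hv' hv1'
  obtain ⟨A, rfl⟩ := exists_eexp hA hA1
  obtain ⟨k, rfl⟩ := exists_eexp hκ hκ1
  choose s hs using fun i => exists_eexp (hs i) (hs1 i)
  choose s' hs' using fun i => exists_eexp (hs' i) (hs1' i)
  simp only [hs, hs', eexp_rpow, eexp_prod, eexp_add, one_eq_eexp, eexp_le] at *
  have e1 : ∑ i, s i * d i = b * ∑ i, s i * c i - ∑ i, s i * (b * c i - d i) := by
    rw [Finset.mul_sum, ← Finset.sum_sub_distrib]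
    exact Finset.sum_congr rfl fun i _ => by ring
  have e2 : ∑ i, (s' i - k) * (b * c i - d i) ≤ ∑ i, s i * (b * c i - d i) :=
    Finset.sum_le_sum fun i _ => mul_le_mul_of_nonneg_right (by linarith [h4 i])
      (by linarith [hd i])
  have e3 : ∑ i, (s' i - k) * (b * c i - d i) =
      (b - (1 - h)) * ∑ i, s' i * c i - ∑ i, s' i * e i - k * ∑ i, (b * c i - d i) := by
    rw [Finset.mul_sum, Finset.mul_sum, ← Finset.sum_sub_distrib, ← Finset.sum_sub_distrib]
    exact Finset.sum_congr rfl fun i _ => by rw [he]; ring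
  have e4 : (b - 1) * (v' - k) ≤ (b - 1) * v :=
    mul_le_mul_of_nonneg_left (by linarith) (by linarith)
  have e5 : b * (v + ∑ i, s i * c i) ≤ b * A := mul_le_mul_of_nonneg_left h1 (by linarith)
  have e6 : 0 ≤ (b - (1 - h)) * (v' + ∑ i, s' i * c i) := mul_nonneg hh h2
  nlinarith

section Average

variable {X : Type*} [MeasurableSpace X] {μ : Measure X}

lemma setLAverage_ne_zero {D : Set X} (h0 : μ D ≠ 0) (h1 : μ D ≠ ∞)
    {f : X → ℝ≥0∞} (hf : Measurable f) (hpos : ∀ x, f x ≠ 0) : ⨍⁻ x in D, f x ∂μ ≠ 0 := by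
  rw [setLAverage_eq]
  refine ENNReal.div_ne_zero.2 ⟨?_, h1⟩
  rw [← pos_iff_ne_zero, setLIntegral_pos_iff hf]
  have : Function.support f = Set.univ := by ext x; simp [hpos x]
  rw [this, Set.univ_inter]
  exact pos_iff_ne_zero.2 h0

lemma setLAverage_mul {D : Set X} (h0 : μ D ≠ 0) (h1 : μ D ≠ ∞) (f : X → ℝ≥0∞) :
    (⨍⁻ x in D, f x ∂μ) * μ D = ∫⁻ x in D, f x ∂μ := by
  rw [setLAverage_eq, ENNReal.div_mul_cancel h0 h1]

lemma setLAverage_subset_le {D E : Set X} (hED : E ⊆ D) (h0 : μ D ≠ 0) (h1 : μ D ≠ ∞)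
    {κ : ℝ≥0∞} (hκ : μ D ≤ κ * μ E) (f : X → ℝ≥0∞) :
    ⨍⁻ x in E, f x ∂μ ≤ κ * ⨍⁻ x in D, f x ∂μ := by
  have hE1 : μ E ≠ ∞ := ne_top_of_le_ne_top h1 (measure_mono hED)
  have hE0 : μ E ≠ 0 := by
    intro h
    rw [h, mul_zero] at hκ
    exact h0 (nonpos_iff_eq_zero.1 hκ)
  rw [setLAverage_eq, setLAverage_eq]
  rw [ENNReal.div_le_iff hE0 hE1]
  calc ∫⁻ x in E, f x ∂μ ≤ ∫⁻ x in D, f x ∂μ := lintegral_mono_set hED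
    _ = (∫⁻ x in D, f x ∂μ) / μ D * μ D := (ENNReal.div_mul_cancel h0 h1).symm
    _ ≤ (∫⁻ x in D, f x ∂μ) / μ D * (κ * μ E) := by gcongr
    _ = _ := by ring

/-- If `V ∏ S_i^{c_i} = 1` pointwise then `1 ≤ ⟨V⟩ ∏ ⟨S_i⟩^{c_i}`. -/
lemma one_le_laverage_mul_prod {ι : Type*} [Fintype ι] {E : Set X} (h0 : μ E ≠ 0) (h1 : μ E ≠ ∞)
    {V : X → ℝ≥0∞} {S : ι → X → ℝ≥0∞} (hV : Measurable V) (hS : ∀ i, Measurable (S i))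
    {c : ι → ℝ} (hc : ∀ i, 0 ≤ c i) (hVS : ∀ x, V x * ∏ i, S i x ^ c i = 1) :
    1 ≤ (⨍⁻ x in E, V x ∂μ) * ∏ i, (⨍⁻ x in E, S i x ∂μ) ^ c i := by
  -- Hölder's inequality on the normalised measure with exponents `1/M` and `c_i/M`, which sum to 1;
  -- the result is raised to the power `M`.
  set M : ℝ := 1 + ∑ i, c i with hM
  have hM0 : 0 < M := by
    have : 0 ≤ ∑ i, c i := Finset.sum_nonneg fun i _ => hc i
    linarith
  have key := ENNReal.lintegral_mul_prod_norm_pow_le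
    (μ := (μ.restrict E Set.univ)⁻¹ • μ.restrict E) Finset.univ (g := V) (f := S)
    hV.aemeasurable (fun i _ => (hS i).aemeasurable) (1 / M) (p := fun i => c i / M)
    (by rw [← Finset.sum_div, ← add_div]; exact div_self hM0.ne') (by positivity)
    (fun i _ => div_nonneg (hc i) hM0.le)
  have hint : ∀ x, V x ^ (1 / M) * ∏ i, S i x ^ (c i / M) = 1 := by
    intro x
    have : (V x * ∏ i, S i x ^ c i) ^ (1 / M) = 1 := by rw [hVS, ENNReal.one_rpow]
    rw [← this, ENNReal.mul_rpow_of_nonneg _ _ (by positivity : 0 ≤ 1 / M),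
      ← ENNReal.prod_rpow_of_nonneg (by positivity : 0 ≤ 1 / M)]
    congr 1
    refine Finset.prod_congr rfl fun i _ => ?_
    rw [← ENNReal.rpow_mul]; congr 1; ring
  simp only [hint] at key
  have hone : ∫⁻ _, (1 : ℝ≥0∞) ∂((μ.restrict E Set.univ)⁻¹ • μ.restrict E) = 1 := by
    rw [lintegral_one, Measure.smul_apply, Measure.restrict_apply_univ, smul_eq_mul,
      ENNReal.inv_mul_cancel h0 h1]
  rw [hone] at key
  have h2 := ENNReal.rpow_le_rpow key hM0.le
  rw [ENNReal.one_rpow, ENNReal.mul_rpow_of_nonneg _ _ hM0.le,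
    ← ENNReal.prod_rpow_of_nonneg hM0.le, ← ENNReal.rpow_mul, one_div_mul_cancel hM0.ne',
    ENNReal.rpow_one] at h2
  refine h2.trans_eq ?_
  congr 1
  refine Finset.prod_congr rfl fun i _ => ?_
  rw [← ENNReal.rpow_mul, div_mul_cancel₀ _ hM0.ne']
  rfl

/-- Hölder's inequality for finite sums with several factors. -/
lemma sum_mul_prod_rpow_le {ι κ : Type*} [Fintype ι] (F : Finset κ) (g : κ → ℝ≥0∞)
    (f : ι → κ → ℝ≥0∞) {q : ℝ} {e : ι → ℝ} (hsum : q + ∑ i, e i = 1) (hq : 0 ≤ q)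
    (he : ∀ i, 0 ≤ e i) :
    ∑ j ∈ F, g j ^ q * ∏ i, f i j ^ e i ≤
      (∑ j ∈ F, g j) ^ q * ∏ i, (∑ j ∈ F, f i j) ^ e i := by
  -- The sum over `F` is an integral against a sum of Dirac masses.
  let : MeasurableSpace κ := ⊤
  have := ENNReal.lintegral_mul_prod_norm_pow_le
    (μ := ∑ j ∈ F, Measure.dirac j) Finset.univ (g := g) (f := f)
    measurable_from_top.aemeasurable (fun i _ => measurable_from_top.aemeasurable) q
    hsum hq (fun i _ => he i)
  have hint : ∀ h : κ → ℝ≥0∞, ∫⁻ j, h j ∂(∑ j ∈ F, Measure.dirac j) = ∑ j ∈ F, h j := by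
    intro h
    rw [lintegral_finsetSum_measure]
    simp
  simpa only [hint] using this

end Average

end SparseHormander

/-! ### A single term of the weighted sparse form -/

namespace SparseHormander

section Average

variable {X : Type*} [MeasurableSpace X] {μ : Measure X}

/-- The change of measure that separates the function from the dual weight: one factor goes to the
Carleson embedding for `S dμ`, the other to the weight constant. -/
lemma setLAverage_div_withDensity {D : Set X} (hD : MeasurableSet D) (h0 : μ D ≠ 0) (h1 : μ D ≠ ∞)
    {S h : X → ℝ≥0∞} (hS : Measurable S) (hS0 : ∀ x, S x ≠ 0) (hS1 : ∀ x, S x ≠ ∞)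
    (hh : Measurable h) (hfin : ⨍⁻ x in D, S x ∂μ ≠ ∞) :
    (⨍⁻ x in D, h x / S x ∂(μ.withDensity S)) * (⨍⁻ x in D, S x ∂μ) = ⨍⁻ x in D, h x ∂μ := by
  have h2 : ∫⁻ x in D, S x ∂μ ≠ ∞ := by
    rw [← setLAverage_mul h0 h1]; exact ENNReal.mul_ne_top hfin h1
  have h3 : ∫⁻ x in D, S x ∂μ ≠ 0 := by
    rw [← setLAverage_mul h0 h1]; exact mul_ne_zero (setLAverage_ne_zero h0 h1 hS hS0) h0
  rw [setLAverage_eq, withDensity_apply _ hD, setLAverage_eq, setLAverage_eq,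
    setLIntegral_withDensity_eq_setLIntegral_mul _ hS
      (show Measurable fun x => h x / S x from hh.div hS) hD]
  have h4 : ∀ x, (S * fun x => h x / S x) x = h x := fun x => by
    rw [Pi.mul_apply, ENNReal.mul_div_cancel (hS0 x) (hS1 x)]
  simp only [h4]
  rw [← mul_div_assoc, ENNReal.div_mul_cancel h3 h2]

/-- One term of the weighted sparse form is controlled by its restriction to the large subset. -/
lemma prod_laverage_mul_le {ι : Type*} [Fintype ι] {c d e q : ι → ℝ} {b h : ℝ}
    (hb : 1 ≤ b) (hc : ∀ i, 0 ≤ c i) (hd : ∀ i, d i ≤ b * c i)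
    (he : ∀ i, e i = d i - (1 - h) * c i)
    (hh : 0 ≤ b - (1 - h)) (hh0 : 0 ≤ h) (he0 : ∀ i, 0 ≤ e i) (hqe : ∀ i, d i = q i * e i)
    (hsum : h + ∑ i, e i = 1)
    {V : X → ℝ≥0∞} {S : ι → X → ℝ≥0∞} (hV : Measurable V) (hS : ∀ i, Measurable (S i))
    (hV0 : ∀ x, V x ≠ 0) (hS0 : ∀ i x, S i x ≠ 0) (hS1 : ∀ i x, S i x ≠ ∞)
    (hVS : ∀ x, V x * ∏ i, S i x ^ c i = 1)
    {D E : Set X} (hD : MeasurableSet D) (hE : MeasurableSet E) (hED : E ⊆ D)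
    (h0 : μ D ≠ 0) (h1 : μ D ≠ ∞) {κ : ℝ≥0∞} (hκ0 : κ ≠ 0) (hκ1 : κ ≠ ∞) (hκ : μ D ≤ κ * μ E)
    {A : ℝ≥0∞} (hA1 : A ≠ ∞) (hVD : ⨍⁻ x in D, V x ∂μ ≠ ∞) (hSD : ∀ i, ⨍⁻ x in D, S i x ∂μ ≠ ∞)
    (hA : (⨍⁻ x in D, V x ∂μ) * ∏ i, (⨍⁻ x in D, S i x ∂μ) ^ c i ≤ A)
    {f : ι → X → ℝ≥0∞} (hf : ∀ i, Measurable (f i)) :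
    (∏ i, (⨍⁻ x in D, f i x ∂μ) ^ d i) * ∫⁻ x in D, V x ∂μ ≤
      κ ^ (b - 1 + ∑ i, (b * c i - d i)) * κ * A ^ b * ((∫⁻ x in E, V x ∂μ) ^ h *
        ∏ i, ((⨍⁻ x in D, f i x / S i x ∂(μ.withDensity (S i))) ^ q i *
          μ.withDensity (S i) E) ^ e i) := by
  have hE1 : μ E ≠ ∞ := ne_top_of_le_ne_top h1 (measure_mono hED)
  have hE0 : μ E ≠ 0 := by
    intro h
    rw [h, mul_zero] at hκ
    exact h0 (nonpos_iff_eq_zero.1 hκ)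
  have sub := fun f => setLAverage_subset_le (μ := μ) hED h0 h1 hκ f
  have key := weight_average_le (e := e) hb hd he hh (setLAverage_ne_zero h0 h1 hV hV0) hVD
    (setLAverage_ne_zero hE0 hE1 hV hV0)
    (ne_top_of_le_ne_top (ENNReal.mul_ne_top hκ1 hVD) (sub V))
    (fun i => setLAverage_ne_zero h0 h1 (hS i) (hS0 i)) hSD
    (fun i => setLAverage_ne_zero hE0 hE1 (hS i) (hS0 i))
    (fun i => ne_top_of_le_ne_top (ENNReal.mul_ne_top hκ1 (hSD i)) (sub (S i)))
    hκ0 hκ1 hA1 hA (one_le_laverage_mul_prod hE0 hE1 hV hS hc hVS) (sub V) (fun i => sub (S i))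
  have hd0 : ∀ i, 0 ≤ d i := fun i => by
    have := he0 i
    rw [he] at this
    have h1 : h ≤ 1 := by linarith [Finset.sum_nonneg fun i (_ : i ∈ Finset.univ) => he0 i]
    have h2 := mul_nonneg (by linarith : 0 ≤ 1 - h) (hc i)
    linarith
  set G : ι → ℝ≥0∞ := fun i => ⨍⁻ x in D, f i x / S i x ∂(μ.withDensity (S i)) with hG
  have e1 : ∀ i, (⨍⁻ x in D, f i x ∂μ) ^ d i = G i ^ d i * (⨍⁻ x in D, S i x ∂μ) ^ d i := by
    intro i
    rw [← setLAverage_div_withDensity hD h0 h1 (hS i) (hS0 i) (hS1 i) (hf i) (hSD i),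
      ENNReal.mul_rpow_of_nonneg _ _ (hd0 i)]
  -- Since `h + ∑ e_i = 1`, the factor `μ(E)` can be distributed so that every average over `E`
  -- becomes the weighted measure of `E`.
  have e2 : μ E = μ E ^ h * ∏ i, μ E ^ e i := by
    have hp : ∏ i, μ E ^ e i = μ E ^ (∑ i, e i) := by
      obtain ⟨a, ha⟩ := exists_eexp hE0 hE1
      simp only [ha, eexp_rpow, eexp_prod, Finset.mul_sum]
    rw [hp, ← ENNReal.rpow_add _ _ hE0 hE1, hsum, ENNReal.rpow_one]
  have e3 : ∀ i, ((⨍⁻ x in D, f i x / S i x ∂(μ.withDensity (S i))) ^ q i *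
      μ.withDensity (S i) E) ^ e i =
      G i ^ d i * ((⨍⁻ x in E, S i x ∂μ) ^ e i * μ E ^ e i) := by
    intro i
    rw [withDensity_apply _ hE, ← setLAverage_mul hE0 hE1, ENNReal.mul_rpow_of_nonneg _ _ (he0 i),
      ← ENNReal.rpow_mul, ← hqe, ENNReal.mul_rpow_of_nonneg _ _ (he0 i)]
  simp only [e1, e3, Finset.prod_mul_distrib]
  rw [← setLAverage_mul h0 h1, ← setLAverage_mul hE0 hE1 V, ENNReal.mul_rpow_of_nonneg _ _ hh0]
  calc _ = (∏ i, G i ^ d i) * ((⨍⁻ x in D, V x ∂μ) * ∏ i, (⨍⁻ x in D, S i x ∂μ) ^ d i) * μ D := by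
        ring
    _ ≤ (∏ i, G i ^ d i) * (κ ^ (b - 1 + ∑ i, (b * c i - d i)) * A ^ b *
        ((⨍⁻ x in E, V x ∂μ) ^ h * ∏ i, (⨍⁻ x in E, S i x ∂μ) ^ e i)) * (κ * μ E) := by gcongr
    _ = (∏ i, G i ^ d i) * (κ ^ (b - 1 + ∑ i, (b * c i - d i)) * A ^ b *
        ((⨍⁻ x in E, V x ∂μ) ^ h * ∏ i, (⨍⁻ x in E, S i x ∂μ) ^ e i)) *
        (κ * (μ E ^ h * ∏ i, μ E ^ e i)) := by rw [← e2]
    _ = _ := by ring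

/-- A family of sets `D j` with subsets `E j` carries a Carleson embedding with constants `Cem`. -/
def HasEmbedding (μ : Measure X) {κ : Type*} (F : Finset κ) (D E : κ → Set X)
    (Cem : ℝ → ℝ≥0∞) : Prop :=
  ∀ (s : ℝ), 1 < s → ∀ (S : X → ℝ≥0∞), Measurable S → ∀ g : X → ℝ≥0∞, Measurable g →
    (∀ j ∈ F, ⨍⁻ x in D j, g x ∂(μ.withDensity S) ≠ ∞) →
    ∑ j ∈ F, (⨍⁻ x in D j, g x ∂(μ.withDensity S)) ^ s * μ.withDensity S (E j) ≤
      Cem s * ∫⁻ x, g x ^ s ∂(μ.withDensity S)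

lemma sum_rpow_le_sum_rpow {κ : Type*} (F : Finset κ) (a : κ → ℝ≥0∞) {p : ℝ} (hp0 : 0 < p)
    (hp : p ≤ 1) : (∑ j ∈ F, a j) ^ p ≤ ∑ j ∈ F, a j ^ p := by
  classical
  induction F using Finset.induction with
  | empty => simp [hp0]
  | insert j F hj ih =>
    rw [Finset.sum_insert hj, Finset.sum_insert hj]
    exact (ENNReal.rpow_add_le_add_rpow _ _ hp0.le hp).trans (by gcongr)

/-- `I ≤ K I^{1-1/p}` implies `I ≤ K^p`. -/
lemma le_rpow_of_le_mul_rpow {I K : ℝ≥0∞} {p : ℝ} (hp : 0 < p) (hI : I ≠ ∞)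
    (h : I ≤ K * I ^ (1 - 1 / p)) : I ≤ K ^ p := by
  rcases eq_or_ne I 0 with rfl | h0
  · exact zero_le
  have h1 : I ^ (1 / p) * I ^ (1 - 1 / p) ≤ K * I ^ (1 - 1 / p) := by
    rw [← ENNReal.rpow_add _ _ h0 hI]
    simpa using h
  have h2 : I ^ (1 / p) ≤ K := by
    refine (ENNReal.mul_le_mul_iff_left (ENNReal.rpow_pos (pos_iff_ne_zero.2 h0) hI).ne' ?_).1 h1
    exact ENNReal.rpow_ne_top_of_ne_zero h0 hI
  calc I = (I ^ (1 / p)) ^ p := by rw [← ENNReal.rpow_mul, one_div_mul_cancel hp.ne', ENNReal.rpow_one]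
    _ ≤ _ := ENNReal.rpow_le_rpow h2 hp.le

end Average

end SparseHormander

/-! ### Summation of the sparse form for `p ≤ 1` and `p > 1` -/

namespace SparseHormander

section

variable {X : Type*} [MeasurableSpace X] {μ : Measure X} {ι κ : Type*} [Fintype ι]

/-- Sparse bound for `p ≤ 1`, assuming the estimate of each term. -/
lemma lintegral_sparse_rpow_le_of_le_one {p : ℝ} (hp0 : 0 < p) (hp1 : p ≤ 1) {r : ℝ}
    {q e : ι → ℝ} (hq : ∀ i, 1 < q i) (he : ∀ i, 0 ≤ e i) (hsum : ∑ i, e i = 1)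
    {V : X → ℝ≥0∞} {S : ι → X → ℝ≥0∞} (hV : Measurable V) (hS : ∀ i, Measurable (S i))
    {F : Finset κ} {D E : κ → Set X} {Cem : ℝ → ℝ≥0∞} (hemb : HasEmbedding μ F D E Cem)
    (hD : ∀ j ∈ F, MeasurableSet (D j))
    {f : ι → X → ℝ≥0∞} (hf : ∀ i, Measurable (f i)) {K : ℝ≥0∞}
    (hfin : ∀ i, ∀ j ∈ F, ⨍⁻ x in D j, f i x / S i x ∂(μ.withDensity (S i)) ≠ ∞)
    (hterm : ∀ j ∈ F, (∏ i, (⨍⁻ x in D j, f i x ∂μ) ^ (p / r)) * ∫⁻ x in D j, V x ∂μ ≤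
      K * ∏ i, ((⨍⁻ x in D j, f i x / S i x ∂(μ.withDensity (S i))) ^ q i *
          μ.withDensity (S i) (E j)) ^ e i) :
    ∫⁻ x, (∑ j ∈ F, (D j).indicator (fun _ => ∏ i, (⨍⁻ x in D j, f i x ∂μ) ^ (1 / r)) x) ^ p *
      V x ∂μ ≤
      K * ∏ i, (Cem (q i) * ∫⁻ x, (f i x / S i x) ^ q i ∂(μ.withDensity (S i))) ^ e i := by
  calc _ ≤ ∫⁻ x, ∑ j ∈ F, (∏ i, (⨍⁻ x in D j, f i x ∂μ) ^ (p / r)) *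
        (D j).indicator V x ∂μ := by
        refine lintegral_mono fun x => ?_
        refine (mul_le_mul_left (sum_rpow_le_sum_rpow F _ hp0 hp1) _).trans ?_
        rw [Finset.sum_mul]
        refine Finset.sum_le_sum fun j _ => ?_
        by_cases hx : x ∈ D j
        · rw [Set.indicator_of_mem hx, Set.indicator_of_mem hx,
            ← ENNReal.prod_rpow_of_nonneg hp0.le]
          refine le_of_eq ?_
          congr 1
          refine Finset.prod_congr rfl fun i _ => ?_
          rw [← ENNReal.rpow_mul]; congr 1; ring
        · simp [hx, hp0]
    _ = ∑ j ∈ F, (∏ i, (⨍⁻ x in D j, f i x ∂μ) ^ (p / r)) * ∫⁻ x in D j, V x ∂μ := by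
        rw [lintegral_finsetSum' _ fun j hj => ((hV.indicator (hD j hj)).const_mul _).aemeasurable]
        refine Finset.sum_congr rfl fun j hj => ?_
        rw [lintegral_const_mul _ (hV.indicator (hD j hj)), lintegral_indicator (hD j hj)]
    _ ≤ ∑ j ∈ F, K * ∏ i, ((⨍⁻ x in D j, f i x / S i x ∂(μ.withDensity (S i))) ^ q i *
          μ.withDensity (S i) (E j)) ^ e i := Finset.sum_le_sum hterm
    _ ≤ K * ∏ i, (∑ j ∈ F, (⨍⁻ x in D j, f i x / S i x ∂(μ.withDensity (S i))) ^ q i *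
          μ.withDensity (S i) (E j)) ^ e i := by
        rw [← Finset.mul_sum]
        gcongr
        -- Hölder's inequality without a dual factor: the constant function enters with exponent 0.
        have := sum_mul_prod_rpow_le F (fun _ => 1)
          (fun i j => (⨍⁻ x in D j, f i x / S i x ∂(μ.withDensity (S i))) ^ q i *
          μ.withDensity (S i) (E j)) (q := 0) (e := e) (by linarith) le_rfl he
        simpa using this
    _ ≤ _ := by
        gcongr with i
        · exact he i
        · exact hemb (q i) (hq i) (S i) (hS i) _ ((hf i).div (hS i)) (hfin i)

/-- Sparse bound for `p > 1` (by duality), assuming the estimate of each term. -/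
lemma lintegral_sparse_rpow_le_of_one_lt {p : ℝ} (hp1 : 1 < p) {r : ℝ} (hr : 0 < r)
    {q e : ι → ℝ} (hq : ∀ i, 1 < q i) (he : ∀ i, 0 ≤ e i) (hsum : 1 - 1 / p + ∑ i, e i = 1)
    {V : X → ℝ≥0∞} {S : ι → X → ℝ≥0∞} (hV : Measurable V) (hS : ∀ i, Measurable (S i))
    {F : Finset κ} {D E : κ → Set X} {Cem : ℝ → ℝ≥0∞} (hemb : HasEmbedding μ F D E Cem)
    (hD : ∀ j ∈ F, MeasurableSet (D j))
    {f : ι → X → ℝ≥0∞} (hf : ∀ i, Measurable (f i)) {K : ℝ≥0∞}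
    (hffin : ∀ i, ∀ j ∈ F, ⨍⁻ x in D j, f i x ∂μ ≠ ∞)
    (hVD0 : ∀ j ∈ F, ∫⁻ x in D j, V x ∂μ ≠ 0) (hVD1 : ∀ j ∈ F, ∫⁻ x in D j, V x ∂μ ≠ ∞)
    (hfin : ∀ i, ∀ j ∈ F, ⨍⁻ x in D j, f i x / S i x ∂(μ.withDensity (S i)) ≠ ∞)
    (hterm : ∀ j ∈ F, (∏ i, (⨍⁻ x in D j, f i x ∂μ) ^ (1 / r)) * ∫⁻ x in D j, V x ∂μ ≤
      K * ((μ.withDensity V (E j)) ^ (1 - 1 / p) *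
        ∏ i, ((⨍⁻ x in D j, f i x / S i x ∂(μ.withDensity (S i))) ^ q i *
          μ.withDensity (S i) (E j)) ^ e i)) :
    ∫⁻ x, (∑ j ∈ F, (D j).indicator (fun _ => ∏ i, (⨍⁻ x in D j, f i x ∂μ) ^ (1 / r)) x) ^ p *
      V x ∂μ ≤
      (K * Cem (p / (p - 1)) ^ (1 - 1 / p) *
        ∏ i, (Cem (q i) * ∫⁻ x, (f i x / S i x) ^ q i ∂(μ.withDensity (S i))) ^ e i) ^ p := by
  set a : κ → ℝ≥0∞ := fun j => ∏ i, (⨍⁻ x in D j, f i x ∂μ) ^ (1 / r) with ha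
  set G : X → ℝ≥0∞ := fun x => ∑ j ∈ F, (D j).indicator (fun _ => a j) x with hG
  have hp0 : 0 < p := by linarith
  have hq0 : 0 ≤ 1 - 1 / p := by
    rw [sub_nonneg, div_le_one hp0]; exact hp1.le
  have ha1 : ∀ j ∈ F, a j ≠ ∞ := fun j hj =>
    ENNReal.prod_ne_top fun i _ => ENNReal.rpow_ne_top_of_nonneg (by positivity) (hffin i j hj)
  have hGm : Measurable G :=
    Finset.measurable_fun_sum F fun j hj => measurable_const.indicator (hD j hj)
  have hGM : ∀ x, G x ≤ ∑ j ∈ F, a j := fun x =>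
    Finset.sum_le_sum fun j _ => Set.indicator_le_self _ _ x
  have hM : ∑ j ∈ F, a j ≠ ∞ := ENNReal.sum_ne_top.2 ha1
  have hGp : Measurable fun x => G x ^ (p - 1) := hGm.pow_const _
  -- One factor `G` is expanded into the sparse sum, while `G^{p-1}` plays the part of the dual
  -- function.
  have hsplit : ∀ x, G x ^ p * V x = ∑ j ∈ F, a j * (D j).indicator (fun x => G x ^ (p - 1) * V x) x := by
    intro x
    have : G x ^ p = G x * G x ^ (p - 1) := by
      conv_rhs => rw [← ENNReal.rpow_one (G x), ← ENNReal.rpow_mul,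
        ← ENNReal.rpow_add_of_nonneg _ _ (by norm_num) (by linarith)]
      congr 1; ring
    rw [this, mul_assoc]
    nth_rewrite 1 [hG]
    rw [Finset.sum_mul]
    refine Finset.sum_congr rfl fun j _ => ?_
    by_cases hx : x ∈ D j <;> simp [hx]
  have hGVm : Measurable fun x => G x ^ (p - 1) * V x := hGp.mul hV
  have hI : ∫⁻ x, G x ^ p * V x ∂μ = ∑ j ∈ F, a j * ∫⁻ x in D j, G x ^ (p - 1) * V x ∂μ := by
    simp only [hsplit]
    rw [lintegral_finsetSum' _ fun j hj => ((hGVm.indicator (hD j hj)).const_mul _).aemeasurable]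
    refine Finset.sum_congr rfl fun j hj => ?_
    rw [lintegral_const_mul _ (hGVm.indicator (hD j hj)), lintegral_indicator (hD j hj)]
  have hloc : ∀ j ∈ F, ∫⁻ x in D j, G x ^ (p - 1) * V x ∂μ ≤
      (∑ j ∈ F, a j) ^ (p - 1) * ∫⁻ x in D j, V x ∂μ := by
    intro j _
    rw [← lintegral_const_mul _ hV]
    refine lintegral_mono fun x => ?_
    exact mul_le_mul_left (ENNReal.rpow_le_rpow (hGM x) (by linarith)) _
  -- The family is finite and the coefficients are finite, so `G` is bounded by a finite constant.
  -- Finiteness is what allows the final absorption.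
  have hIfin : ∫⁻ x, G x ^ p * V x ∂μ ≠ ∞ := by
    rw [hI]
    refine ENNReal.sum_ne_top.2 fun j hj => ENNReal.mul_ne_top (ha1 j hj) ?_
    exact ne_top_of_le_ne_top (ENNReal.mul_ne_top
      (ENNReal.rpow_ne_top_of_nonneg (by linarith) hM) (hVD1 j hj)) (hloc j hj)
  have hΦ : ∀ j ∈ F, (⨍⁻ x in D j, G x ^ (p - 1) ∂(μ.withDensity V)) * ∫⁻ x in D j, V x ∂μ =
      ∫⁻ x in D j, G x ^ (p - 1) * V x ∂μ := by
    intro j hj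
    have hw : μ.withDensity V (D j) = ∫⁻ x in D j, V x ∂μ := withDensity_apply _ (hD j hj)
    rw [← hw, setLAverage_mul (by rw [hw]; exact hVD0 j hj) (by rw [hw]; exact hVD1 j hj),
      setLIntegral_withDensity_eq_setLIntegral_mul _ hV hGp (hD j hj)]
    simp only [Pi.mul_apply, mul_comm]
  have hΦfin : ∀ j ∈ F, ⨍⁻ x in D j, G x ^ (p - 1) ∂(μ.withDensity V) ≠ ∞ := by
    intro j hj htop
    have h1 := hΦ j hj
    rw [htop, ENNReal.top_mul (hVD0 j hj)] at h1
    exact ne_top_of_le_ne_top (ENNReal.mul_ne_top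
      (ENNReal.rpow_ne_top_of_nonneg (by linarith) hM) (hVD1 j hj)) (hloc j hj) h1.symm
  refine le_rpow_of_le_mul_rpow hp0 hIfin ?_
  -- The dual function is embedded in `L^{p'}(V)` with `p' = p/(p-1)` and `1/p' = 1 - 1/p`; its
  -- `p'`-th power is again `G^p`.
  have hp' : p / (p - 1) * (1 - 1 / p) = 1 := by
    have : p - 1 ≠ 0 := by linarith
    field_simp
  set Φ : κ → ℝ≥0∞ := fun j => ⨍⁻ x in D j, G x ^ (p - 1) ∂(μ.withDensity V) with hΦdef
  calc ∫⁻ x, G x ^ p * V x ∂μ = ∑ j ∈ F, Φ j * (a j * ∫⁻ x in D j, V x ∂μ) := by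
        rw [hI]
        refine Finset.sum_congr rfl fun j hj => ?_
        rw [← hΦ j hj]; ring
    _ ≤ ∑ j ∈ F, Φ j * (K * ((μ.withDensity V (E j)) ^ (1 - 1 / p) *
        ∏ i, ((⨍⁻ x in D j, f i x / S i x ∂(μ.withDensity (S i))) ^ q i *
          μ.withDensity (S i) (E j)) ^ e i)) :=
        Finset.sum_le_sum fun j hj => mul_le_mul_right (hterm j hj) _
    _ = K * ∑ j ∈ F, (Φ j ^ (p / (p - 1)) * μ.withDensity V (E j)) ^ (1 - 1 / p) *
        ∏ i, ((⨍⁻ x in D j, f i x / S i x ∂(μ.withDensity (S i))) ^ q i *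
          μ.withDensity (S i) (E j)) ^ e i := by
        rw [Finset.mul_sum]
        refine Finset.sum_congr rfl fun j _ => ?_
        rw [ENNReal.mul_rpow_of_nonneg _ _ hq0, ← ENNReal.rpow_mul, hp', ENNReal.rpow_one]
        ring
    _ ≤ K * ((∑ j ∈ F, Φ j ^ (p / (p - 1)) * μ.withDensity V (E j)) ^ (1 - 1 / p) *
        ∏ i, (∑ j ∈ F, (⨍⁻ x in D j, f i x / S i x ∂(μ.withDensity (S i))) ^ q i *
          μ.withDensity (S i) (E j)) ^ e i) := by
        gcongr
        exact sum_mul_prod_rpow_le F _ _ hsum hq0 he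
    _ ≤ K * ((Cem (p / (p - 1)) * ∫⁻ x, (G x ^ (p - 1)) ^ (p / (p - 1)) ∂(μ.withDensity V))
          ^ (1 - 1 / p) *
        ∏ i, (Cem (q i) * ∫⁻ x, (f i x / S i x) ^ q i ∂(μ.withDensity (S i))) ^ e i) := by
        gcongr with i
        · refine hemb (p / (p - 1)) ?_ V hV _ hGp hΦfin
          rw [lt_div_iff₀ (by linarith)]; linarith
        · exact he i
        · exact hemb (q i) (hq i) (S i) (hS i) _ ((hf i).div (hS i)) (hfin i)
    _ = _ := by
        have : ∫⁻ x, (G x ^ (p - 1)) ^ (p / (p - 1)) ∂(μ.withDensity V) =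
            ∫⁻ x, G x ^ p * V x ∂μ := by
          rw [lintegral_withDensity_eq_lintegral_mul _ hV (hGp.pow_const _)]
          refine lintegral_congr fun x => ?_
          rw [Pi.mul_apply, ← ENNReal.rpow_mul, mul_div_cancel₀ _ (by linarith : p - 1 ≠ 0), mul_comm]
        rw [this, ENNReal.mul_rpow_of_nonneg _ _ hq0]
        ring

end

end SparseHormander

/-! ### The weighted bound for the sparse operator -/

namespace SparseHormander

/-- No factor vanishes, so one infinite factor would make the product infinite. Local integrability
of the weights is thus obtained from the finiteness of the weight constant. -/
lemma ne_top_of_mul_prod_rpow_ne_top {ι : Type*} [Fintype ι] {v : ℝ≥0∞} {s : ι → ℝ≥0∞} {c : ι → ℝ}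
    (hc : ∀ i, 0 < c i) (hv : v ≠ 0) (hs : ∀ i, s i ≠ 0)
    (h : v * ∏ i, s i ^ c i ≠ ∞) : v ≠ ∞ ∧ ∀ i, s i ≠ ∞ := by
  classical
  have h0 : ∀ i, s i ^ c i ≠ 0 := fun i h0 => by
    rcases ENNReal.rpow_eq_zero_iff.1 h0 with h1 | h1
    · exact hs i h1.1
    · linarith [hc i, h1.2]
  constructor
  · rintro rfl
    exact h (ENNReal.top_mul (Finset.prod_ne_zero_iff.2 fun i _ => h0 i))
  · intro i hi
    apply h
    rw [← Finset.mul_prod_erase _ _ (Finset.mem_univ i), hi, ENNReal.top_rpow_of_pos (hc i),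
      ENNReal.top_mul (Finset.prod_ne_zero_iff.2 fun i _ => h0 i), ENNReal.mul_top hv]

variable {n m : ℕ}

lemma productWeight_pos {p : ℝ} {P : Fin m → ℝ} {w : Fin m → (Fin n → ℝ) → ℝ} {x : Fin n → ℝ}
    (hx : ∀ i, 0 < w i x) : 0 < productWeight p P w x :=
  Finset.prod_pos fun i _ => Real.rpow_pos_of_pos (hx i) _

lemma productWeight_mul_prod {r p : ℝ} {P : Fin m → ℝ} (hr : 0 < r) (hP : ∀ i, r < P i)
    {w : Fin m → (Fin n → ℝ) → ℝ} {x : Fin n → ℝ} (hx : ∀ i, 0 < w i x) :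
    ENNReal.ofReal (productWeight p P w x) *
      ∏ i, ENNReal.ofReal (w i x ^ (-(r / (P i - r)))) ^ (p * (P i - r) / (P i * r)) = 1 := by
  have h : ∀ i, ENNReal.ofReal (w i x ^ (-(r / (P i - r)))) ^ (p * (P i - r) / (P i * r)) =
      ENNReal.ofReal (w i x ^ (-(p / P i))) := by
    intro i
    rw [ENNReal.ofReal_rpow_of_pos (Real.rpow_pos_of_pos (hx i) _), ← Real.rpow_mul (hx i).le]
    congr 2
    have h1 : P i - r ≠ 0 := by linarith [hP i]
    have h2 : P i ≠ 0 := by linarith [hP i]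
    field_simp
  simp only [h]
  rw [← ENNReal.ofReal_prod_of_nonneg fun i _ => (Real.rpow_pos_of_pos (hx i) _).le,
    ← ENNReal.ofReal_mul (productWeight_pos hx).le, productWeight, ← Finset.prod_mul_distrib]
  have : ∀ i, w i x ^ (p / P i) * w i x ^ (-(p / P i)) = 1 := fun i => by
    rw [← Real.rpow_add (hx i), add_neg_cancel, Real.rpow_zero]
  simp [this]

/-- With `S = w^{-r/(P-r)}` one has `S^{1-P/r} = w`. Hence the `L^{P/r}(S)` integral of `|f|^r / S`
is the `L^P(w)` integral of `f`. -/
lemma dual_weight_identity {r P : ℝ} (hr : 0 < r) (hP : r < P) {w : ℝ} (hw : 0 < w) (f : ℝ≥0∞) :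
    ENNReal.ofReal (w ^ (-(r / (P - r)))) *
      (f ^ r / ENNReal.ofReal (w ^ (-(r / (P - r))))) ^ (P / r) = f ^ P * ENNReal.ofReal w := by
  have h1 : P - r ≠ 0 := by linarith
  have hS0 : ENNReal.ofReal (w ^ (-(r / (P - r)))) ≠ 0 := by
    simpa using Real.rpow_pos_of_pos hw _
  rw [ENNReal.div_rpow_of_nonneg _ _ (div_nonneg (by linarith) hr.le), ← ENNReal.rpow_mul,
    mul_div_cancel₀ _ hr.ne', ENNReal.div_eq_inv_mul, mul_comm (f ^ P), ← mul_assoc]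
  congr 1
  rw [← ENNReal.rpow_neg]
  nth_rewrite 1 [← ENNReal.rpow_one (ENNReal.ofReal (w ^ (-(r / (P - r)))))]
  rw [← ENNReal.rpow_add _ _ hS0 ENNReal.ofReal_ne_top,
    ENNReal.ofReal_rpow_of_pos (Real.rpow_pos_of_pos hw _), ← Real.rpow_mul hw.le]
  have : -(r / (P - r)) * (1 + -(P / r)) = 1 := by field_simp; ring
  rw [this, Real.rpow_one]

/-- The weighted bound for the `m`-linear sparse operator built on `L^r` averages. -/
theorem exists_sparse_bound (hm : 0 < m) {r p β : ℝ} (hr : 0 < r) {P : Fin m → ℝ}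
    (hP : ∀ i, r < P i) (hp : 1 / p = ∑ i, 1 / P i) (hβ1 : 1 ≤ β)
    (hβ : ∀ i, P i / (P i - r) / p ≤ β) {κ : ℝ≥0∞} (hκ0 : κ ≠ 0) (hκ1 : κ ≠ ∞)
    {Cem : ℝ → ℝ≥0∞} (hCem : ∀ s, 1 < s → Cem s ≠ ∞) :
    ∃ C : ℝ≥0∞, C ≠ ∞ ∧ ∀ w : Fin m → (Fin n → ℝ) → ℝ, (∀ i, Measurable (w i)) →
      (∀ i x, 0 < w i x) → ∀ A : ℝ≥0∞, A ≠ ∞ → ∀ {J : Type} (F : Finset J)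
      (D E : J → Set (Fin n → ℝ)), HasEmbedding volume F D E Cem →
      (∀ j ∈ F, MeasurableSet (D j)) → (∀ j ∈ F, MeasurableSet (E j)) → (∀ j ∈ F, E j ⊆ D j) →
      (∀ j ∈ F, volume (D j) ≠ 0) → (∀ j ∈ F, volume (D j) ≠ ∞) →
      (∀ j ∈ F, volume (D j) ≤ κ * volume (E j)) →
      (∀ j ∈ F, (⨍⁻ x in D j, ENNReal.ofReal (productWeight p P w x) ∂volume) *
        ∏ i, (⨍⁻ x in D j, ENNReal.ofReal (w i x ^ (-(r / (P i - r)))) ∂volume) ^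
        (p * (P i - r) / (P i * r)) ≤ A) →
      ∀ f : Fin m → (Fin n → ℝ) → ℝ≥0∞, (∀ i, Measurable (f i)) →
      (∀ i, ∀ j ∈ F, ⨍⁻ x in D j, f i x ^ r ∂volume ≠ ∞) →
      ∫⁻ x, (∑ j ∈ F, (D j).indicator
          (fun _ => ∏ i, (⨍⁻ x in D j, f i x ^ r ∂volume) ^ (1 / r)) x) ^ p *
        ENNReal.ofReal (productWeight p P w x) ≤
        (C * A ^ β) ^ p * ∏ i, (∫⁻ x, f i x ^ P i * ENNReal.ofReal (w i x)) ^ (p / P i) := by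
  have hP0 : ∀ i, 0 < P i := fun i => hr.trans (hP i)
  have hPr : ∀ i, 0 < P i - r := fun i => by linarith [hP i]
  have : Nonempty (Fin m) := ⟨⟨0, hm⟩⟩
  have hp0 : 0 < p := by
    have : 0 < 1 / p := by
      rw [hp]; exact Finset.sum_pos (fun i _ => one_div_pos.2 (hP0 i)) Finset.univ_nonempty
    exact one_div_pos.1 this
  set c : Fin m → ℝ := fun i => p * (P i - r) / (P i * r) with hc
  have hc0 : ∀ i, 0 < c i := fun i => div_pos (mul_pos hp0 (hPr i)) (mul_pos (hP0 i) hr)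
  -- Since `1/r = ((p_i/r)'/p) c_i`, the requirement on `β` says exactly that `β c_i` dominates the
  -- exponent `1/r` of `⟨S_i⟩`.
  have hβc : ∀ i, 1 / r ≤ β * c i := by
    intro i
    have h1 : 1 / r = P i / (P i - r) / p * c i := by
      have := (hP0 i).ne'; have := (hPr i).ne'; have := hp0.ne'; have := hr.ne'
      simp only [hc]; field_simp
    rw [h1]
    exact mul_le_mul_of_nonneg_right (hβ i) (hc0 i).le
  -- Because `(p_i/r)' ≥ 1`; this is the condition `1 ≤ b` for `b = βp` when `p ≤ 1`.
  have hβp : 1 ≤ β * p := by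
    have i : Fin m := Classical.arbitrary _
    have h1 := hβ i
    rw [div_le_iff₀ hp0] at h1
    refine le_trans ?_ h1
    rw [le_div_iff₀ (hPr i)]; linarith
  rcases le_or_gt p 1 with hp1 | hp1
  -- Case `p ≤ 1`: the terms are raised to the power `p`, so the parameters are `d = p/r`, `b = βp`,
  -- `h = 0`, `e_i = p/p_i`.
  · set Kκ : ℝ≥0∞ := κ ^ (β * p - 1 + ∑ i, (β * p * c i - p / r)) * κ with hKκ
    set C0 : ℝ≥0∞ := Kκ * ∏ i, Cem (P i / r) ^ (p / P i) with hC0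
    refine ⟨C0 ^ (1 / p), ?_, ?_⟩
    · refine ENNReal.rpow_ne_top_of_nonneg (by positivity) (ENNReal.mul_ne_top (ENNReal.mul_ne_top
        (ENNReal.rpow_ne_top_of_ne_zero hκ0 hκ1) hκ1) (ENNReal.prod_ne_top fun i _ => ?_))
      exact ENNReal.rpow_ne_top_of_nonneg (div_pos hp0 (hP0 i)).le
        (hCem _ ((one_lt_div hr).2 (hP i)))
    intro w hw hpos A hA1 J F D E hemb hD hE hED hD0 hD1 hDE hDA f hf hffin
    set V : (Fin n → ℝ) → ℝ≥0∞ := fun x => ENNReal.ofReal (productWeight p P w x) with hV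
    set S : Fin m → (Fin n → ℝ) → ℝ≥0∞ := fun i x => ENNReal.ofReal (w i x ^ (-(r / (P i - r))))
      with hS
    have hVm : Measurable V :=
      (Finset.measurable_fun_prod _ fun i _ => (hw i).pow_const _).ennreal_ofReal
    have hSm : ∀ i, Measurable (S i) := fun i => ((hw i).pow_const _).ennreal_ofReal
    have hV0 : ∀ x, V x ≠ 0 := fun x => by
      simpa [hV] using productWeight_pos (fun i => hpos i x)
    have hS0 : ∀ i x, S i x ≠ 0 := fun i x => by
      simpa [hS] using Real.rpow_pos_of_pos (hpos i x) _
    have hS1 : ∀ i x, S i x ≠ ∞ := fun i x => ENNReal.ofReal_ne_top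
    have hVS : ∀ x, V x * ∏ i, S i x ^ c i = 1 := fun x =>
      productWeight_mul_prod hr hP (fun i => hpos i x)
    have hfr : ∀ i, Measurable fun x => f i x ^ r := fun i => (hf i).pow_const _
    have hVSD : ∀ j ∈ F, ⨍⁻ x in D j, V x ∂volume ≠ ∞ ∧ ∀ i, ⨍⁻ x in D j, S i x ∂volume ≠ ∞ :=
      fun j hj => ne_top_of_mul_prod_rpow_ne_top hc0
        (setLAverage_ne_zero (hD0 j hj) (hD1 j hj) hVm hV0)
        (fun i => setLAverage_ne_zero (hD0 j hj) (hD1 j hj) (hSm i) (hS0 i))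
        (ne_top_of_le_ne_top hA1 (hDA j hj))
    have hfin : ∀ i, ∀ j ∈ F, ⨍⁻ x in D j, f i x ^ r / S i x ∂(volume.withDensity (S i)) ≠ ∞ := by
      intro i j hj htop
      have h1 := setLAverage_div_withDensity (hD j hj) (hD0 j hj) (hD1 j hj) (hSm i) (hS0 i) (hS1 i)
        (hfr i) ((hVSD j hj).2 i)
      rw [htop, ENNReal.top_mul (setLAverage_ne_zero (hD0 j hj) (hD1 j hj) (hSm i) (hS0 i))] at h1
      exact hffin i j hj h1.symm
    have hint : ∀ i, ∫⁻ x, (f i x ^ r / S i x) ^ (P i / r) ∂(volume.withDensity (S i)) =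
        ∫⁻ x, f i x ^ P i * ENNReal.ofReal (w i x) := by
      intro i
      rw [lintegral_withDensity_eq_lintegral_mul _ (hSm i)
        (show Measurable fun x => (f i x ^ r / S i x) ^ (P i / r) from
          ((hfr i).div (hSm i)).pow_const _)]
      exact lintegral_congr fun x => dual_weight_identity hr (hP i) (hpos i x) _
    have main := lintegral_sparse_rpow_le_of_le_one (r := r) hp0 hp1 (q := fun i => P i / r)
      (e := fun i => p / P i) (fun i => (one_lt_div hr).2 (hP i))
      (fun i => (div_pos hp0 (hP0 i)).le)
      (by
        have : ∀ i, p / P i = p * (1 / P i) := fun i => by ring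
        simp only [this]
        rw [← Finset.mul_sum, ← hp, mul_one_div_cancel hp0.ne'])
      hVm hSm hemb hD hfr (K := Kκ * A ^ (β * p)) hfin
      (by
        intro j hj
        have := prod_laverage_mul_le (c := c) (d := fun _ => p / r) (e := fun i => p / P i)
          (q := fun i => P i / r) (b := β * p) (h := 0) hβp (fun i => (hc0 i).le)
          (fun i => by
            have := mul_le_mul_of_nonneg_left (hβc i) hp0.le
            calc p / r = p * (1 / r) := by ring
              _ ≤ p * (β * c i) := this
              _ = _ := by ring)
          (fun i => by
            have := (hP0 i).ne'; have := hr.ne'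
            simp only [hc]; field_simp; ring)
          (by linarith) le_rfl (fun i => (div_pos hp0 (hP0 i)).le)
          (fun i => by
            have := (hP0 i).ne'; have := hr.ne'
            field_simp)
          (by
            have : ∀ i, p / P i = p * (1 / P i) := fun i => by ring
            simp only [this]
            rw [← Finset.mul_sum, ← hp, mul_one_div_cancel hp0.ne', zero_add])
          hVm hSm hV0 hS0 hS1 hVS (hD j hj) (hE j hj) (hED j hj) (hD0 j hj) (hD1 j hj) hκ0 hκ1
          (hDE j hj) hA1 (hVSD j hj).1 (hVSD j hj).2 (hDA j hj) hfr
        rwa [ENNReal.rpow_zero, one_mul] at this)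
    refine main.trans_eq ?_
    simp only [hint]
    rw [ENNReal.mul_rpow_of_nonneg _ _ hp0.le, ← ENNReal.rpow_mul, ← ENNReal.rpow_mul,
      one_div_mul_cancel hp0.ne', ENNReal.rpow_one, hC0]
    simp only [ENNReal.mul_rpow_of_nonneg _ _ (div_pos hp0 (hP0 _)).le, Finset.prod_mul_distrib]
    ring
  -- Case `p > 1`: the parameters are `d = 1/r`, `b = β`, `e_i = 1/p_i`, and the dual factor takes
  -- `h = 1 - 1/p`.
  · set Kκ : ℝ≥0∞ := κ ^ (β - 1 + ∑ i, (β * c i - 1 / r)) * κ with hKκ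
    set C0 : ℝ≥0∞ := Kκ * Cem (p / (p - 1)) ^ (1 - 1 / p) * ∏ i, Cem (P i / r) ^ (1 / P i) with hC0
    have hq0 : 0 ≤ 1 - 1 / p := by
      rw [sub_nonneg, div_le_one hp0]; exact hp1.le
    refine ⟨C0, ?_, ?_⟩
    · refine ENNReal.mul_ne_top (ENNReal.mul_ne_top (ENNReal.mul_ne_top
        (ENNReal.rpow_ne_top_of_ne_zero hκ0 hκ1) hκ1)
        (ENNReal.rpow_ne_top_of_nonneg hq0 (hCem _ ?_))) (ENNReal.prod_ne_top fun i _ => ?_)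
      · rw [lt_div_iff₀ (by linarith)]; linarith
      · exact ENNReal.rpow_ne_top_of_nonneg (one_div_pos.2 (hP0 i)).le
          (hCem _ ((one_lt_div hr).2 (hP i)))
    intro w hw hpos A hA1 J F D E hemb hD hE hED hD0 hD1 hDE hDA f hf hffin
    set V : (Fin n → ℝ) → ℝ≥0∞ := fun x => ENNReal.ofReal (productWeight p P w x) with hV
    set S : Fin m → (Fin n → ℝ) → ℝ≥0∞ := fun i x => ENNReal.ofReal (w i x ^ (-(r / (P i - r))))
      with hS
    have hVm : Measurable V :=
      (Finset.measurable_fun_prod _ fun i _ => (hw i).pow_const _).ennreal_ofReal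
    have hSm : ∀ i, Measurable (S i) := fun i => ((hw i).pow_const _).ennreal_ofReal
    have hV0 : ∀ x, V x ≠ 0 := fun x => by
      simpa [hV] using productWeight_pos (fun i => hpos i x)
    have hS0 : ∀ i x, S i x ≠ 0 := fun i x => by
      simpa [hS] using Real.rpow_pos_of_pos (hpos i x) _
    have hS1 : ∀ i x, S i x ≠ ∞ := fun i x => ENNReal.ofReal_ne_top
    have hVS : ∀ x, V x * ∏ i, S i x ^ c i = 1 := fun x =>
      productWeight_mul_prod hr hP (fun i => hpos i x)
    have hfr : ∀ i, Measurable fun x => f i x ^ r := fun i => (hf i).pow_const _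
    have hVD0 : ∀ j ∈ F, ⨍⁻ x in D j, V x ∂volume ≠ 0 := fun j hj =>
      setLAverage_ne_zero (hD0 j hj) (hD1 j hj) hVm hV0
    have hVSD : ∀ j ∈ F, ⨍⁻ x in D j, V x ∂volume ≠ ∞ ∧ ∀ i, ⨍⁻ x in D j, S i x ∂volume ≠ ∞ :=
      fun j hj => ne_top_of_mul_prod_rpow_ne_top hc0 (hVD0 j hj)
        (fun i => setLAverage_ne_zero (hD0 j hj) (hD1 j hj) (hSm i) (hS0 i))
        (ne_top_of_le_ne_top hA1 (hDA j hj))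
    have hfin : ∀ i, ∀ j ∈ F, ⨍⁻ x in D j, f i x ^ r / S i x ∂(volume.withDensity (S i)) ≠ ∞ := by
      intro i j hj htop
      have h1 := setLAverage_div_withDensity (hD j hj) (hD0 j hj) (hD1 j hj) (hSm i) (hS0 i) (hS1 i)
        (hfr i) ((hVSD j hj).2 i)
      rw [htop, ENNReal.top_mul (setLAverage_ne_zero (hD0 j hj) (hD1 j hj) (hSm i) (hS0 i))] at h1
      exact hffin i j hj h1.symm
    have hint : ∀ i, ∫⁻ x, (f i x ^ r / S i x) ^ (P i / r) ∂(volume.withDensity (S i)) =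
        ∫⁻ x, f i x ^ P i * ENNReal.ofReal (w i x) := by
      intro i
      rw [lintegral_withDensity_eq_lintegral_mul _ (hSm i)
        (show Measurable fun x => (f i x ^ r / S i x) ^ (P i / r) from
          ((hfr i).div (hSm i)).pow_const _)]
      exact lintegral_congr fun x => dual_weight_identity hr (hP i) (hpos i x) _
    have hsum : 1 - 1 / p + ∑ i, 1 / P i = 1 := by rw [← hp]; ring
    have main := lintegral_sparse_rpow_le_of_one_lt hp1 hr (q := fun i => P i / r)
      (e := fun i => 1 / P i) (fun i => (one_lt_div hr).2 (hP i))
      (fun i => (one_div_pos.2 (hP0 i)).le) hsum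
      hVm hSm hemb hD hfr (K := Kκ * A ^ β) hffin
      (fun j hj => by
        rw [← setLAverage_mul (hD0 j hj) (hD1 j hj)]
        exact mul_ne_zero (hVD0 j hj) (hD0 j hj))
      (fun j hj => by
        rw [← setLAverage_mul (hD0 j hj) (hD1 j hj)]
        exact ENNReal.mul_ne_top (hVSD j hj).1 (hD1 j hj))
      hfin
      (by
        intro j hj
        have := prod_laverage_mul_le (c := c) (d := fun _ => 1 / r) (e := fun i => 1 / P i)
          (q := fun i => P i / r) (b := β) (h := 1 - 1 / p) hβ1 (fun i => (hc0 i).le)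
          hβc
          (fun i => by
            have := (hP0 i).ne'; have := hr.ne'; have := hp0.ne'
            simp only [hc]; field_simp; ring)
          (by
            have : 1 / p ≤ 1 := by rw [div_le_one hp0]; exact hp1.le
            linarith) hq0 (fun i => (one_div_pos.2 (hP0 i)).le)
          (fun i => by
            have := (hP0 i).ne'; have := hr.ne'
            field_simp)
          hsum
          hVm hSm hV0 hS0 hS1 hVS (hD j hj) (hE j hj) (hED j hj) (hD0 j hj) (hD1 j hj) hκ0 hκ1
          (hDE j hj) hA1 (hVSD j hj).1 (hVSD j hj).2 (hDA j hj) hfr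
        rwa [withDensity_apply _ (hE j hj)])
    refine main.trans_eq ?_
    simp only [hint]
    simp only [ENNReal.mul_rpow_of_nonneg _ _ (one_div_pos.2 (hP0 _)).le, Finset.prod_mul_distrib]
    have hprod : ∀ I : Fin m → ℝ≥0∞, ∏ i, I i ^ (p / P i) = (∏ i, I i ^ (1 / P i)) ^ p := by
      intro I
      rw [← ENNReal.prod_rpow_of_nonneg hp0.le]
      refine Finset.prod_congr rfl fun i _ => ?_
      rw [← ENNReal.rpow_mul]; congr 1; ring
    rw [hprod, ← ENNReal.mul_rpow_of_nonneg _ _ hp0.le, hC0]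
    congr 1
    ring

end SparseHormander

/-! ### Test functions and the Hörmander condition -/

namespace SparseHormander

lemma lintegral_pi_prod {m : ℕ} {X : Type*} [MeasurableSpace X] (μ : Measure X) [SigmaFinite μ]
    (f : Fin m → X → ℝ≥0∞) (hf : ∀ i, Measurable (f i)) :
    ∫⁻ x : Fin m → X, ∏ i, f i (x i) ∂(Measure.pi fun _ => μ) = ∏ i, ∫⁻ x, f i x ∂μ := by
  induction m with
  | zero => simp
  | succ m ih =>
    have hmp := (measurePreserving_piFinSuccAbove (fun _ : Fin (m + 1) => μ) 0).symm
    rw [← hmp.lintegral_comp (f := fun x => ∏ i, f i (x i))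
      (Finset.measurable_fun_prod _ fun i _ => (hf i).comp (measurable_pi_apply i))]
    have : ∀ a : X × (Fin m → X), ∏ i, f i
        ((MeasurableEquiv.piFinSuccAbove (fun _ : Fin (m + 1) => X) 0).symm a i) =
        f 0 a.1 * ∏ i : Fin m, f i.succ (a.2 i) := by
      intro a
      rw [Fin.prod_univ_succ]
      simp [MeasurableEquiv.piFinSuccAbove_symm_apply]
    simp only [this]
    rw [lintegral_prod_mul (f := f 0) (g := fun x : Fin m → X => ∏ i : Fin m, f i.succ (x i))
      (hf 0).aemeasurable
      (Finset.measurable_fun_prod _ fun i _ => (hf _).comp (measurable_pi_apply i)).aemeasurable,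
      ih _ fun i => hf _, Fin.prod_univ_succ]

variable {n m : ℕ}

/-- Bounded measurable functions with compact support. -/
def IsTest (f : (Fin n → ℝ) → ℂ) : Prop :=
  Measurable f ∧ (∃ B : ℝ, ∀ y, ‖f y‖ ≤ B) ∧ HasCompactSupport f

lemma IsTest.memLp {f : (Fin n → ℝ) → ℂ} (hf : IsTest f) (p : ℝ≥0∞) (μ : Measure (Fin n → ℝ))
    [IsFiniteMeasureOnCompacts μ] : MemLp f p μ := by
  obtain ⟨hm, ⟨B, hB⟩, hc⟩ := hf
  have h1 : MemLp f ∞ μ := memLp_top_of_bound hm.aestronglyMeasurable B (.of_forall hB)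
  refine h1.mono_exponent_of_measure_support_ne_top (s := tsupport f) (q := ∞)
    (fun x hx => image_eq_zero_of_notMem_tsupport hx) ?_ le_top
  exact (IsCompact.measure_lt_top hc).ne

lemma IsTest.indicator {f : (Fin n → ℝ) → ℂ} (hf : IsTest f) {s : Set (Fin n → ℝ)}
    (hs : MeasurableSet s) : IsTest (s.indicator f) := by
  obtain ⟨hm, ⟨B, hB⟩, hc⟩ := hf
  refine ⟨hm.indicator hs, ⟨B, fun y => ?_⟩, ?_⟩
  · refine le_trans ?_ (hB y)
    by_cases hy : y ∈ s <;> simp [hy]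
  · refine hc.mono ?_
    exact fun x hx => (Set.indicator_apply_ne_zero.1 hx).2

/-- Averages `⟨|f|^r⟩` over a set. -/
noncomputable def avg (r : ℝ) (f : (Fin n → ℝ) → ℂ) (D : Set (Fin n → ℝ)) : ℝ≥0∞ :=
  ⨍⁻ x in D, ‖f x‖ₑ ^ r ∂volume

lemma eLpNorm_cubePow_prod {r : ℝ} (hr : 1 ≤ r) {f : Fin m → (Fin n → ℝ) → ℂ}
    (hf : ∀ i, Measurable (f i)) (c : Fin n → ℝ) {l : ℝ} (hl : 0 < l) :
    eLpNorm (fun y : Fin m → Fin n → ℝ => ∏ i, f i (y i)) (ENNReal.ofReal r)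
      (volume.restrict (cubePow m c l)) =
      volume (cube c l) ^ ((m : ℝ) / r) * ∏ i, avg r (f i) (cube c l) ^ (1 / r) := by
  have hr0 : 0 < r := by linarith
  have hpi : cubePow m c l = Set.pi Set.univ fun _ => cube c l := by
    ext y; simp [cubePow]
  rw [eLpNorm_eq_lintegral_rpow_enorm_toReal (by simpa using hr0) ENNReal.ofReal_ne_top,
    ENNReal.toReal_ofReal hr0.le, hpi, volume_pi, Measure.restrict_pi_pi]
  have h1 : ∀ y : Fin m → Fin n → ℝ, ‖∏ i, f i (y i)‖ₑ ^ r = ∏ i, ‖f i (y i)‖ₑ ^ r := by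
    intro y
    rw [ENNReal.prod_rpow_of_nonneg hr0.le]
    congr 1
    simp only [enorm_eq_nnnorm]
    rw [nnnorm_prod]
    push_cast
    rfl
  simp only [h1]
  rw [lintegral_pi_prod _ (fun i x => ‖f i x‖ₑ ^ r) fun i => (hf i).enorm.pow_const _]
  have h2 : ∀ i, ∫⁻ x in cube c l, ‖f i x‖ₑ ^ r = avg r (f i) (cube c l) * volume (cube c l) :=
    fun i => (setLAverage_mul (volume_cube_pos c hl).ne' (volume_cube_ne_top c hl.le) _).symm
  simp only [h2, Finset.prod_mul_distrib, Finset.prod_const, Finset.card_univ, Fintype.card_fin]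
  rw [ENNReal.mul_rpow_of_nonneg _ _ (by positivity), mul_comm, ENNReal.prod_rpow_of_nonneg
    (by positivity : 0 ≤ 1 / r), ← ENNReal.rpow_natCast, ← ENNReal.rpow_mul]
  congr 2
  ring

lemma measurableSet_cubePow (c : Fin n → ℝ) (l : ℝ) : MeasurableSet (cubePow m c l) := by
  have hpi : cubePow m c l = Set.pi Set.univ fun _ => cube c l := by
    ext y; simp [cubePow]
  rw [hpi]
  exact MeasurableSet.univ_pi fun _ => measurableSet_cube c l

lemma compl_cubePow_subset_iUnion (c : Fin n → ℝ) {l : ℝ} (hl : 0 < l) :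
    (cubePow m c l)ᶜ ⊆ ⋃ k : ℕ, cubePow m c (2 ^ (k + 1) * l) \ cubePow m c (2 ^ k * l) := by
  classical
  intro y hy
  have hex : ∃ k : ℕ, y ∈ cubePow m c (2 ^ k * l) := by
    obtain ⟨M, hM⟩ : ∃ M : ℝ, ∀ i j, |y i j - c j| ≤ M := by
      refine ⟨∑ i, ∑ j, |y i j - c j|, fun i j => ?_⟩
      refine le_trans ?_ (Finset.single_le_sum (f := fun i => ∑ j, |y i j - c j|)
        (fun i _ => Finset.sum_nonneg fun j _ => abs_nonneg _) (Finset.mem_univ i))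
      exact Finset.single_le_sum (f := fun j => |y i j - c j|)
        (fun j _ => abs_nonneg _) (Finset.mem_univ j)
    obtain ⟨k, hk⟩ := pow_unbounded_of_one_lt (2 * M / l) (by norm_num : (1 : ℝ) < 2)
    refine ⟨k, fun i j => (hM i j).trans ?_⟩
    rw [div_lt_iff₀ hl] at hk
    linarith
  have h0 : Nat.find hex ≠ 0 := by
    intro h
    have := Nat.find_spec hex
    rw [h, pow_zero, one_mul] at this
    exact hy this
  obtain ⟨k, hk⟩ := Nat.exists_eq_succ_of_ne_zero h0
  refine Set.mem_iUnion.2 ⟨k, ?_, Nat.find_min hex (by omega)⟩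
  have := Nat.find_spec hex
  rwa [hk] at this

/-- The oscillation estimate from the Hörmander condition. -/
lemma lintegral_oscillation_le {r : ℝ} (hr : 1 ≤ r) {K : (Fin n → ℝ) → (Fin m → Fin n → ℝ) → ℂ}
    (hK : ∀ x, AEStronglyMeasurable (K x) volume) {f : Fin m → (Fin n → ℝ) → ℂ}
    (hf : ∀ i, Measurable (f i)) (c : Fin n → ℝ) {l : ℝ} (hl : 0 < l) {M : ℝ≥0∞}
    (hM : ∀ k : ℕ, ∏ i, avg r (f i) (cube c (2 ^ (k + 1) * l)) ^ (1 / r) ≤ M)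
    {x z : Fin n → ℝ} (hx : x ∈ cube c (l / 2)) (hz : z ∈ cube c (l / 2)) :
    ∫⁻ y in (cubePow m c l)ᶜ, ‖(K x y - K z y) * ∏ i, f i (y i)‖ₑ ≤ hormanderConst r K * M := by
  have hfm : Measurable fun y : Fin m → Fin n → ℝ => ∏ i, f i (y i) :=
    Finset.measurable_fun_prod _ fun i _ => (hf i).comp (measurable_pi_apply i)
  -- Hölder's inequality on each annulus; for `r = 1` the conjugate exponent is `∞`, so no separate
  -- case is needed.
  have hconj : ENNReal.HolderConjugate (ENNReal.ofReal r).conjExponent (ENNReal.ofReal r) :=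
    (ENNReal.HolderConjugate.conjExponent (by simpa using hr)).symm
  have hterm : ∀ k : ℕ,
      ∫⁻ y in cubePow m c (2 ^ (k + 1) * l) \ cubePow m c (2 ^ k * l),
        ‖(K x y - K z y) * ∏ i, f i (y i)‖ₑ ≤
      (volume (cube c (2 ^ (k + 1) * l))) ^ ((m : ℝ) / r) *
      eLpNorm (fun y => K x y - K z y) (ENNReal.ofReal r).conjExponent
        (volume.restrict (cubePow m c (2 ^ (k + 1) * l) \ cubePow m c (2 ^ k * l))) * M := by
    intro k
    set Ak := cubePow m c (2 ^ (k + 1) * l) \ cubePow m c (2 ^ k * l)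
    have h1 := eLpNorm_smul_le_mul_eLpNorm (μ := volume.restrict Ak) (r := 1)
      (p := (ENNReal.ofReal r).conjExponent) (q := ENNReal.ofReal r)
      (f := fun y : Fin m → Fin n → ℝ => ∏ i, f i (y i)) (φ := fun y => K x y - K z y)
      hfm.aestronglyMeasurable ((hK x).sub (hK z)).restrict
    rw [eLpNorm_one_eq_lintegral_enorm] at h1
    refine h1.trans ?_
    calc _ ≤ eLpNorm (fun y => K x y - K z y) (ENNReal.ofReal r).conjExponent
          (volume.restrict Ak) * eLpNorm (fun y : Fin m → Fin n → ℝ => ∏ i, f i (y i))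
            (ENNReal.ofReal r) (volume.restrict (cubePow m c (2 ^ (k + 1) * l))) := by
          exact mul_le_mul_right
            (eLpNorm_mono_measure _ (Measure.restrict_mono Set.sdiff_subset le_rfl)) _
      _ ≤ eLpNorm (fun y => K x y - K z y) (ENNReal.ofReal r).conjExponent
        (volume.restrict Ak) * (volume (cube c (2 ^ (k + 1) * l)) ^ ((m : ℝ) / r) * M) := by
          rw [eLpNorm_cubePow_prod hr hf c (by positivity)]
          gcongr
          exact hM k
      _ = _ := by ring
  calc _ ≤ ∫⁻ y in (⋃ k : ℕ, cubePow m c (2 ^ (k + 1) * l) \ cubePow m c (2 ^ k * l)),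
        ‖(K x y - K z y) * ∏ i, f i (y i)‖ₑ :=
        lintegral_mono_set (compl_cubePow_subset_iUnion c hl)
    _ ≤ ∑' k : ℕ, (∫⁻ y in cubePow m c (2 ^ (k + 1) * l) \ cubePow m c (2 ^ k * l),
        ‖(K x y - K z y) * ∏ i, f i (y i)‖ₑ) := lintegral_iUnion_le _ _
    _ ≤ ∑' k : ℕ, ((volume (cube c (2 ^ (k + 1) * l))) ^ ((m : ℝ) / r) *
      eLpNorm (fun y => K x y - K z y) (ENNReal.ofReal r).conjExponent
        (volume.restrict (cubePow m c (2 ^ (k + 1) * l) \ cubePow m c (2 ^ k * l))) * M) :=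
        ENNReal.tsum_le_tsum hterm
    _ = (∑' k : ℕ, (volume (cube c (2 ^ (k + 1) * l))) ^ ((m : ℝ) / r) *
      eLpNorm (fun y => K x y - K z y) (ENNReal.ofReal r).conjExponent
        (volume.restrict (cubePow m c (2 ^ (k + 1) * l) \ cubePow m c (2 ^ k * l)))) * M := by
        rw [ENNReal.tsum_mul_right]
    _ ≤ _ := by
        gcongr
        rw [hormanderConst]
        refine le_iSup_of_le c <| le_iSup_of_le l <| le_iSup_of_le hl <| le_iSup_of_le x <|
          le_iSup_of_le hx <| le_iSup_of_le z <| le_iSup_of_le hz le_rfl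

end SparseHormander

/-! ### Localisation of the operator -/

namespace SparseHormander

variable {n m : ℕ} {r : ℝ}

open Classical in
/-- The action of `T` on tuples of functions (zero outside `L^r × ⋯ × L^r`). -/
noncomputable def onFun (T : MultilinearMap ℂ
      (fun _ : Fin m => Lp ℂ (ENNReal.ofReal r) (volume : Measure (Fin n → ℝ)))
      ((Fin n → ℝ) →ₘ[volume] ℂ)) (f : Fin m → (Fin n → ℝ) → ℂ) : (Fin n → ℝ) → ℂ :=
  if h : ∀ i, MemLp (f i) (ENNReal.ofReal r) volume then T fun i => (h i).toLp (f i) else 0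

variable {T : MultilinearMap ℂ
      (fun _ : Fin m => Lp ℂ (ENNReal.ofReal r) (volume : Measure (Fin n → ℝ)))
      ((Fin n → ℝ) →ₘ[volume] ℂ)}

lemma onFun_eq {f : Fin m → (Fin n → ℝ) → ℂ} (h : ∀ i, MemLp (f i) (ENNReal.ofReal r) volume) :
    onFun T f = T fun i => (h i).toLp (f i) := dif_pos h

lemma aestronglyMeasurable_onFun (f : Fin m → (Fin n → ℝ) → ℂ) :
    AEStronglyMeasurable (onFun T f) volume := by
  unfold onFun
  split_ifs
  · exact AEEqFun.aestronglyMeasurable _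
  · exact aestronglyMeasurable_zero

/-- Weak boundedness as a distributional estimate, with a nonzero constant. -/
lemma IsWeakBounded.exists_bound (hT : IsWeakBounded r T) :
    ∃ B : ℝ≥0∞, B ≠ 0 ∧ B ≠ ∞ ∧ ∀ f : Fin m → (Fin n → ℝ) → ℂ,
      (∀ i, MemLp (f i) (ENNReal.ofReal r) volume) → ∀ t : ℝ≥0,
      (t : ℝ≥0∞) * volume {x | (t : ℝ≥0∞) < ‖onFun T f x‖ₑ} ^ ((m : ℝ) / r) ≤
        B * ∏ i, eLpNorm (f i) (ENNReal.ofReal r) volume := by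
  obtain ⟨B, hB⟩ := hT
  -- The summand 1 makes the constant nonzero.
  refine ⟨(B + 1 : ℝ≥0), by simp, ENNReal.coe_ne_top, fun f hf t => ?_⟩
  rw [onFun_eq hf]
  have h1 := (le_iSup (fun t : ℝ≥0 => (t : ℝ≥0∞) * (volume {x | t <
    ‖(T fun i => (hf i).toLp (f i)) x‖₊}) ^ (1 / (r / m))) t).trans (hB fun i => (hf i).toLp (f i))
  have h2 : ∀ i, eLpNorm ((hf i).toLp (f i)) (ENNReal.ofReal r) volume =
      eLpNorm (f i) (ENNReal.ofReal r) volume := fun i => eLpNorm_congr_ae (hf i).coeFn_toLp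
  simp only [h2, one_div_div] at h1
  calc _ = (t : ℝ≥0∞) * (volume {x | t < ‖(T fun i => (hf i).toLp (f i)) x‖₊}) ^ ((m : ℝ) / r) := by
        simp only [enorm_eq_nnnorm, ENNReal.coe_lt_coe]
    _ ≤ _ := h1
    _ ≤ _ := by gcongr; simp

lemma onFun_ae_zero {f : Fin m → (Fin n → ℝ) → ℂ}
    (hf : ∀ i, MemLp (f i) (ENNReal.ofReal r) volume) {i : Fin m} (h : f i =ᵐ[volume] 0) :
    onFun T f =ᵐ[volume] 0 := by
  rw [onFun_eq hf, T.map_coord_zero i]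
  · exact AEEqFun.coeFn_zero
  · exact (Lp.eq_zero_iff_ae_eq_zero).2 ((hf i).coeFn_toLp.trans h)

/-- Off the localisation cube, `T f - T (f 1_C)` has a kernel representation. -/
lemma onFun_sub_onFun_indicator {K : (Fin n → ℝ) → (Fin m → Fin n → ℝ) → ℂ}
    (hTK : IsSingularIntegral r T K) {f : Fin m → (Fin n → ℝ) → ℂ} (hf : ∀ i, IsTest (f i))
    (c : Fin n → ℝ) {l : ℝ} (hl : 0 < l) :
    ∀ᵐ x, x ∈ cube c (l / 2) →
      Integrable (fun y => K x y * ((cubePow m c l)ᶜ.indicator (fun y => ∏ i, f i (y i)) y)) ∧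
      onFun T f x - onFun T (fun i => (cube c l).indicator (f i)) x =
        ∫ y, K x y * ((cubePow m c l)ᶜ.indicator (fun y => ∏ i, f i (y i)) y) := by
  classical
  have hC := measurableSet_cube c l
  set a : Fin m → (Fin n → ℝ) → ℂ := fun i => (cube c l).indicator (f i) with ha
  set b : Fin m → (Fin n → ℝ) → ℂ := fun i => (cube c l)ᶜ.indicator (f i) with hb
  have hat : ∀ i, IsTest (a i) := fun i => (hf i).indicator hC
  have hbt : ∀ i, IsTest (b i) := fun i => (hf i).indicator hC.compl
  have hat' : ∀ i, MemLp (a i) (ENNReal.ofReal r) volume := fun i => (hat i).memLp _ _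
  have hbt' : ∀ i, MemLp (b i) (ENNReal.ofReal r) volume := fun i => (hbt i).memLp _ _
  have hft' : ∀ i, MemLp (f i) (ENNReal.ofReal r) volume := fun i => (hf i).memLp _ _
  have hab : f = a + b := by
    funext i x
    exact (congrFun (Set.indicator_self_add_compl (cube c l) (f i)) x).symm
  have hs : ∀ (s : Finset (Fin m)) i, IsTest (s.piecewise a b i) := by
    intro s i
    by_cases hi : i ∈ s <;> simp [hi, hat, hbt]
  have hs' : ∀ (s : Finset (Fin m)) i, MemLp (s.piecewise a b i) (ENNReal.ofReal r) volume :=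
    fun s i => (hs s i).memLp _ _
  -- Expanding `T(a + b)` over subsets of indices, `U` indexes all terms except `T(a)`: each
  -- contains at least one factor `b_i`, living off the cube.
  set U : Finset (Finset (Fin m)) := Finset.univ.erase Finset.univ with hU
  have hTs : ∀ s : Finset (Fin m), (T fun i => (hs' s i).toLp _) =
      T (s.piecewise (fun i => (hat' i).toLp (a i)) fun i => (hbt' i).toLp (b i)) := by
    intro s
    congr 1
    funext i
    by_cases hi : i ∈ s <;> simp [hi]
  have hsplit : (T fun i => (hft' i).toLp (f i)) - (T fun i => (hat' i).toLp (a i)) =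
      ∑ s ∈ U, T fun i => (hs' s i).toLp _ := by
    have h1 : (fun i => (hft' i).toLp (f i)) =
        (fun i => (hat' i).toLp (a i)) + fun i => (hbt' i).toLp (b i) := by
      funext i
      rw [Pi.add_apply, ← MemLp.toLp_add, MemLp.toLp_eq_toLp_iff, hab]
      rfl
    rw [h1, T.map_add_univ, ← Finset.add_sum_erase _ _ (Finset.mem_univ Finset.univ),
      Finset.piecewise_univ, add_sub_cancel_left]
    exact Finset.sum_congr rfl fun s _ => (hTs s).symm
  have hrep : ∀ᵐ x, ∀ s ∈ U, x ∈ cube c (l / 2) →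
      Integrable (fun y : Fin m → Fin n → ℝ => K x y * ∏ i, s.piecewise a b i (y i)) ∧
      (T fun i => (hs' s i).toLp _) x =
        ∫ y : Fin m → Fin n → ℝ, K x y * ∏ i, s.piecewise a b i (y i) := by
    rw [ae_all_iff]
    intro s
    by_cases hsU : s ∈ U
    swap
    · exact .of_forall fun x h => absurd h hsU
    obtain ⟨i, hi⟩ : ∃ i, i ∉ s := by
      by_contra hcon
      push Not at hcon
      exact (Finset.mem_erase.1 hsU).1 (Finset.eq_univ_iff_forall.2 hcon)
    filter_upwards [hTK.kernel_repr (s.piecewise a b) (hs' s) (fun i => (hs s i).2.1)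
      (fun i => (hs s i).2.2)] with x hx _ hxc
    refine hx fun hmem => ?_
    have h1 := Set.mem_iInter.1 hmem i
    rw [Finset.piecewise_eq_of_notMem _ _ _ hi] at h1
    -- The closed support of `b_i` may touch the boundary of the cube but avoids its interior, hence
    -- the half cube; the kernel representation applies there.
    have h2 : tsupport (b i) ⊆ (Metric.ball c (l / 2))ᶜ := by
      refine closure_minimal ?_ Metric.isOpen_ball.isClosed_compl
      intro y hy
      have h3 := (Set.indicator_apply_ne_zero.1 hy).1
      rw [cube_eq_closedBall c hl.le] at h3
      exact fun h4 => h3 (Metric.ball_subset_closedBall h4)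
    refine h2 h1 ?_
    rw [cube_eq_closedBall c (by linarith)] at hxc
    exact Metric.closedBall_subset_ball (by linarith) hxc
  -- The same expansion for the product of functions: only points with some `y_i` off the cube
  -- contribute to the terms in `U`.
  have hprod : ∀ y : Fin m → Fin n → ℝ,
      (cubePow m c l)ᶜ.indicator (fun y => ∏ i, f i (y i)) y =
      ∑ s ∈ U, ∏ i, s.piecewise a b i (y i) := by
    intro y
    have h1 := (MultilinearMap.mkPiAlgebra ℂ (Fin m) ℂ).map_add_univ
      (fun i => a i (y i)) fun i => b i (y i)
    rw [← Finset.add_sum_erase _ _ (Finset.mem_univ Finset.univ), Finset.piecewise_univ] at h1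
    simp only [MultilinearMap.mkPiAlgebra_apply] at h1
    have h2 : ∏ i, f i (y i) = ∏ i, a i (y i) + ∑ s ∈ U, ∏ i, s.piecewise a b i (y i) := by
      have h3 : ∀ s : Finset (Fin m), ∏ i, s.piecewise (fun i => a i (y i)) (fun i => b i (y i)) i =
          ∏ i, s.piecewise a b i (y i) := fun s => Finset.prod_congr rfl fun i _ => by
        by_cases hi : i ∈ s <;> simp [hi]
      simp only [h3] at h1
      rw [← h1, hab]
      rfl
    by_cases hy : y ∈ cubePow m c l
    · rw [Set.indicator_of_notMem (by simpa using hy)]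
      have h4 : ∏ i, f i (y i) = ∏ i, a i (y i) :=
        Finset.prod_congr rfl fun i _ => (Set.indicator_of_mem (hy i) _).symm
      rw [h4] at h2
      exact (left_eq_add.1 h2).symm
    · rw [Set.indicator_of_mem (by simpa using hy), h2]
      have h4 : ∏ i, a i (y i) = 0 := by
        have : ∃ i, y i ∉ cube c l := by
          by_contra hcon
          push Not at hcon
          exact hy hcon
        obtain ⟨i, hi⟩ := this
        exact Finset.prod_eq_zero (Finset.mem_univ i) (Set.indicator_of_notMem hi _)
      rw [h4, zero_add]
  filter_upwards [hrep, AEEqFun.coeFn_sub (T fun i => (hft' i).toLp (f i))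
    (T fun i => (hat' i).toLp (a i)), AEEqFun.coeFn_finsetSum U fun s => T fun i => (hs' s i).toLp _]
    with x h1 h2 h3 hx
  simp only [hprod, Finset.mul_sum]
  refine ⟨integrable_finsetSum _ fun s hs => (h1 s hs hx).1, ?_⟩
  rw [integral_finsetSum _ fun s hs => (h1 s hs hx).1, onFun_eq hft', onFun_eq hat']
  rw [hsplit] at h2
  rw [Pi.sub_apply] at h2
  rw [← h2, h3, Finset.sum_apply]
  exact Finset.sum_congr rfl fun s hs => (h1 s hs hx).2

/-- Oscillation of `T f - T (f 1_C)` on `½ C`. -/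
lemma onFun_oscillation (hr : 1 ≤ r) {K : (Fin n → ℝ) → (Fin m → Fin n → ℝ) → ℂ}
    (hTK : IsSingularIntegral r T K) {f : Fin m → (Fin n → ℝ) → ℂ} (hf : ∀ i, IsTest (f i))
    (c : Fin n → ℝ) {l : ℝ} (hl : 0 < l) :
    ∃ N : Set (Fin n → ℝ), volume N = 0 ∧ ∀ x ∈ cube c (l / 2) \ N, ∀ z ∈ cube c (l / 2) \ N,
      ∀ M : ℝ≥0∞, (∀ k : ℕ, ∏ i, avg r (f i) (cube c (2 ^ (k + 1) * l)) ^ (1 / r) ≤ M) →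
      ‖onFun T f x - onFun T (fun i => (cube c l).indicator (f i)) x‖ₑ ≤
        ‖onFun T f z - onFun T (fun i => (cube c l).indicator (f i)) z‖ₑ +
          hormanderConst r K * M := by
  -- The exceptional set is where the kernel representation fails; it depends neither on `x`, `z`
  -- nor on `M`.
  refine ⟨_, onFun_sub_onFun_indicator hTK hf c hl, ?_⟩
  rintro x ⟨hx, hxN⟩ z ⟨hz, hzN⟩ M hM
  rw [Set.mem_compl_iff, not_not] at hxN hzN
  obtain ⟨hx1, hx2⟩ := hxN hx
  obtain ⟨hz1, hz2⟩ := hzN hz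
  rw [hx2, hz2]
  set H := (cubePow m c l)ᶜ.indicator (fun y => ∏ i, f i (y i)) with hH
  have h1 : ∫ y, K x y * H y = (∫ y, K z y * H y) + ∫ y, (K x y - K z y) * H y := by
    rw [← integral_add hz1]
    · congr 1; funext y; ring
    · simp only [sub_mul]; exact hx1.sub hz1
  rw [h1]
  refine (enorm_add_le _ _).trans (add_le_add le_rfl ?_)
  refine (enorm_integral_le_lintegral_enorm _).trans ?_
  refine le_trans (le_of_eq ?_)
    (lintegral_oscillation_le hr hTK.kernel_measurable (fun i => (hf i).1) c hl hM hx hz)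
  rw [← lintegral_indicator (measurableSet_cubePow c l).compl]
  refine lintegral_congr fun y => ?_
  by_cases hy : y ∈ (cubePow m c l)ᶜ
  · rw [Set.indicator_of_mem hy, hH, Set.indicator_of_mem hy]
  · rw [Set.indicator_of_notMem hy, hH, Set.indicator_of_notMem hy, mul_zero, enorm_zero]

end SparseHormander

/-! ### Vitali covering and stopping cubes -/

namespace SparseHormander

variable {n m : ℕ} {r : ℝ} {t : Fin n → ℝ} {L : ℝ}

/-- Weak type estimate for the maximal function over arbitrary cubes, via Vitali covering. -/
lemma volume_iUnion_cube_le {I : Type*} [Countable I] (c : I → Fin n → ℝ) (l : I → ℝ)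
    (hl : ∀ i, 0 < l i) (S : Set I) (g : (Fin n → ℝ) → ℝ≥0∞) {b : ℝ≥0∞}
    (h : ∀ i ∈ S, b * volume (cube (c i) (l i)) ≤ ∫⁻ x in cube (c i) (l i), g x) :
    b * volume (⋃ i ∈ S, cube (c i) (l i)) ≤ 5 ^ n * ∫⁻ x, g x := by
  classical
  have hfin : ∀ F : Finset I, (∀ i ∈ F, i ∈ S) →
      b * volume (⋃ i ∈ F, cube (c i) (l i)) ≤ 5 ^ n * ∫⁻ x, g x := by
    intro F hF
    -- The Vitali lemma needs bounded radii, which a finite family has; the general case follows by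
    -- exhaustion.
    obtain ⟨R, hR⟩ : ∃ R : ℝ, ∀ i ∈ (F : Set I), l i / 2 ≤ R := by
      obtain ⟨R, hR⟩ := (F.image fun i => l i / 2).bddAbove
      exact ⟨R, fun i hi => hR (Finset.mem_coe.2 (Finset.mem_image_of_mem _ hi))⟩
    obtain ⟨u, huF, hdis, hcov⟩ := Vitali.exists_disjoint_subfamily_covering_enlargement_closedBall
      (F : Set I) c (fun i => l i / 2) R hR 5 (by norm_num)
    have hball : ∀ i, cube (c i) (l i) = Metric.closedBall (c i) (l i / 2) :=
      fun i => cube_eq_closedBall _ (hl i).le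
    have hcov' : (⋃ i ∈ F, cube (c i) (l i)) ⊆ ⋃ i ∈ u, cube (c i) (5 * l i) := by
      refine Set.iUnion₂_subset fun i hi => ?_
      obtain ⟨j, hj, hij⟩ := hcov i hi
      rw [hball]
      refine hij.trans ?_
      have h5 : cube (c j) (5 * l j) = Metric.closedBall (c j) (5 * (l j / 2)) := by
        rw [cube_eq_closedBall _ (by linarith [hl j])]; congr 1; ring
      rw [← h5]
      exact Set.subset_biUnion_of_mem (u := fun j => cube (c j) (5 * l j)) hj
    have hu : u.Countable := u.to_countable
    calc _ ≤ b * ∑' i : u, volume (cube (c i) (5 * l i)) := by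
          gcongr
          exact (measure_mono hcov').trans (measure_biUnion_le _ hu _)
      _ = ∑' i : u, 5 ^ n * (b * volume (cube (c i) (l i))) := by
          rw [← ENNReal.tsum_mul_left]
          refine tsum_congr fun i => ?_
          rw [volume_cube _ (by linarith [hl i]), volume_cube _ (hl i).le,
            ENNReal.ofReal_mul (by norm_num), mul_pow]
          simp only [ENNReal.ofReal_ofNat]
          ring
      _ ≤ ∑' i : u, 5 ^ n * ∫⁻ x in cube (c i) (l i), g x :=
          ENNReal.tsum_le_tsum fun i => mul_le_mul_right (h i (hF _ (huF i.2))) _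
      _ = 5 ^ n * ∫⁻ x in ⋃ i ∈ u, cube (c i) (l i), g x := by
          rw [ENNReal.tsum_mul_left, lintegral_biUnion hu (fun i _ => measurableSet_cube _ _)]
          intro i hi j hj hij
          simp only [Function.onFun, hball]
          exact hdis hi hj hij
      _ ≤ _ := by
          gcongr
          exact Measure.restrict_le_self
  have hU : (⋃ i ∈ S, cube (c i) (l i)) = ⋃ F : Finset S, ⋃ i ∈ F.image Subtype.val,
      cube (c i) (l i) := by
    ext x
    simp only [Set.mem_iUnion, exists_prop]
    constructor
    · rintro ⟨i, hi, hx⟩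
      exact ⟨{⟨i, hi⟩}, i, by simp, hx⟩
    · rintro ⟨F, i, hi, hx⟩
      obtain ⟨⟨i', h'⟩, -, rfl⟩ := Finset.mem_image.1 hi
      exact ⟨i', h', hx⟩
  have hdir : Directed (· ⊆ ·)
      (fun F : Finset S => ⋃ i ∈ F.image Subtype.val, cube (c i) (l i)) :=
    Monotone.directed_le (fun F G hFG =>
      Set.biUnion_subset_biUnion_left (Finset.image_subset_image hFG))
  rw [hU, hdir.measure_iUnion, ENNReal.mul_iSup]
  refine iSup_le fun F => hfin _ ?_
  intro i hi
  obtain ⟨⟨i', h'⟩, -, rfl⟩ := Finset.mem_image.1 hi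
  exact h'

lemma volume_of_level_succ (hL : 0 < L) {P R : Label n} (h : R.1 = P.1 + 1) :
    volume (dcube t L P) = 2 ^ n * volume (dcube t L R) := by
  rw [volume_dcube hL, volume_dcube hL, ← mul_pow]
  congr 1
  have : side L P = 2 * side L R := by
    unfold side
    rw [h, pow_succ]
    field_simp
  rw [this, ENNReal.ofReal_mul (by norm_num)]
  simp

/-- Stopping cubes: the maximal dyadic subcubes with a bad child. -/
lemma exists_stopping_cubes (hL : 0 < L) (Q : Label n) (Bad : Set (Label n))
    (hBad : ∀ R ∈ Bad, Q.1 ≤ R.1 ∧ dcube t L R ⊆ dcube t L Q)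
    (hsmall : 2 ^ (n + 1) * volume (⋃ R ∈ Bad, dcube t L R) ≤ volume (dcube t L Q)) :
    ∃ ch : Set (Label n), (∀ P ∈ ch, Q.1 < P.1 ∧ dcube t L P ⊆ dcube t L Q) ∧
      ch.PairwiseDisjoint (dcube t L) ∧
      2 * volume (⋃ P ∈ ch, dcube t L P) ≤ volume (dcube t L Q) ∧
      (∀ P ∈ ch, P ∉ Bad) ∧ (⋃ R ∈ Bad, dcube t L R) ⊆ ⋃ P ∈ ch, dcube t L P := by
  classical
  have hsub : ∀ R ∈ Bad, dcube t L R ⊆ ⋃ R ∈ Bad, dcube t L R := fun R hR =>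
    Set.subset_biUnion_of_mem (u := dcube t L) hR
  have hlevel : ∀ P : Label n, P.1 = Q.1 → dcube t L P ⊆ dcube t L Q → P = Q := by
    intro P h1 h2
    obtain ⟨x, hx⟩ := dcube_nonempty (t := t) hL P
    exact label_eq_of_mem h1 hx (h2 hx)
  -- Otherwise the bad cubes would cover `Q`.
  have hQ : Q ∉ Bad := by
    intro hQ
    have h1 := (mul_le_mul_right (measure_mono (hsub Q hQ)) (2 ^ (n + 1))).trans hsmall
    have h2 : volume (dcube t L Q) < 2 ^ (n + 1) * volume (dcube t L Q) := by
      conv_lhs => rw [← one_mul (volume (dcube t L Q))]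
      refine (ENNReal.mul_lt_mul_iff_left (volume_dcube_pos hL Q).ne'
        (volume_dcube_ne_top hL Q)).2 ?_
      exact one_lt_pow₀ (by norm_num) (by omega)
    exact h2.not_ge h1
  -- Stopping takes place one generation above the bad cubes, so that the selected cubes are not bad
  -- and the oscillation estimate holds on them.
  set Cand : Label n → Prop := fun P => Q.1 ≤ P.1 ∧ dcube t L P ⊆ dcube t L Q ∧
    ∃ R ∈ Bad, R.1 = P.1 + 1 ∧ dcube t L R ⊆ dcube t L P with hCand
  have hparent : ∀ R ∈ Bad, Cand (parent R) ∧ dcube t L R ⊆ dcube t L (parent R) ∧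
      (parent R).1 + 1 = R.1 := by
    intro R hR
    obtain ⟨h1, h2⟩ := hBad R hR
    have h3 : Q.1 < R.1 := lt_of_le_of_ne h1 fun h => hQ (hlevel R h.symm h2 ▸ hR)
    have h4 := parent_level (Q := R) (by omega)
    have h5 := dcube_subset_parent (t := t) (L := L) (Q := R) (by omega)
    refine ⟨⟨by omega, ?_, R, hR, h4.symm, h5⟩, h5, h4⟩
    obtain ⟨x, hx⟩ := dcube_nonempty (t := t) hL R
    exact dcube_subset_of_mem (by omega) (h2 hx) (h5 hx)
  set ch : Set (Label n) := {P | Cand P ∧ ∀ P', Cand P' → dcube t L P ⊆ dcube t L P' →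
    P'.1 ≤ P.1 → P' = P} with hch
  refine ⟨ch, ?_, ?_, ?_, ?_, ?_⟩
  · rintro P ⟨⟨h1, h2, R, hR, h3, h4⟩, -⟩
    refine ⟨lt_of_le_of_ne h1 fun h => ?_, h2⟩
    -- `Q` is not selected: a bad child of `Q` would have measure `2^{-n} |Q|`, more than the bad
    -- set is allowed.
    have hPQ := hlevel P h.symm h2
    rw [hPQ] at h3
    have h5 := (mul_le_mul_right (measure_mono (hsub R hR)) (2 ^ (n + 1))).trans hsmall
    rw [volume_of_level_succ hL h3, pow_succ, mul_assoc] at h5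
    have h6 : 2 ^ n * volume (dcube t L R) < 2 ^ n * (2 * volume (dcube t L R)) := by
      refine (ENNReal.mul_lt_mul_iff_right (by simp) (by simp)).2 ?_
      conv_lhs => rw [← one_mul (volume (dcube t L R))]
      exact (ENNReal.mul_lt_mul_iff_left (volume_dcube_pos hL R).ne'
        (volume_dcube_ne_top hL R)).2 (by norm_num)
    exact h6.not_ge h5
  · have key : ∀ P ∈ ch, ∀ P' ∈ ch, P.1 ≤ P'.1 → P ≠ P' →
        Disjoint (dcube t L P) (dcube t L P') := by
      intro P hP P' hP' hle hne
      by_contra hd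
      obtain ⟨x, hx1, hx2⟩ := Set.not_disjoint_iff.1 hd
      exact hne (hP'.2 P hP.1 (dcube_subset_of_mem hle hx1 hx2) hle)
    intro P hP P' hP' hne
    rcases le_total P.1 P'.1 with h | h
    · exact key P hP P' hP' h hne
    · exact (key P' hP' P hP h hne.symm).symm
  -- A bad child fills the fraction `2^{-n}` of its parent, so the selected cubes have total measure
  -- at most `2^n` times that of the bad set.
  · have h1 := packing (t := t) hL (μ := volume)
      (ν := volume.restrict (⋃ R ∈ Bad, dcube t L R)) (c := (2 ^ n)⁻¹) ch (by
        rintro P ⟨⟨-, -, R, hR, h3, h4⟩, -⟩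
        rw [volume_of_level_succ hL h3, ← mul_assoc, ENNReal.inv_mul_cancel (by simp) (by simp),
          one_mul, Measure.restrict_apply (measurableSet_dcube hL P)]
        exact measure_mono (Set.subset_inter h4 (hsub R hR)))
    have h2 : volume (⋃ P ∈ ch, dcube t L P) ≤ 2 ^ n * volume (⋃ R ∈ Bad, dcube t L R) := by
      have h3 := mul_le_mul_right (h1.trans (measure_mono (Set.subset_univ _))) (2 ^ n)
      rw [← mul_assoc, ENNReal.mul_inv_cancel (by simp) (by simp), one_mul,
        Measure.restrict_apply_univ] at h3
      exact h3
    calc _ ≤ 2 * (2 ^ n * volume (⋃ R ∈ Bad, dcube t L R)) := by gcongr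
      _ = 2 ^ (n + 1) * volume (⋃ R ∈ Bad, dcube t L R) := by ring
      _ ≤ _ := hsmall
  -- A bad selected cube would have a candidate as parent, against maximality.
  · intro P hP hPB
    obtain ⟨h1, h2, h3⟩ := hparent P hPB
    have h4 := hP.2 _ h1 h2 (by omega)
    rw [h4] at h3
    omega
  · refine Set.iUnion₂_subset fun R hR => ?_
    obtain ⟨h1, h2, -⟩ := hparent R hR
    -- The candidate of least generation containing the parent of `R` is maximal.
    have hex : ∃ k, ∃ P', Cand P' ∧ P'.1 = k ∧ dcube t L (parent R) ⊆ dcube t L P' :=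
      ⟨_, parent R, h1, rfl, subset_rfl⟩
    obtain ⟨P', hP1, hP2, hP3⟩ := Nat.find_spec hex
    refine (h2.trans hP3).trans (Set.subset_biUnion_of_mem (u := dcube t L) ⟨hP1, ?_⟩)
    intro P'' hc hs hl
    have h4 : Nat.find hex ≤ P''.1 := Nat.find_min' hex ⟨P'', hc, rfl, hP3.trans hs⟩
    obtain ⟨x, hx⟩ := dcube_nonempty (t := t) hL P'
    exact label_eq_of_mem (by omega) (hs hx) hx

/-- The double of a dyadic cube. -/
noncomputable def big (t : Fin n → ℝ) (L : ℝ) (Q : Label n) : Set (Fin n → ℝ) :=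
  cube (center t L Q) (2 * side L Q)

lemma measurableSet_big (Q : Label n) : MeasurableSet (big t L Q) := measurableSet_cube _ _

lemma volume_big (hL : 0 < L) (Q : Label n) :
    volume (big t L Q) = 2 ^ n * volume (dcube t L Q) := by
  have := side_pos hL Q
  rw [big, volume_cube _ (by linarith), volume_dcube hL, ENNReal.ofReal_mul (by norm_num), mul_pow]
  simp

lemma volume_big_ne_top (hL : 0 < L) (Q : Label n) : volume (big t L Q) ≠ ∞ := by
  rw [volume_big hL]; exact ENNReal.mul_ne_top (by simp) (volume_dcube_ne_top hL Q)

lemma volume_big_ne_zero (hL : 0 < L) (Q : Label n) : volume (big t L Q) ≠ 0 := by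
  rw [volume_big hL]; exact mul_ne_zero (by simp) (volume_dcube_pos hL Q).ne'

/-- Coordinatewise, `[a, b) ⊆ [A, B)` implies `3A - B ≤ 3a - b` and `3b - a ≤ 3B - A`. It makes
successive localisations collapse: restricting `f 1_{2Q}` to `2R` gives `f 1_{2R}`. -/
lemma big_subset_big (hL : 0 < L) {R Q : Label n} (h : dcube t L R ⊆ dcube t L Q) :
    big t L R ⊆ big t L Q := by
  have hR := side_pos hL R
  have hne : (Set.pi Set.univ fun j => Set.Ico (t j + R.2 j * side L R)
      (t j + (R.2 j + 1) * side L R)).Nonempty := by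
    rw [← dcube_eq_pi hL]; exact dcube_nonempty hL R
  rw [dcube_eq_pi hL, dcube_eq_pi hL, Set.univ_pi_subset_univ_pi_iff] at h
  rcases h with h | ⟨j, hj⟩
  · intro y hy j
    have h1 := hy j
    obtain ⟨h2, h3⟩ := (Set.Ico_subset_Ico_iff (by linarith)).1 (h j)
    simp only [center] at h1 ⊢
    rw [abs_le] at h1 ⊢
    constructor <;> linarith [h1.1, h1.2]
  · exact absurd hj (Set.nonempty_Ico.2 (by linarith)).ne_empty

end SparseHormander

/-! ### What makes a cube bad -/

namespace SparseHormander

variable {n m : ℕ} {r : ℝ} {t : Fin n → ℝ} {L : ℝ}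

lemma avg_mul_volume {f : (Fin n → ℝ) → ℂ} {D : Set (Fin n → ℝ)} (h0 : volume D ≠ 0)
    (h1 : volume D ≠ ∞) : avg r f D * volume D = ∫⁻ x in D, ‖f x‖ₑ ^ r :=
  setLAverage_mul h0 h1 _

lemma prod_eLpNorm_indicator (hr : 0 < r) (f : Fin m → (Fin n → ℝ) → ℂ) {D : Set (Fin n → ℝ)}
    (hD : MeasurableSet D) (h0 : volume D ≠ 0) (h1 : volume D ≠ ∞) :
    ∏ i, eLpNorm (D.indicator (f i)) (ENNReal.ofReal r) volume =
      volume D ^ ((m : ℝ) / r) * ∏ i, avg r (f i) D ^ (1 / r) := by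
  have h2 : ∀ i, eLpNorm (D.indicator (f i)) (ENNReal.ofReal r) volume =
      avg r (f i) D ^ (1 / r) * volume D ^ (1 / r) := by
    intro i
    rw [eLpNorm_indicator_eq_eLpNorm_restrict hD, eLpNorm_eq_lintegral_rpow_enorm_toReal
      (by simpa using hr) ENNReal.ofReal_ne_top, ENNReal.toReal_ofReal hr.le,
      ← ENNReal.mul_rpow_of_nonneg _ _ (by positivity), avg_mul_volume h0 h1]
  simp only [h2, Finset.prod_mul_distrib, Finset.prod_const, Finset.card_univ, Fintype.card_fin]
  rw [mul_comm, ← ENNReal.rpow_natCast, ← ENNReal.rpow_mul]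
  congr 2
  ring

lemma avg_ne_top {f : (Fin n → ℝ) → ℂ} (hr : 0 < r) (hf : IsTest f) {D : Set (Fin n → ℝ)}
    (h0 : volume D ≠ 0) : avg r f D ≠ ∞ := by
  have h1 := (hf.memLp (ENNReal.ofReal r) volume).2
  rw [eLpNorm_lt_top_iff_lintegral_rpow_enorm_lt_top (by simpa using hr) ENNReal.ofReal_ne_top,
    ENNReal.toReal_ofReal hr.le] at h1
  rw [avg, setLAverage_eq]
  exact (ENNReal.div_lt_top (ne_top_of_le_ne_top h1.ne (setLIntegral_le_lintegral _ _)) h0).ne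

variable {T : MultilinearMap ℂ
      (fun _ : Fin m => Lp ℂ (ENNReal.ofReal r) (volume : Measure (Fin n → ℝ)))
      ((Fin n → ℝ) →ₘ[volume] ℂ)}
  {K : (Fin n → ℝ) → (Fin m → Fin n → ℝ) → ℂ}

/-- If the oscillating part is large on a nonnull subset of `R`, then `|T f|` or one of the averages
over dilates of `R` is large. -/
lemma large_of_oscillation_large (hr : 1 ≤ r) (hTK : IsSingularIntegral r T K) {B : ℝ≥0∞}
    (hT : ∀ f : Fin m → (Fin n → ℝ) → ℂ,
      (∀ i, MemLp (f i) (ENNReal.ofReal r) volume) → ∀ t : ℝ≥0,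
      (t : ℝ≥0∞) * volume {x | (t : ℝ≥0∞) < ‖onFun T f x‖ₑ} ^ ((m : ℝ) / r) ≤
        B * ∏ i, eLpNorm (f i) (ENNReal.ofReal r) volume)
    {κ : ℝ≥0∞} (hκ0 : κ ≠ 0) (hκ1 : κ ≠ ∞) (hκK : hormanderConst r K ≤ κ)
    (hκB : B * 2 ^ (((n : ℝ) + 1) * (m / r)) ≤ κ)
    {F : Fin m → (Fin n → ℝ) → ℂ} (hF : ∀ i, IsTest (F i)) (hL : 0 < L) (R : Label n) (lam : ℝ≥0)
    (hosc : volume {x ∈ dcube t L R | 3 * (lam : ℝ≥0∞) <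
      ‖onFun T F x - onFun T (fun i => (big t L R).indicator (F i)) x‖ₑ} ≠ 0) :
    volume (dcube t L R) ≤ 2 * volume (dcube t L R ∩ {x | (lam : ℝ≥0∞) < ‖onFun T F x‖ₑ}) ∨
    ∃ k : ℕ, (lam : ℝ≥0∞) ≤
      κ * ∏ i, avg r (F i) (cube (center t L R) (2 ^ k * (2 * side L R))) ^ (1 / r) := by
  have hr0 : 0 < r := by linarith
  have hs := side_pos hL R
  by_contra hcon
  push Not at hcon
  obtain ⟨hG, hk⟩ := hcon
  set G := {x | (lam : ℝ≥0∞) < ‖onFun T F x‖ₑ} with hGdef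
  set FR := fun i => (big t L R).indicator (F i) with hFR
  set G' := {x | (lam : ℝ≥0∞) < ‖onFun T FR x‖ₑ} with hG'def
  have hFRt : ∀ i, IsTest (FR i) := fun i => (hF i).indicator (measurableSet_big R)
  -- Were at least half of `R` covered, the weak type bound for the localised functions would give
  -- the alternative with `k = 0`, that is, large averages over `2R`.
  have hG' : 2 * volume (dcube t L R ∩ G') < volume (dcube t L R) := by
    by_contra hcon
    rw [not_lt] at hcon
    have h1 := hT FR (fun i => (hFRt i).memLp _ _) lam
    rw [prod_eLpNorm_indicator hr0 F (measurableSet_big R) (volume_big_ne_zero hL R)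
      (volume_big_ne_top hL R)] at h1
    have h2 : volume (big t L R) ≤ 2 ^ ((n : ℝ) + 1) * volume G' := by
      rw [volume_big hL]
      calc _ ≤ 2 ^ n * (2 * volume (dcube t L R ∩ G')) := by gcongr
        _ ≤ 2 ^ n * (2 * volume G') := by gcongr; exact Set.inter_subset_right
        _ = _ := by
          rw [ENNReal.rpow_add _ _ (by simp) (by simp), ENNReal.rpow_natCast, ENNReal.rpow_one]
          ring
    have h3 : volume (big t L R) ^ ((m : ℝ) / r) ≤
        2 ^ (((n : ℝ) + 1) * (m / r)) * volume G' ^ ((m : ℝ) / r) := by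
      rw [ENNReal.rpow_mul, ← ENNReal.mul_rpow_of_nonneg _ _ (by positivity)]
      exact ENNReal.rpow_le_rpow h2 (by positivity)
    have hV0 : volume (big t L R) ^ ((m : ℝ) / r) ≠ 0 :=
      (ENNReal.rpow_pos (pos_iff_ne_zero.2 (volume_big_ne_zero hL R)) (volume_big_ne_top hL R)).ne'
    have hV1 : volume (big t L R) ^ ((m : ℝ) / r) ≠ ∞ :=
      ENNReal.rpow_ne_top_of_nonneg (by positivity) (volume_big_ne_top hL R)
    have h4 : (lam : ℝ≥0∞) ≤ κ * ∏ i, avg r (F i) (big t L R) ^ (1 / r) := by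
      refine (ENNReal.mul_le_mul_iff_left hV0 hV1).1 ?_
      calc (lam : ℝ≥0∞) * volume (big t L R) ^ ((m : ℝ) / r)
          ≤ lam * (2 ^ (((n : ℝ) + 1) * (m / r)) * volume G' ^ ((m : ℝ) / r)) := by gcongr
        _ = 2 ^ (((n : ℝ) + 1) * (m / r)) * (lam * volume G' ^ ((m : ℝ) / r)) := by ring
        _ ≤ 2 ^ (((n : ℝ) + 1) * (m / r)) * (B * (volume (big t L R) ^ ((m : ℝ) / r) *
            ∏ i, avg r (F i) (big t L R) ^ (1 / r))) := by gcongr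
        _ = (B * 2 ^ (((n : ℝ) + 1) * (m / r))) * (∏ i, avg r (F i) (big t L R) ^ (1 / r)) *
            volume (big t L R) ^ ((m : ℝ) / r) := by ring
        _ ≤ _ := by gcongr
    have h5 := hk 0
    rw [pow_zero, one_mul] at h5
    exact h5.not_ge h4
  obtain ⟨N, hN0, hN⟩ := onFun_oscillation hr hTK hF (center t L R) (l := 2 * side L R) (by linarith)
  have hsub : dcube t L R ⊆ cube (center t L R) (2 * side L R / 2) := by
    rw [mul_div_cancel_left₀ _ (by norm_num : (2 : ℝ) ≠ 0)]; exact dcube_subset_cube hL R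
  -- Two sets of less than half the measure and a null set cannot fill `R`. At the remaining point
  -- both `|T F|` and `|T(F 1_{2R})|` are at most `λ`.
  obtain ⟨z, hzR, hz⟩ : ∃ z ∈ dcube t L R, z ∉ N ∪ (dcube t L R ∩ G) ∪ (dcube t L R ∩ G') := by
    by_contra hcon
    push Not at hcon
    have h1 : volume (dcube t L R) ≤
        0 + volume (dcube t L R ∩ G) + volume (dcube t L R ∩ G') := by
      rw [← hN0]
      exact (measure_mono hcon).trans ((measure_union_le _ _).trans
        (add_le_add (measure_union_le _ _) le_rfl))
    rw [zero_add] at h1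
    have h2 : 2 * volume (dcube t L R) < 2 * volume (dcube t L R) := by
      calc _ ≤ 2 * volume (dcube t L R ∩ G) + 2 * volume (dcube t L R ∩ G') := by
            rw [← mul_add]; gcongr
        _ < volume (dcube t L R) + volume (dcube t L R) := ENNReal.add_lt_add hG hG'
        _ = _ := (two_mul _).symm
    exact lt_irrefl _ h2
  simp only [Set.mem_union, Set.mem_inter_iff, not_or, not_and] at hz
  obtain ⟨⟨hzN, hzG⟩, hzG'⟩ := hz
  have hzG := hzG hzR
  have hzG' := hzG' hzR
  rw [hGdef, Set.mem_ofPred_eq, not_lt] at hzG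
  rw [hG'def, Set.mem_ofPred_eq, not_lt] at hzG'
  refine hosc (measure_mono_null (t := N) ?_ hN0)
  rintro x ⟨hxR, hx⟩
  by_contra hxN
  -- All dilated products are below `λ/κ` and `K_r ≤ κ`, so the kernel contributes a third `λ`; this
  -- is the 3 in the threshold.
  have h1 := hN x ⟨hsub hxR, hxN⟩ z ⟨hsub hzR, hzN⟩ (lam / κ) (fun k => by
    rw [ENNReal.le_div_iff_mul_le (Or.inl hκ0) (Or.inl hκ1), mul_comm]
    exact (hk (k + 1)).le)
  have h2 : hormanderConst r K * (lam / κ) ≤ lam :=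
    (mul_le_mul_left hκK _).trans_eq (ENNReal.mul_div_cancel hκ0 hκ1)
  refine hx.not_ge (h1.trans ?_)
  calc _ ≤ ((lam : ℝ≥0∞) + lam) + lam := by
        refine add_le_add ((enorm_sub_le).trans (add_le_add hzG hzG')) h2
    _ = _ := by ring

/-- The comparison of averages that follows from `large_of_oscillation_large`. -/
lemma exists_avg_large (hr : 0 < r) {κ Λ : ℝ≥0∞} (hκ0 : κ ≠ 0) (hκ1 : κ ≠ ∞)
    (hΛ0 : Λ ≠ 0) (hΛ1 : Λ ≠ ∞) {α β : Fin m → ℝ≥0∞} (hα0 : ∀ i, α i ≠ 0) (hα1 : ∀ i, α i ≠ ∞)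
    (h : 2 * κ * Λ ^ ((m : ℝ) / r) * ∏ i, α i ^ (1 / r) ≤ κ * ∏ i, β i ^ (1 / r)) :
    ∃ i, Λ * α i ≤ β i := by
  by_contra hcon
  push Not at hcon
  have h1 : ∏ i, β i ^ (1 / r) ≤ Λ ^ ((m : ℝ) / r) * ∏ i, α i ^ (1 / r) := by
    calc _ ≤ ∏ i, (Λ * α i) ^ (1 / r) :=
          Finset.prod_le_prod' fun i _ => ENNReal.rpow_le_rpow (hcon i).le (by positivity)
      _ = _ := by
          simp only [ENNReal.mul_rpow_of_nonneg _ _ (by positivity : 0 ≤ 1 / r),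
            Finset.prod_mul_distrib, Finset.prod_const, Finset.card_univ, Fintype.card_fin]
          rw [← ENNReal.rpow_natCast, ← ENNReal.rpow_mul]
          congr 2
          ring
  set Y := κ * (Λ ^ ((m : ℝ) / r) * ∏ i, α i ^ (1 / r)) with hY
  have hY0 : Y ≠ 0 := by
    refine mul_ne_zero hκ0 (mul_ne_zero (ENNReal.rpow_pos (pos_iff_ne_zero.2 hΛ0) hΛ1).ne' ?_)
    exact Finset.prod_ne_zero_iff.2 fun i _ =>
      (ENNReal.rpow_pos (pos_iff_ne_zero.2 (hα0 i)) (hα1 i)).ne'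
  have hY1 : Y ≠ ∞ := by
    refine ENNReal.mul_ne_top hκ1 (ENNReal.mul_ne_top
      (ENNReal.rpow_ne_top_of_nonneg (by positivity) hΛ1) (ENNReal.prod_ne_top fun i _ =>
      ENNReal.rpow_ne_top_of_nonneg (by positivity) (hα1 i)))
  have h2 : 2 * Y ≤ 1 * Y := by
    -- The factor 2 in the hypothesis makes the comparison strict: `2Y ≤ Y` is impossible for `0 < Y
    -- < ∞`.
    rw [one_mul]
    calc 2 * Y = 2 * κ * Λ ^ ((m : ℝ) / r) * ∏ i, α i ^ (1 / r) := by rw [hY]; ring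
      _ ≤ _ := h
      _ ≤ Y := by rw [hY]; gcongr
  have h3 := (ENNReal.mul_le_mul_iff_left hY0 hY1).1 h2
  norm_num at h3

end SparseHormander

/-! ### One step of the sparse domination -/

namespace SparseHormander

variable {n m : ℕ} {r : ℝ}

/-- The product of the `L^r` averages over the double of a dyadic cube. -/
noncomputable def coeff (r : ℝ) (f : Fin m → (Fin n → ℝ) → ℂ) (t : Fin n → ℝ) (L : ℝ)
    (Q : Label n) : ℝ≥0∞ := ∏ i, avg r (f i) (big t L Q) ^ (1 / r)

/-- Localisation of a tuple of functions to the double of a dyadic cube. -/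
noncomputable def localize (f : Fin m → (Fin n → ℝ) → ℂ) (t : Fin n → ℝ) (L : ℝ)
    (Q : Label n) : Fin m → (Fin n → ℝ) → ℂ := fun i => (big t L Q).indicator (f i)

variable {T : MultilinearMap ℂ
      (fun _ : Fin m => Lp ℂ (ENNReal.ofReal r) (volume : Measure (Fin n → ℝ)))
      ((Fin n → ℝ) →ₘ[volume] ℂ)}
  {K : (Fin n → ℝ) → (Fin m → Fin n → ℝ) → ℂ}

/-- One step of the sparse domination. -/
theorem exists_local_step (hm : 0 < m) (hr : 1 ≤ r) (hTK : IsSingularIntegral r T K)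
    (hT : IsWeakBounded r T) (hK : hormanderConst r K < ∞) :
    ∃ A : ℝ≥0∞, A ≠ ∞ ∧ ∀ f : Fin m → (Fin n → ℝ) → ℂ, (∀ i, IsTest (f i)) →
      ∀ (t : Fin n → ℝ) (L : ℝ), 0 < L → ∀ Q : Label n, ∃ ch : Set (Label n),
      (∀ P ∈ ch, Q.1 < P.1 ∧ dcube t L P ⊆ dcube t L Q) ∧ ch.PairwiseDisjoint (dcube t L) ∧
      2 * volume (⋃ P ∈ ch, dcube t L P) ≤ volume (dcube t L Q) ∧
      ∀ᵐ x, (x ∈ dcube t L Q → x ∉ (⋃ P ∈ ch, dcube t L P) →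
          ‖onFun T (localize f t L Q) x‖ₑ ≤ A * coeff r f t L Q) ∧
        ∀ P ∈ ch, x ∈ dcube t L P → ‖onFun T (localize f t L Q) x‖ₑ ≤
          A * coeff r f t L Q + ‖onFun T (localize f t L P) x‖ₑ := by
  have hr0 : 0 < r := by linarith
  have hm0 : (0 : ℝ) < m := by exact_mod_cast hm
  obtain ⟨B, -, hB1, hTB⟩ := hT.exists_bound
  set κ : ℝ≥0∞ := hormanderConst r K + B * 2 ^ (((n : ℝ) + 1) * (m / r)) + B + 1 with hκ
  have hκ0 : κ ≠ 0 := by simp [hκ]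
  have hκ1 : κ ≠ ∞ := by
    simp only [hκ, ne_eq, ENNReal.add_eq_top, not_or, ENNReal.one_ne_top, not_false_eq_true,
      and_true]
    exact ⟨⟨hK.ne, ENNReal.mul_ne_top hB1 (ENNReal.rpow_ne_top_of_nonneg (by positivity)
      (by simp))⟩, hB1⟩
  have hκK : hormanderConst r K ≤ κ := by
    rw [hκ, add_assoc, add_assoc]; exact le_self_add
  have hκB' : B * 2 ^ (((n : ℝ) + 1) * (m / r)) ≤ κ := by
    rw [hκ, add_assoc]; exact le_add_self.trans le_self_add
  have hκB : B ≤ κ := le_add_self.trans le_self_add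
  -- The three covers of the bad cubes cost `2^n + 1` (open set), `2 · 2^n` (half-filled cubes) and
  -- `10^n = 5^n · 2^n` for each `i` (Vitali constant times `|2Q|/|Q|`), relative to `|Q|/Λ`. The
  -- factor `2^{n+1}` in `Λ` is the smallness required for stopping.
  set W : ℝ≥0∞ := 3 * 2 ^ n + 1 + m * 10 ^ n with hW
  have hW0 : W ≠ 0 := by simp [hW]
  have hW1 : W ≠ ∞ := by
    simp only [hW]
    exact_mod_cast ENNReal.natCast_ne_top (3 * 2 ^ n + 1 + m * 10 ^ n)
  set Λ : ℝ≥0∞ := 2 ^ (n + 1) * W with hΛ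
  have hΛ0 : Λ ≠ 0 := mul_ne_zero (by simp) hW0
  have hΛ1 : Λ ≠ ∞ := ENNReal.mul_ne_top (by simp) hW1
  -- At height `A₁ a`, large products force one average to grow by the factor `Λ`, and the weak type
  -- bound gives `Λ |G| ≤ |2Q|`.
  set A₁ : ℝ≥0∞ := 2 * κ * Λ ^ ((m : ℝ) / r) with hA₁
  have hA₁t : A₁ ≠ ∞ := ENNReal.mul_ne_top (ENNReal.mul_ne_top (by simp) hκ1)
    (ENNReal.rpow_ne_top_of_nonneg (by positivity) hΛ1)
  refine ⟨3 * A₁, ENNReal.mul_ne_top (by simp) hA₁t, fun f hf t L hL Q => ?_⟩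
  set F := localize f t L Q with hFdef
  have hFt : ∀ i, IsTest (F i) := fun i => (hf i).indicator (measurableSet_big Q)
  have hFp : ∀ i, MemLp (F i) (ENNReal.ofReal r) volume := fun i => (hFt i).memLp _ _
  set α : Fin m → ℝ≥0∞ := fun i => avg r (f i) (big t L Q) with hα
  have hα1 : ∀ i, α i ≠ ∞ := fun i => avg_ne_top hr0 (hf i) (volume_big_ne_zero hL Q)
  have hFint : ∀ i, ∫⁻ x, ‖F i x‖ₑ ^ r = α i * volume (big t L Q) := by
    intro i
    rw [avg_mul_volume (volume_big_ne_zero hL Q) (volume_big_ne_top hL Q),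
      ← lintegral_indicator (measurableSet_big Q)]
    refine lintegral_congr fun x => ?_
    by_cases hx : x ∈ big t L Q
    · simp [hFdef, localize, hx]
    · simp [hFdef, localize, hx, hr0]
  -- A vanishing average makes `F i`, hence `T F`, vanish almost everywhere; no stopping cubes are
  -- needed.
  by_cases hα0 : ∃ i, α i = 0
  · obtain ⟨i, hi⟩ := hα0
    have hFi : F i =ᵐ[volume] 0 := by
      have h1 := hFint i
      rw [hi, zero_mul, lintegral_eq_zero_iff ((hFt i).1.enorm.pow_const r)] at h1
      filter_upwards [h1] with x hx
      simpa [hr0, hr0.not_gt] using hx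
    refine ⟨∅, by simp, by simp, by simp, ?_⟩
    filter_upwards [onFun_ae_zero (T := T) hFp hFi] with x hx
    simp [hx]
  push Not at hα0
  set a := coeff r f t L Q with ha
  have haα : a = ∏ i, α i ^ (1 / r) := rfl
  have ha1 : a ≠ ∞ := ENNReal.prod_ne_top fun i _ =>
    ENNReal.rpow_ne_top_of_nonneg (by positivity) (hα1 i)
  have ha0 : a ≠ 0 := Finset.prod_ne_zero_iff.2 fun i _ =>
    (ENNReal.rpow_pos (pos_iff_ne_zero.2 (hα0 i)) (hα1 i)).ne'
  set lam : ℝ≥0 := (A₁ * a).toNNReal with hlam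
  have hlamc : (lam : ℝ≥0∞) = A₁ * a := ENNReal.coe_toNNReal (ENNReal.mul_ne_top hA₁t ha1)
  set G := {x | (lam : ℝ≥0∞) < ‖onFun T F x‖ₑ} with hG
  have hGvol : Λ * volume G ≤ 2 ^ n * volume (dcube t L Q) := by
    have h1 : (lam : ℝ≥0∞) * volume G ^ ((m : ℝ) / r) ≤
        B * ∏ i, eLpNorm (F i) (ENNReal.ofReal r) volume := hTB F hFp lam
    have h0 : ∏ i, eLpNorm (F i) (ENNReal.ofReal r) volume =
        volume (big t L Q) ^ ((m : ℝ) / r) * a :=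
      prod_eLpNorm_indicator hr0 f (measurableSet_big Q) (volume_big_ne_zero hL Q)
        (volume_big_ne_top hL Q)
    rw [h0, hlamc] at h1
    have h2 : Λ ^ ((m : ℝ) / r) * volume G ^ ((m : ℝ) / r) ≤
        volume (big t L Q) ^ ((m : ℝ) / r) := by
      refine (ENNReal.mul_le_mul_iff_left (mul_ne_zero hκ0 ha0) (ENNReal.mul_ne_top hκ1 ha1)).1 ?_
      calc Λ ^ ((m : ℝ) / r) * volume G ^ ((m : ℝ) / r) * (κ * a)
          ≤ 2 * (Λ ^ ((m : ℝ) / r) * volume G ^ ((m : ℝ) / r) * (κ * a)) := by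
            rw [two_mul]; exact le_self_add
        _ = A₁ * a * volume G ^ ((m : ℝ) / r) := by rw [hA₁]; ring
        _ ≤ B * (volume (big t L Q) ^ ((m : ℝ) / r) * a) := h1
        _ ≤ κ * (volume (big t L Q) ^ ((m : ℝ) / r) * a) := by gcongr
        _ = _ := by ring
    rw [← ENNReal.mul_rpow_of_nonneg _ _ (by positivity),
      ENNReal.rpow_le_rpow_iff (by positivity)] at h2
    rwa [← volume_big hL]
  -- Every point of an open set has a small dyadic cube inside it. Enlarging `G` to `U` therefore
  -- replaces an appeal to Lebesgue differentiation.
  obtain ⟨U, hGU, hUo, hUvol⟩ := Set.exists_isOpen_le_add (G) (volume : Measure (Fin n → ℝ))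
    (ε := Λ⁻¹ * volume (dcube t L Q))
    (mul_ne_zero (ENNReal.inv_ne_zero.2 hΛ1) (volume_dcube_pos hL Q).ne')
  set osc : Label n → Set (Fin n → ℝ) := fun R => {x ∈ dcube t L R | 3 * (lam : ℝ≥0∞) <
      ‖onFun T F x - onFun T (fun i => (big t L R).indicator (F i)) x‖ₑ} with hosc
  set Bad : Set (Label n) := {R | (Q.1 ≤ R.1 ∧ dcube t L R ⊆ dcube t L Q) ∧
    (dcube t L R ⊆ U ∨ volume (osc R) ≠ 0)} with hBad
  set S₁ : Set (Label n) := {R | volume (dcube t L R) ≤ 2 * volume (dcube t L R ∩ G)} with hS₁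
  set S₂ : Fin m → Set (Label n × ℕ) := fun i => {Rk | Λ * α i ≤
    avg r (F i) (cube (center t L Rk.1) (2 ^ Rk.2 * (2 * side L Rk.1)))} with hS₂
  have hcover : (⋃ R ∈ Bad, dcube t L R) ⊆ U ∪ (⋃ R ∈ S₁, dcube t L R) ∪
      ⋃ i, ⋃ Rk ∈ S₂ i, cube (center t L Rk.1) (2 ^ Rk.2 * (2 * side L Rk.1)) := by
    refine Set.iUnion₂_subset fun R hR => ?_
    obtain ⟨-, hRU | hRosc⟩ := hR
    · exact (hRU.trans Set.subset_union_left).trans Set.subset_union_left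
    rcases large_of_oscillation_large hr hTK hTB hκ0 hκ1 hκK hκB' hFt hL R lam hRosc with h | ⟨k, hk⟩
    · exact ((Set.subset_biUnion_of_mem (u := dcube t L) (show R ∈ S₁ from h)).trans
        Set.subset_union_right).trans Set.subset_union_left
    · rw [hlamc, haα, hA₁] at hk
      obtain ⟨i, hi⟩ := exists_avg_large (α := α) (β := fun i => avg r (F i)
        (cube (center t L R) (2 ^ k * (2 * side L R)))) hr0 hκ0 hκ1 hΛ0 hΛ1 hα0 hα1 hk
      have hs := side_pos hL R
      have hsub : dcube t L R ⊆ cube (center t L R) (2 ^ k * (2 * side L R)) := by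
        refine (dcube_subset_cube hL R).trans (cube_mono _ ?_)
        have : (1 : ℝ) ≤ 2 ^ k := one_le_pow₀ (by norm_num)
        nlinarith
      have hmem : (R, k) ∈ S₂ i := by
        rw [hS₂, Set.mem_ofPred_eq]
        exact hi
      exact fun x hx => Or.inr (Set.mem_iUnion.2 ⟨i, Set.mem_iUnion₂.2 ⟨(R, k), hmem, hsub hx⟩⟩)
  have hU' : Λ * volume U ≤ (2 ^ n + 1) * volume (dcube t L Q) := by
    calc _ ≤ Λ * (volume G + Λ⁻¹ * volume (dcube t L Q)) := by gcongr
      _ = Λ * volume G + Λ * Λ⁻¹ * volume (dcube t L Q) := by ring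
      _ ≤ 2 ^ n * volume (dcube t L Q) + 1 * volume (dcube t L Q) := by
          rw [ENNReal.mul_inv_cancel hΛ0 hΛ1]; gcongr
      _ = _ := by ring
  have hS₁' : Λ * volume (⋃ R ∈ S₁, dcube t L R) ≤ 2 * 2 ^ n * volume (dcube t L Q) := by
    have h1 := packing (t := t) hL (μ := volume) (ν := volume.restrict G) (c := 2⁻¹) S₁
      (fun R hR => by
        rw [Measure.restrict_apply (measurableSet_dcube hL R)]
        calc _ ≤ 2⁻¹ * (2 * volume (dcube t L R ∩ G)) := mul_le_mul_right hR _
          _ = _ := by rw [← mul_assoc, ENNReal.inv_mul_cancel (by simp) (by simp), one_mul])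
    have h2 : volume (⋃ R ∈ S₁, dcube t L R) ≤ 2 * volume G := by
      have h3 := mul_le_mul_right (h1.trans (measure_mono (Set.subset_univ _))) 2
      rwa [← mul_assoc, ENNReal.mul_inv_cancel (by simp) (by simp), one_mul,
        Measure.restrict_apply_univ] at h3
    calc _ ≤ Λ * (2 * volume G) := by gcongr
      _ = 2 * (Λ * volume G) := by ring
      _ ≤ 2 * (2 ^ n * volume (dcube t L Q)) := by gcongr
      _ = _ := by ring
  have hS₂' : ∀ i, Λ * volume (⋃ Rk ∈ S₂ i, cube (center t L Rk.1)
      (2 ^ Rk.2 * (2 * side L Rk.1))) ≤ 10 ^ n * volume (dcube t L Q) := by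
    intro i
    have hl : ∀ Rk : Label n × ℕ, 0 < 2 ^ Rk.2 * (2 * side L Rk.1) := fun Rk => by
      have := side_pos hL Rk.1
      positivity
    have h1 := volume_iUnion_cube_le (fun Rk : Label n × ℕ => center t L Rk.1)
      (fun Rk => 2 ^ Rk.2 * (2 * side L Rk.1)) hl (S₂ i) (fun x => ‖F i x‖ₑ ^ r) (b := Λ * α i)
      (fun Rk hRk => by
        rw [← avg_mul_volume (volume_cube_pos _ (hl Rk)).ne' (volume_cube_ne_top _ (hl Rk).le)]
        exact mul_le_mul_left hRk _)
    rw [hFint, volume_big hL] at h1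
    refine (ENNReal.mul_le_mul_iff_left (hα0 i) (hα1 i)).1 ?_
    calc _ = Λ * α i * volume (⋃ Rk ∈ S₂ i, cube (center t L Rk.1)
      (2 ^ Rk.2 * (2 * side L Rk.1))) := by ring
      _ ≤ _ := h1
      _ = (5 ^ n * 2 ^ n) * volume (dcube t L Q) * α i := by ring
      _ = _ := by rw [← mul_pow]; norm_num
  have hsmall : 2 ^ (n + 1) * volume (⋃ R ∈ Bad, dcube t L R) ≤ volume (dcube t L Q) := by
    refine (ENNReal.mul_le_mul_iff_left hW0 hW1).1 ?_
    calc _ = Λ * volume (⋃ R ∈ Bad, dcube t L R) := by rw [hΛ]; ring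
      _ ≤ Λ * (volume U + volume (⋃ R ∈ S₁, dcube t L R) + ∑ i, volume
          (⋃ Rk ∈ S₂ i, cube (center t L Rk.1) (2 ^ Rk.2 * (2 * side L Rk.1)))) := by
          gcongr
          refine (measure_mono hcover).trans ((measure_union_le _ _).trans
            (add_le_add (measure_union_le _ _) ?_))
          exact measure_iUnion_fintype_le _ _
      _ = Λ * volume U + Λ * volume (⋃ R ∈ S₁, dcube t L R) + ∑ i, Λ * volume
          (⋃ Rk ∈ S₂ i, cube (center t L Rk.1) (2 ^ Rk.2 * (2 * side L Rk.1))) := by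
          rw [mul_add, mul_add, Finset.mul_sum]
      _ ≤ (2 ^ n + 1) * volume (dcube t L Q) + 2 * 2 ^ n * volume (dcube t L Q) +
          ∑ _i : Fin m, 10 ^ n * volume (dcube t L Q) := by
          exact add_le_add (add_le_add hU' hS₁') (Finset.sum_le_sum fun i _ => hS₂' i)
      _ = _ := by
          rw [Finset.sum_const, Finset.card_univ, Fintype.card_fin, nsmul_eq_mul, hW]
          ring
  obtain ⟨ch, hch1, hch2, hch3, hch4, hch5⟩ := exists_stopping_cubes hL Q Bad (fun R hR => hR.1)
    hsmall
  refine ⟨ch, hch1, hch2, hch3, ?_⟩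
  -- Stopping cubes are not bad, so their oscillation sets are null, and there are countably many
  -- labels.
  have hnull : ∀ᵐ x, ∀ P : Label n, P ∈ ch → x ∉ osc P := by
    rw [ae_all_iff]
    intro P
    by_cases hP : P ∈ ch
    · have h1 : volume (osc P) = 0 := by
        by_contra hcon
        exact hch4 P hP ⟨⟨(hch1 P hP).1.le, (hch1 P hP).2⟩, Or.inr hcon⟩
      filter_upwards [measure_eq_zero_iff_ae_notMem.1 h1] with x hx _ using hx
    · exact .of_forall fun x h => absurd h hP
  filter_upwards [hnull] with x hx
  have h3 : 3 * A₁ * a = 3 * (lam : ℝ≥0∞) := by rw [hlamc]; ring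
  constructor
  · intro hxQ hxch
    by_contra hcon
    rw [not_le, h3] at hcon
    have hxG : x ∈ G := by
      refine lt_of_le_of_lt ?_ hcon
      calc (lam : ℝ≥0∞) = 1 * lam := (one_mul _).symm
        _ ≤ 3 * lam := by gcongr; norm_num
    -- A point of `Q` with `|T F| > λ` lies in a bad cube, hence in a stopping cube.
    obtain ⟨k, hk1, hk2⟩ := exists_dcube_subset_of_isOpen (t := t) hL hUo (hGU hxG) Q.1
    refine hxch (hch5 ?_)
    have hxk := mem_dcube_labelAt (t := t) (L := L) k x
    exact Set.mem_biUnion (show labelAt t L k x ∈ Bad from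
      ⟨⟨hk1, dcube_subset_of_mem hk1 hxQ hxk⟩, Or.inl hk2⟩) hxk
  · intro P hP hxP
    have h4 := hx P hP
    have h5 : (fun i => (big t L P).indicator (F i)) = localize f t L P := by
      funext i
      rw [hFdef, localize, localize, Set.indicator_indicator,
        Set.inter_eq_left.2 (big_subset_big hL (hch1 P hP).2)]
    have h6 : ‖onFun T F x - onFun T (localize f t L P) x‖ₑ ≤ 3 * (lam : ℝ≥0∞) := by
      by_contra hcon
      rw [not_le, ← h5] at hcon
      exact h4 ⟨hxP, hcon⟩
    rw [h3]
    calc ‖onFun T F x‖ₑ = ‖(onFun T F x - onFun T (localize f t L P) x) +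
          onFun T (localize f t L P) x‖ₑ := by rw [sub_add_cancel]
      _ ≤ _ := (enorm_add_le _ _).trans (add_le_add h6 le_rfl)

end SparseHormander

/-! ### Iteration of the stopping construction -/

namespace SparseHormander

variable {n m : ℕ} {t : Fin n → ℝ} {L : ℝ}

/-- A choice of stopping children for every dyadic cube. -/
structure IsStopping (t : Fin n → ℝ) (L : ℝ) (ch : Label n → Set (Label n)) : Prop where
  level_lt : ∀ Q, ∀ P ∈ ch Q, Q.1 < P.1
  subset : ∀ Q, ∀ P ∈ ch Q, dcube t L P ⊆ dcube t L Q
  disjoint : ∀ Q, (ch Q).PairwiseDisjoint (dcube t L)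
  measure_le : ∀ Q, 2 * volume (⋃ P ∈ ch Q, dcube t L P) ≤ volume (dcube t L Q)

/-- The cubes reached from `Q`. -/
def tree (ch : Label n → Set (Label n)) (Q : Label n) : Set (Label n) :=
  {R | Relation.ReflTransGen (fun Q P => P ∈ ch Q) Q R}

/-- The part of a cube outside its stopping children. -/
def remainder (t : Fin n → ℝ) (L : ℝ) (ch : Label n → Set (Label n)) (Q : Label n) :
    Set (Fin n → ℝ) := dcube t L Q \ ⋃ P ∈ ch Q, dcube t L P

/-- The union of the stopping cubes of generation `k` below `Q`. -/
def generation (t : Fin n → ℝ) (L : ℝ) (ch : Label n → Set (Label n)) :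
    ℕ → Label n → Set (Fin n → ℝ)
  | 0, Q => dcube t L Q
  | k + 1, Q => ⋃ P ∈ ch Q, generation t L ch k P

variable {ch : Label n → Set (Label n)}

lemma IsStopping.tree_subset (h : IsStopping t L ch) {Q R : Label n} (hR : R ∈ tree ch Q) :
    dcube t L R ⊆ dcube t L Q ∧ Q.1 ≤ R.1 := by
  have hR' : Relation.ReflTransGen (fun Q P => P ∈ ch Q) Q R := hR
  induction hR' with
  | refl => exact ⟨subset_rfl, le_rfl⟩
  | tail h1 h2 ih =>
    obtain ⟨i1, i2⟩ := ih h1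
    exact ⟨(h.subset _ _ h2).trans i1, i2.trans (h.level_lt _ _ h2).le⟩

lemma measurableSet_remainder (hL : 0 < L) (Q : Label n) : MeasurableSet (remainder t L ch Q) :=
  (measurableSet_dcube hL Q).diff
    (MeasurableSet.biUnion (Set.to_countable _) fun P _ => measurableSet_dcube hL P)

lemma IsStopping.volume_le (h : IsStopping t L ch) (hL : 0 < L) (Q : Label n) :
    volume (dcube t L Q) ≤ 2 * volume (remainder t L ch Q) := by
  have h1 : volume (dcube t L Q) ≤
      volume (remainder t L ch Q) + volume (⋃ P ∈ ch Q, dcube t L P) := by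
    refine le_trans (measure_mono ?_) (measure_union_le _ _)
    rw [remainder, Set.sdiff_union_self]
    exact Set.subset_union_left
  have h2 : volume (dcube t L Q) + volume (dcube t L Q) ≤
      2 * volume (remainder t L ch Q) + volume (dcube t L Q) := by
    calc _ = 2 * volume (dcube t L Q) := (two_mul _).symm
      _ ≤ 2 * (volume (remainder t L ch Q) + volume (⋃ P ∈ ch Q, dcube t L P)) := by gcongr
      _ = 2 * volume (remainder t L ch Q) + 2 * volume (⋃ P ∈ ch Q, dcube t L P) := mul_add _ _ _
      _ ≤ _ := by gcongr; exact h.measure_le Q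
  exact (ENNReal.add_le_add_iff_right (volume_dcube_ne_top hL Q)).1 h2

/-- A remainder misses everything below the children of its cube, and trees below distinct siblings
are disjoint. Induction follows the path to one of the two cubes. -/
lemma IsStopping.remainder_disjoint (h : IsStopping t L ch) (Q : Label n) :
    (tree ch Q).PairwiseDisjoint (remainder t L ch) := by
  have hself : ∀ Q P R : Label n, P ∈ ch Q → R ∈ tree ch P →
      Disjoint (remainder t L ch Q) (remainder t L ch R) := by
    intro Q P R hP hR
    refine Set.disjoint_left.2 fun x hx hx' => hx.2 ?_
    exact Set.mem_biUnion hP ((h.tree_subset hR).1 hx'.1)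
  intro R hR R' hR' hne
  have hRR : Relation.ReflTransGen (fun Q P => P ∈ ch Q) Q R := hR
  clear hR
  induction hRR using Relation.ReflTransGen.head_induction_on with
  | refl =>
    rcases Relation.ReflTransGen.cases_head hR' with h1 | ⟨P, h1, h2⟩
    · exact absurd h1 hne
    · exact hself _ P R' h1 h2
  | head h1 h2 ih =>
    rename_i S P
    rcases Relation.ReflTransGen.cases_head hR' with h3 | ⟨P', h3, h4⟩
    · rw [← h3]
      exact (hself _ P R h1 h2).symm
    · by_cases hPP : P = P'
      · exact ih (hPP ▸ h4)
      · exact (h.disjoint _ h1 h3 hPP).mono (Set.sdiff_subset.trans (h.tree_subset h2).1)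
          (Set.sdiff_subset.trans (h.tree_subset h4).1)

lemma IsStopping.volume_generation (h : IsStopping t L ch) (hL : 0 < L) (k : ℕ) (Q : Label n) :
    2 ^ k * volume (generation t L ch k Q) ≤ volume (dcube t L Q) := by
  induction k generalizing Q with
  | zero => simp [generation]
  | succ k ih =>
    calc _ ≤ 2 ^ (k + 1) * ∑' P : ch Q, volume (generation t L ch k P) := by
          gcongr
          exact measure_biUnion_le _ (Set.to_countable _) _
      _ = 2 * ∑' P : ch Q, 2 ^ k * volume (generation t L ch k P) := by
          rw [ENNReal.tsum_mul_left]; ring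
      _ ≤ 2 * ∑' P : ch Q, volume (dcube t L P) := by
          gcongr with P
          exact ih P
      _ = 2 * volume (⋃ P ∈ ch Q, dcube t L P) := by
          rw [measure_biUnion (Set.to_countable _) (h.disjoint Q)
            fun P _ => measurableSet_dcube hL P]
      _ ≤ _ := h.measure_le Q

/-- Generations at least halve in measure, so almost every point leaves after finitely many steps,
where the recursion ends. -/
lemma IsStopping.ae_exists_notMem_generation (h : IsStopping t L ch) (hL : 0 < L) (Q : Label n) :
    ∀ᵐ x, ∃ k, x ∉ generation t L ch k Q := by
  have h1 : volume (⋂ k, generation t L ch k Q) = 0 := by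
    by_contra h0
    have h2 : ∀ k : ℕ, (2 : ℝ≥0∞) ^ k ≤ volume (dcube t L Q) / volume (⋂ k, generation t L ch k Q) := by
      intro k
      rw [ENNReal.le_div_iff_mul_le (Or.inl h0) (Or.inr (volume_dcube_ne_top hL Q))]
      exact (mul_le_mul_right (measure_mono (Set.iInter_subset _ k)) _).trans
        (h.volume_generation hL k Q)
    have h3 : volume (dcube t L Q) / volume (⋂ k, generation t L ch k Q) ≠ ∞ :=
      (ENNReal.div_lt_top (volume_dcube_ne_top hL Q) h0).ne
    obtain ⟨k, hk⟩ := ENNReal.exists_nat_gt h3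
    refine (hk.trans_le ?_).not_ge (h2 k)
    exact_mod_cast Nat.lt_two_pow_self.le
  filter_upwards [measure_eq_zero_iff_ae_notMem.1 h1] with x hx
  simpa using hx

open Classical in
/-- The iterated stopping time domination, pointwise. -/
lemma IsStopping.le_tsum (h : IsStopping t L ch) {a : Label n → ℝ≥0∞} {u : Label n → ℝ≥0∞}
    {x : Fin n → ℝ}
    (h1 : ∀ Q, x ∈ dcube t L Q → x ∉ (⋃ P ∈ ch Q, dcube t L P) → u Q ≤ a Q)
    (h2 : ∀ Q, ∀ P ∈ ch Q, x ∈ dcube t L P → u Q ≤ a Q + u P) (k : ℕ) (Q : Label n)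
    (hx : x ∈ dcube t L Q) (hk : x ∉ generation t L ch k Q) :
    u Q ≤ ∑' R : tree ch Q, (dcube t L (R : Label n)).indicator (fun _ => a R) x := by
  have conv : ∀ Q, ∑' R : tree ch Q, (dcube t L (R : Label n)).indicator (fun _ => a R) x =
      ∑' R, if R ∈ tree ch Q then (dcube t L R).indicator (fun _ => a R) x else 0 := by
    intro Q
    rw [tsum_subtype (tree ch Q) fun R => (dcube t L R).indicator (fun _ => a R) x]
    rfl
  induction k generalizing Q with
  | zero => exact absurd hx hk
  | succ k ih =>
    by_cases hxc : x ∈ ⋃ P ∈ ch Q, dcube t L P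
    · obtain ⟨P, hP, hxP⟩ := Set.mem_iUnion₂.1 hxc
      have hkP : x ∉ generation t L ch k P := fun hcon => hk (Set.mem_biUnion hP hcon)
      refine (h2 Q P hP hxP).trans ?_
      refine (add_le_add le_rfl (ih P hxP hkP)).trans ?_
      -- The root and the tree below the child containing `x` are disjoint parts of the tree of `Q`:
      -- levels strictly increase.
      rw [conv, conv, ← tsum_ite_eq Q fun _ => a Q, ← ENNReal.tsum_add]
      refine ENNReal.tsum_le_tsum fun R => ?_
      by_cases hRQ : R = Q
      · subst hRQ
        have h3 : R ∉ tree ch P := fun hcon =>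
          absurd (h.tree_subset hcon).2 (not_le.2 (h.level_lt _ _ hP))
        have h4 : R ∈ tree ch R := Relation.ReflTransGen.refl
        simp [h3, h4, hx]
      · by_cases hRP : R ∈ tree ch P
        · have h3 : R ∈ tree ch Q := Relation.ReflTransGen.head hP hRP
          simp [hRQ, hRP, h3]
        · simp [hRQ, hRP]
    · refine (h1 Q hx hxc).trans ?_
      refine le_trans (le_of_eq ?_) (ENNReal.le_tsum (⟨Q, Relation.ReflTransGen.refl⟩ : tree ch Q))
      rw [Set.indicator_of_mem hx]

variable {r : ℝ} {T : MultilinearMap ℂ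
      (fun _ : Fin m => Lp ℂ (ENNReal.ofReal r) (volume : Measure (Fin n → ℝ)))
      ((Fin n → ℝ) →ₘ[volume] ℂ)}
  {K : (Fin n → ℝ) → (Fin m → Fin n → ℝ) → ℂ}

/-- Sparse domination on a dyadic cube whose double contains the supports. -/
theorem exists_sparse_domination (hm : 0 < m) (hr : 1 ≤ r) (hTK : IsSingularIntegral r T K)
    (hT : IsWeakBounded r T) (hK : hormanderConst r K < ∞) :
    ∃ A : ℝ≥0∞, A ≠ ∞ ∧ ∀ f : Fin m → (Fin n → ℝ) → ℂ, (∀ i, IsTest (f i)) →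
      ∀ (t : Fin n → ℝ) (L : ℝ), 0 < L → ∀ Q : Label n, localize f t L Q = f →
      ∃ (S : Set (Label n)) (E : Label n → Set (Fin n → ℝ)),
        (∀ R, MeasurableSet (E R)) ∧ (∀ R, E R ⊆ dcube t L R) ∧ S.PairwiseDisjoint E ∧
        (∀ R, volume (dcube t L R) ≤ 2 * volume (E R)) ∧
        ∀ᵐ x, x ∈ dcube t L Q → ‖onFun T f x‖ₑ ≤
          ∑' R : S, (dcube t L (R : Label n)).indicator (fun _ => A * coeff r f t L R) x := by
  obtain ⟨A, hA, hstep⟩ := exists_local_step hm hr hTK hT hK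
  refine ⟨A, hA, fun f hf t L hL Q hQ => ?_⟩
  choose ch h1 h2 h3 h4 using hstep f hf t L hL
  have h : IsStopping t L ch := ⟨fun Q P hP => (h1 Q P hP).1, fun Q P hP => (h1 Q P hP).2, h2, h3⟩
  refine ⟨tree ch Q, remainder t L ch, measurableSet_remainder hL, fun R => Set.sdiff_subset,
    h.remainder_disjoint Q, h.volume_le hL, ?_⟩
  filter_upwards [ae_all_iff.2 h4, h.ae_exists_notMem_generation hL Q] with x hx ⟨k, hk⟩ hxQ
  have := h.le_tsum (a := fun R => A * coeff r f t L R)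
    (u := fun R => ‖onFun T (localize f t L R) x‖ₑ) (fun R => (hx R).1) (fun R => (hx R).2) k Q hxQ hk
  simpa only [hQ] using this

end SparseHormander

/-! ### Shifted dyadic grids -/

namespace SparseHormander

variable {n m : ℕ}

/-- The one-third trick. If both floors jumped, there would be integers `p`, `q` within `1/8` of `a`
and of `a - 2^i/3`; then `|3(p - q) - 2^i| < 1` forces `3 ∣ 2^i`. -/
lemma floor_shift_eq (a : ℝ) (i : ℕ) :
    ⌊a - 1 / 8⌋ = ⌊a + 1 / 8⌋ ∨ ⌊a - 1 / 8 - 2 ^ i / 3⌋ = ⌊a + 1 / 8 - 2 ^ i / 3⌋ := by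
  by_contra! h
  have key : ∀ b : ℝ, ⌊b - 1 / 8⌋ ≠ ⌊b + 1 / 8⌋ → b - 1 / 8 < ⌊b + 1 / 8⌋ := fun b hb => by
    by_contra! hc
    refine hb (le_antisymm (Int.floor_mono (by linarith)) (Int.le_floor.2 hc))
  have h1 := key a h.1
  have h2 := key (a - 2 ^ i / 3) (by
    intro h3
    apply h.2
    convert h3 using 2 <;> ring)
  have h3 := Int.floor_le (a + 1 / 8)
  have h4 := Int.floor_le (a - 2 ^ i / 3 + 1 / 8)
  set p := ⌊a + 1 / 8⌋
  set q := ⌊a - 2 ^ i / 3 + 1 / 8⌋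
  have h5 : 3 * (p - q) = (2 : ℤ) ^ i := by
    have h6 : ((3 * (p - q) - 2 ^ i : ℤ) : ℝ) < 1 := by push_cast; linarith
    have h7 : (-1 : ℝ) < ((3 * (p - q) - 2 ^ i : ℤ) : ℝ) := by push_cast; linarith
    have h8 : 3 * (p - q) - 2 ^ i < (1 : ℤ) := by exact_mod_cast h6
    have h9 : (-1 : ℤ) < 3 * (p - q) - 2 ^ i := by exact_mod_cast h7
    omega
  have h6 : (3 : ℤ) ∣ 2 ^ i := ⟨_, h5.symm⟩
  have h7 := Int.Prime.dvd_pow' (p := 3) Nat.prime_three h6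
  norm_num at h7

/-- Origins of the shifted grids. -/
noncomputable def shift (t : Fin n → ℝ) (L : ℝ) (τ : Fin n → Bool) : Fin n → ℝ :=
  fun j => t j + if τ j then 8 * L / 3 else 0

/-- The double of `R` has a quarter of the side of a generation-`R.1` cube in the grid of top scale
`8L`. In units of that side the shift `8L/3` equals `2^{R.1}/3`, so in every coordinate the shifted
or the unshifted grid has no cut through the double. -/
lemma exists_big_subset_dcube (t : Fin n → ℝ) {L : ℝ} (hL : 0 < L) (R : Label n) :
    ∃ τ : Fin n → Bool, ∃ R' : Label n, R'.1 = R.1 ∧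
      big t L R ⊆ dcube (shift t L τ) (8 * L) R' := by
  have hs := side_pos hL R
  have h : ∀ j, ∃ b : Bool, ∃ k : ℤ, ∀ y : ℝ, |y - center t L R j| ≤ side L R →
      ⌊(y - (t j + if b then 8 * L / 3 else 0)) / (8 * side L R)⌋ = k := by
    intro j
    have h8 : (0 : ℝ) < 8 * side L R := by positivity
    have hb : ∀ u : ℝ, ⌊(center t L R j - t j) / (8 * side L R) - 1 / 8 - u / (8 * side L R)⌋ =
        ⌊(center t L R j - t j) / (8 * side L R) + 1 / 8 - u / (8 * side L R)⌋ →
        ∃ k : ℤ, ∀ y : ℝ, |y - center t L R j| ≤ side L R →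
          ⌊(y - (t j + u)) / (8 * side L R)⌋ = k := by
      intro u hu
      refine ⟨_, fun y hy => le_antisymm ?_ (hu.ge.trans ?_)⟩
      · apply Int.floor_mono
        rw [abs_le] at hy
        rw [← sub_nonneg]
        field_simp
        linarith
      · apply Int.floor_mono
        rw [abs_le] at hy
        rw [← sub_nonneg]
        field_simp
        linarith
    rcases floor_shift_eq ((center t L R j - t j) / (8 * side L R)) R.1 with h | h
    · obtain ⟨k, hk⟩ := hb 0 (by simpa using h)
      exact ⟨false, k, by simpa using hk⟩
    · obtain ⟨k, hk⟩ := hb (8 * L / 3) (by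
        have : 8 * L / 3 / (8 * side L R) = 2 ^ R.1 / 3 := by
          unfold side; field_simp
        rw [this]; exact h)
      exact ⟨true, k, by simpa using hk⟩
  choose b k hk using h
  refine ⟨b, (R.1, k), rfl, fun y hy j => ?_⟩
  have h1 : side (8 * L) ((R.1, k) : Label n) = 8 * side L R := by
    simp only [side]; ring
  rw [h1]
  refine hk j (y j) ?_
  have := hy j
  simpa using this

lemma dcube_ae_eq_cube {t : Fin n → ℝ} {L : ℝ} (hL : 0 < L) (Q : Label n) :
    dcube t L Q =ᵐ[volume] cube (center t L Q) (side L Q) :=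
  ae_eq_of_subset_of_measure_ge (dcube_subset_cube hL Q)
    (by rw [volume_dcube hL, volume_cube _ (side_pos hL Q).le])
    (measurableSet_dcube hL Q).nullMeasurableSet (volume_cube_ne_top _ (side_pos hL Q).le)

/-- Half-open and closed cubes differ by a null set, so cubes of every shifted grid are tested by
the weight constant. -/
lemma average_dcube_le_multiApConst {r p : ℝ} {P : Fin m → ℝ} {w : Fin m → (Fin n → ℝ) → ℝ}
    {t : Fin n → ℝ} {L : ℝ} (hL : 0 < L) (Q : Label n) :
    (⨍⁻ x in dcube t L Q, ENNReal.ofReal (productWeight p P w x) ∂volume) *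
      ∏ i, (⨍⁻ x in dcube t L Q, ENNReal.ofReal (w i x ^ (-(r / (P i - r)))) ∂volume) ^
        (p * (P i - r) / (P i * r)) ≤ multiApConst r p P w := by
  simp only [setLAverage_congr (dcube_ae_eq_cube hL Q)]
  exact le_iSup_of_le (center t L Q) (le_iSup_of_le (side L Q)
    (le_iSup_of_le (side_pos hL Q) le_rfl))

/-- Averages over the double of a dyadic cube are controlled by averages over a cube of the shifted
grid that contains it. -/
lemma laverage_big_le {t t' : Fin n → ℝ} {L : ℝ} (hL : 0 < L) {R R' : Label n} (h : R'.1 = R.1)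
    (hsub : big t L R ⊆ dcube t' (8 * L) R') (g : (Fin n → ℝ) → ℝ≥0∞) :
    ⨍⁻ x in big t L R, g x ∂volume ≤ 8 ^ n * ⨍⁻ x in dcube t' (8 * L) R', g x ∂volume := by
  have h8 : (0 : ℝ) < 8 * L := by positivity
  rw [setLAverage_eq, setLAverage_eq]
  have h1 : volume (dcube t' (8 * L) R') ≤ 8 ^ n * volume (big t L R) := by
    rw [volume_dcube h8, volume_big hL, volume_dcube hL]
    have : side (8 * L) R' = 8 * side L R := by simp only [side, h]; ring
    rw [this, ENNReal.ofReal_mul (by norm_num), mul_pow, ENNReal.ofReal_ofNat]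
    gcongr
    exact le_mul_of_one_le_left' (one_le_pow₀ (by norm_num))
  rw [ENNReal.div_le_iff (volume_big_ne_zero hL R) (volume_big_ne_top hL R)]
  calc ∫⁻ x in big t L R, g x ∂volume ≤ ∫⁻ x in dcube t' (8 * L) R', g x ∂volume :=
        lintegral_mono_set hsub
    _ = (∫⁻ x in dcube t' (8 * L) R', g x ∂volume) / volume (dcube t' (8 * L) R') *
        volume (dcube t' (8 * L) R') :=
        (ENNReal.div_mul_cancel (volume_dcube_pos h8 R').ne' (volume_dcube_ne_top h8 R')).symm
    _ ≤ (∫⁻ x in dcube t' (8 * L) R', g x ∂volume) / volume (dcube t' (8 * L) R') *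
        (8 ^ n * volume (big t L R)) := by gcongr
    _ = _ := by ring

lemma hasEmbedding_dcube {T : Type*} [Fintype T] (t : T → Fin n → ℝ) {L : ℝ} (hL : 0 < L)
    {ι : Type*} (F : Finset ι) (Q : ι → Label n) (τ : ι → T) (E : ι → Set (Fin n → ℝ))
    (hE : ∀ j ∈ F, MeasurableSet (E j)) (hEQ : ∀ j ∈ F, E j ⊆ dcube (t (τ j)) L (Q j))
    (hdis : (F : Set ι).PairwiseDisjoint E) :
    HasEmbedding volume F (fun j => dcube (t (τ j)) L (Q j)) E
      (fun s => Fintype.card T * embedConst s) := by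
  intro s hs S _ g hg hfin
  exact sum_laverage_rpow_le_grids t hL _ hs hg F Q τ E hE hEQ hdis hfin

end SparseHormander

/-! ### The weighted bound on test functions -/

namespace SparseHormander

variable {n m : ℕ} {r : ℝ} {T : MultilinearMap ℂ
  (fun _ : Fin m => Lp ℂ (ENNReal.ofReal r) (volume : Measure (Fin n → ℝ)))
  ((Fin n → ℝ) →ₘ[volume] ℂ)} {K : (Fin n → ℝ) → (Fin m → Fin n → ℝ) → ℂ}

lemma coeff_le (hr : 0 < r) (f : Fin m → (Fin n → ℝ) → ℂ) {t t' : Fin n → ℝ} {L : ℝ} (hL : 0 < L)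
    {R R' : Label n} (h : R'.1 = R.1) (hsub : big t L R ⊆ dcube t' (8 * L) R') :
    coeff r f t L R ≤ (((8 : ℝ≥0∞) ^ n) ^ (1 / r)) ^ m *
      ∏ i, (⨍⁻ x in dcube t' (8 * L) R', ‖f i x‖ₑ ^ r ∂volume) ^ (1 / r) := by
  unfold coeff
  calc ∏ i, avg r (f i) (big t L R) ^ (1 / r)
      ≤ ∏ i, (((8 : ℝ≥0∞) ^ n) ^ (1 / r) *
        (⨍⁻ x in dcube t' (8 * L) R', ‖f i x‖ₑ ^ r ∂volume) ^ (1 / r)) := by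
        refine Finset.prod_le_prod' fun i _ => ?_
        rw [← ENNReal.mul_rpow_of_nonneg _ _ (by positivity)]
        exact ENNReal.rpow_le_rpow (laverage_big_le hL h hsub _) (by positivity)
    _ = _ := by rw [Finset.prod_mul_distrib]; simp

/-- Monotone convergence along finite subfamilies; the absorption argument for `p > 1` is only
available for finite sums. -/
lemma lintegral_tsum_rpow_mul_le {J X : Type*} [Countable J] [MeasurableSpace X] {μ : Measure X}
    {p : ℝ} (hp : 0 < p) {a : J → X → ℝ≥0∞} (ha : ∀ j, Measurable (a j)) {v : X → ℝ≥0∞}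
    (hv : Measurable v) {M : ℝ≥0∞} (h : ∀ F : Finset J, ∫⁻ x, (∑ j ∈ F, a j x) ^ p * v x ∂μ ≤ M) :
    ∫⁻ x, (∑' j, a j x) ^ p * v x ∂μ ≤ M := by
  have h1 : ∀ x, (∑' j, a j x) ^ p * v x = ⨆ F : Finset J, (∑ j ∈ F, a j x) ^ p * v x := by
    intro x
    rw [ENNReal.tsum_eq_iSup_sum, ← ENNReal.iSup_mul]
    congr 1
    exact (ENNReal.orderIsoRpow p hp).map_iSup _
  simp only [h1]
  rw [lintegral_iSup_directed]
  · exact iSup_le h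
  · intro F
    exact (((Finset.measurable_sum F fun j _ => ha j).pow_const p).mul hv).aemeasurable
  · refine Monotone.directed_le fun F G hFG x => ?_
    dsimp only
    gcongr

/-- Sparse domination, transfer of each cube to a shifted grid, and the sparse bound. The constant
depends on neither the grid nor `Q`. -/
lemma exists_local_bound (hm : 0 < m) (hr : 1 ≤ r) (hTK : IsSingularIntegral r T K)
    (hT : IsWeakBounded r T) (hK : hormanderConst r K < ∞) {P : Fin m → ℝ} (hP : ∀ i, r < P i)
    {p β : ℝ} (hp0 : 0 < p) (hp : 1 / p = ∑ i, 1 / P i) (hβ1 : 1 ≤ β)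
    (hβ : ∀ i, P i / (P i - r) / p ≤ β) :
    ∃ C : ℝ≥0∞, C ≠ ∞ ∧ ∀ w : Fin m → (Fin n → ℝ) → ℝ, (∀ i, Measurable (w i)) →
      (∀ i x, 0 < w i x) → multiApConst r p P w ≠ ∞ →
      ∀ f : Fin m → (Fin n → ℝ) → ℂ, (∀ i, IsTest (f i)) →
      ∀ (t : Fin n → ℝ) (L : ℝ), 0 < L → ∀ Q : Label n, localize f t L Q = f →
      ∫⁻ x in dcube t L Q, ‖onFun T f x‖ₑ ^ p * ENNReal.ofReal (productWeight p P w x) ≤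
        (C * multiApConst r p P w ^ β) ^ p *
          ∏ i, (∫⁻ x, ‖f i x‖ₑ ^ P i * ENNReal.ofReal (w i x)) ^ (p / P i) := by
  have hr0 : 0 < r := by linarith
  obtain ⟨A, hA, hdom⟩ := exists_sparse_domination hm hr hTK hT hK
  obtain ⟨C, hC, hsp⟩ := exists_sparse_bound (n := n) (m := m) hm hr0 hP hp hβ1 hβ
    -- The containing cube has measure `8^n |R|`, and `|R| ≤ 2 |E_R|`.
    (κ := 2 * 8 ^ n) (by positivity) (ENNReal.mul_ne_top (by simp) (by simp))
    (Cem := fun s => Fintype.card (Fin n → Bool) * embedConst s)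
    (fun s hs => ENNReal.mul_ne_top (by simp) (embedConst_ne_top hs))
  set H : ℝ≥0∞ := (((8 : ℝ≥0∞) ^ n) ^ (1 / r)) ^ m with hH
  have hHtop : H ≠ ∞ := ENNReal.pow_ne_top (ENNReal.rpow_ne_top_of_nonneg (by positivity) (by simp))
  refine ⟨A * H * C, ENNReal.mul_ne_top (ENNReal.mul_ne_top hA hHtop) hC,
    fun w hw hw0 hwA f hf t L hL Q hQ => ?_⟩
  obtain ⟨S, E, hEm, hEs, hEd, hEv, hle⟩ := hdom f hf t L hL Q hQ
  choose τ R' hR' hsub using exists_big_subset_dcube (n := n) t hL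
  have h8 : 0 < 8 * L := by positivity
  set D : S → Set (Fin n → ℝ) := fun R => dcube (shift t L (τ R)) (8 * L) (R' R) with hD
  have hRD : ∀ R : S, dcube t L (R : Label n) ⊆ D R := fun R =>
    ((dcube_subset_cube hL R.1).trans
      (cube_mono _ (by linarith [side_pos hL (R : Label n)]))).trans (hsub R)
  have hED : ∀ R : S, E R ⊆ D R := fun R => (hEs R).trans (hRD R)
  have hvol : ∀ R : S, volume (D R) ≤ 2 * 8 ^ n * volume (E R) := by
    intro R
    rw [hD, volume_dcube h8]
    have : side (8 * L) (R' R) = 8 * side L (R : Label n) := by simp only [side, hR']; ring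
    rw [this, ENNReal.ofReal_mul (by norm_num), mul_pow, ENNReal.ofReal_ofNat, ← volume_dcube hL]
    calc _ ≤ (8 : ℝ≥0∞) ^ n * (2 * volume (E R)) := by gcongr; exact hEv R
      _ = _ := by ring
  set a : S → (Fin n → ℝ) → ℝ≥0∞ := fun R => (D R).indicator
    (fun _ => ∏ i, (⨍⁻ x in D R, ‖f i x‖ₑ ^ r ∂volume) ^ (1 / r)) with ha
  have ham : ∀ R, Measurable (a R) := fun R =>
    measurable_const.indicator (measurableSet_dcube h8 _)
  have hvm : Measurable fun x => ENNReal.ofReal (productWeight p P w x) := by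
    unfold productWeight
    exact (Finset.measurable_prod _ fun i _ => (hw i).pow_const _).ennreal_ofReal
  have hsum := lintegral_tsum_rpow_mul_le (μ := volume) hp0 ham hvm (M := (C * multiApConst r p P w ^ β) ^ p *
      ∏ i, (∫⁻ x, ‖f i x‖ₑ ^ P i * ENNReal.ofReal (w i x)) ^ (p / P i)) (by
    intro F
    refine hsp w hw hw0 _ hwA F D (fun R => E R) ?_ (fun R _ => measurableSet_dcube h8 _)
      (fun R _ => hEm R) (fun R _ => hED R) (fun R _ => (volume_dcube_pos h8 _).ne')
      (fun R _ => volume_dcube_ne_top h8 _) (fun R _ => hvol R)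
      (fun R _ => average_dcube_le_multiApConst h8 _) (fun i x => ‖f i x‖ₑ)
      (fun i => (hf i).1.enorm) (fun i R _ => avg_ne_top hr0 (hf i) (volume_dcube_pos h8 _).ne')
    exact hasEmbedding_dcube (fun σ => shift t L σ) h8 F (fun R => R' R) (fun R => τ R)
      (fun R => E R) (fun R _ => hEm R) (fun R _ => hED R)
      (fun R _ R₁ _ hne => hEd R.2 R₁.2 (Subtype.coe_injective.ne hne)))
  calc ∫⁻ x in dcube t L Q, ‖onFun T f x‖ₑ ^ p * ENNReal.ofReal (productWeight p P w x)
      ≤ ∫⁻ x in dcube t L Q, (A * H) ^ p * ((∑' R, a R x) ^ p *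
          ENNReal.ofReal (productWeight p P w x)) := by
        refine setLIntegral_mono_ae' (measurableSet_dcube hL Q) ?_
        filter_upwards [hle] with x hx hxQ
        rw [← mul_assoc, ← ENNReal.mul_rpow_of_nonneg _ _ hp0.le]
        gcongr
        refine (hx hxQ).trans ?_
        rw [← ENNReal.tsum_mul_left]
        refine ENNReal.tsum_le_tsum fun R => ?_
        by_cases hxR : x ∈ dcube t L (R : Label n)
        · rw [Set.indicator_of_mem hxR, ha]
          dsimp only
          rw [Set.indicator_of_mem (hRD R hxR), mul_assoc]
          gcongr
          exact coeff_le hr0 f hL (hR' R) (hsub R)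
        · rw [Set.indicator_of_notMem hxR]; exact zero_le
    _ ≤ ∫⁻ x, (A * H) ^ p * ((∑' R, a R x) ^ p *
          ENNReal.ofReal (productWeight p P w x)) := setLIntegral_le_lintegral _ _
    _ = (A * H) ^ p * ∫⁻ x, ((∑' R, a R x) ^ p * ENNReal.ofReal (productWeight p P w x)) :=
        lintegral_const_mul _ (((Measurable.tsum ham).pow_const p).mul hvm)
    _ ≤ (A * H) ^ p * ((C * multiApConst r p P w ^ β) ^ p *
          ∏ i, (∫⁻ x, ‖f i x‖ₑ ^ P i * ENNReal.ofReal (w i x)) ^ (p / P i)) := by gcongr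
    _ = _ := by
        rw [← mul_assoc, ← ENNReal.mul_rpow_of_nonneg _ _ hp0.le]
        simp only [mul_assoc]

lemma dcube_centered {L : ℝ} (hL : 0 < L) :
    dcube (fun _ : Fin n => -(L / 2)) L (0, 0) = {x | ∀ j, -(L / 2) ≤ x j ∧ x j < L / 2} := by
  rw [dcube_eq_pi hL]
  ext x
  simp only [side, Set.mem_pi, Set.mem_univ, true_implies, Set.mem_Ico, Set.mem_ofPred_eq]
  refine forall_congr' fun j => ?_
  simp only [Pi.zero_apply, Int.cast_zero]
  constructor <;> rintro ⟨h1, h2⟩ <;> constructor <;> linarith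

lemma big_centered (L : ℝ) : big (fun _ : Fin n => -(L / 2)) L (0, 0) = cube 0 (2 * L) := by
  unfold big
  congr 1
  · ext j; simp [center, side]; ring
  · simp [side]

/-- The local bound is uniform, so space is exhausted by centred cubes whose doubles contain all the
supports. -/
lemma exists_test_bound_of_pos (hm : 0 < m) (hr : 1 ≤ r) (hTK : IsSingularIntegral r T K)
    (hT : IsWeakBounded r T) (hK : hormanderConst r K < ∞) {P : Fin m → ℝ} (hP : ∀ i, r < P i)
    {p β : ℝ} (hp0 : 0 < p) (hp : 1 / p = ∑ i, 1 / P i) (hβ1 : 1 ≤ β)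
    (hβ : ∀ i, P i / (P i - r) / p ≤ β) :
    ∃ C : ℝ≥0∞, C ≠ ∞ ∧ ∀ w : Fin m → (Fin n → ℝ) → ℝ, (∀ i, Measurable (w i)) →
      (∀ i x, 0 < w i x) → multiApConst r p P w ≠ ∞ →
      ∀ f : Fin m → (Fin n → ℝ) → ℂ, (∀ i, IsTest (f i)) →
      ∫⁻ x, ‖onFun T f x‖ₑ ^ p * ENNReal.ofReal (productWeight p P w x) ≤
        (C * multiApConst r p P w ^ β) ^ p *
          ∏ i, (∫⁻ x, ‖f i x‖ₑ ^ P i * ENNReal.ofReal (w i x)) ^ (p / P i) := by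
  obtain ⟨C, hC, h⟩ := exists_local_bound hm hr hTK hT hK hP hp0 hp hβ1 hβ
  refine ⟨C, hC, fun w hw hw0 hwA f hf => ?_⟩
  have h1 : ∃ L₀ : ℝ, 0 < L₀ ∧ ∀ i, Function.support (f i) ⊆ cube 0 (2 * L₀) := by
    have h2 : ∀ i, ∃ ρ : ℝ, Function.support (f i) ⊆ Metric.closedBall 0 ρ := fun i => by
      obtain ⟨ρ, hρ⟩ := (hf i).2.2.isCompact.isBounded.subset_closedBall 0
      exact ⟨ρ, (subset_tsupport _).trans hρ⟩
    choose ρ hρ using h2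
    have h3 : 0 ≤ ∑ i, |ρ i| := Finset.sum_nonneg fun i _ => abs_nonneg _
    refine ⟨1 + ∑ i, |ρ i|, by linarith, fun i => (hρ i).trans ?_⟩
    rw [cube_eq_closedBall 0 (by linarith)]
    refine Metric.closedBall_subset_closedBall ?_
    have : |ρ i| ≤ ∑ i, |ρ i| :=
      Finset.single_le_sum (f := fun i => |ρ i|) (fun i _ => abs_nonneg _) (Finset.mem_univ i)
    have := le_abs_self (ρ i)
    linarith
  obtain ⟨L₀, hL₀, hsupp⟩ := h1
  have hLk : ∀ k : ℕ, 0 < L₀ + k := fun k => by positivity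
  set B : ℕ → Set (Fin n → ℝ) := fun k => dcube (fun _ => -((L₀ + k) / 2)) (L₀ + k) (0, 0) with hB
  have hBmono : Monotone B := by
    intro k l hkl x hx
    have hkl' : (k : ℝ) ≤ l := by exact_mod_cast hkl
    simp only [hB, dcube_centered (hLk _), Set.mem_ofPred_eq] at hx ⊢
    exact fun j => ⟨by linarith [(hx j).1], by linarith [(hx j).2]⟩
  have hBU : ⋃ k, B k = Set.univ := by
    refine Set.eq_univ_of_forall fun x => Set.mem_iUnion.2 ?_
    obtain ⟨k, hk⟩ := exists_nat_gt (2 * ‖x‖)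
    refine ⟨k, ?_⟩
    simp only [hB, dcube_centered (hLk _), Set.mem_ofPred_eq]
    intro j
    have := abs_le.1 ((Real.norm_eq_abs _).symm.le.trans (norm_le_pi_norm x j))
    constructor <;> linarith [this.1, this.2]
  rw [← setLIntegral_univ, ← hBU, setLIntegral_iUnion_of_directed _ hBmono.directed_le]
  refine iSup_le fun k => h w hw hw0 hwA f hf _ _ (hLk k) _ ?_
  funext i
  simp only [localize, big_centered]
  exact Set.indicator_eq_self.2 ((hsupp i).trans (cube_mono _ (by linarith [(Nat.cast_nonneg k : (0:ℝ) ≤ k)])))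

end SparseHormander

/-! ### General weights -/

namespace SparseHormander

variable {n m : ℕ} {r : ℝ}

lemma weightMeasure_congr {w w' : (Fin n → ℝ) → ℝ} (h : w =ᵐ[volume] w') :
    weightMeasure w = weightMeasure w' :=
  withDensity_congr_ae (h.fun_comp ENNReal.ofReal)

lemma weightMeasure_absolutelyContinuous (w : (Fin n → ℝ) → ℝ) : weightMeasure w ≪ volume :=
  withDensity_absolutelyContinuous _ _

lemma IsWeight.absolutelyContinuous {w : (Fin n → ℝ) → ℝ} (hw : IsWeight w) :
    volume ≪ weightMeasure w :=
  withDensity_absolutelyContinuous' hw.1.ennreal_ofReal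
    (hw.2.mono fun _ hx => (ENNReal.ofReal_pos.2 hx).ne')

lemma IsWeight.productWeight {w : Fin m → (Fin n → ℝ) → ℝ} (hw : ∀ i, IsWeight (w i)) (p : ℝ)
    (P : Fin m → ℝ) : IsWeight (productWeight p P w) := by
  refine ⟨Finset.aemeasurable_fun_prod _ fun i _ => (hw i).1.pow_const _, ?_⟩
  filter_upwards [ae_all_iff.2 fun i => (hw i).2] with x hx
  exact productWeight_pos hx

lemma IsWeight.eLpNorm_eq {w : (Fin n → ℝ) → ℝ} (hw : IsWeight w) {q : ℝ} (hq : 0 < q)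
    {f : (Fin n → ℝ) → ℂ} (hf : AEStronglyMeasurable f volume) :
    eLpNorm f (ENNReal.ofReal q) (weightMeasure w) =
      (∫⁻ x, ‖f x‖ₑ ^ q * ENNReal.ofReal (w x)) ^ (1 / q) := by
  rw [eLpNorm_eq_lintegral_rpow_enorm_toReal (by simpa using hq) ENNReal.ofReal_ne_top,
    ENNReal.toReal_ofReal hq.le, weightMeasure,
    lintegral_withDensity_eq_lintegral_mul₀ hw.1.ennreal_ofReal (hf.enorm.pow_const q)]
  simp only [Pi.mul_apply, mul_comm]

lemma exists_pos_measurable_ae_eq {w : (Fin n → ℝ) → ℝ} (hw : IsWeight w) :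
    ∃ w' : (Fin n → ℝ) → ℝ, Measurable w' ∧ (∀ x, 0 < w' x) ∧ w =ᵐ[volume] w' := by
  refine ⟨fun x => if 0 < hw.1.mk w x then hw.1.mk w x else 1, ?_, fun x => ?_, ?_⟩
  · exact Measurable.ite (measurableSet_lt measurable_const hw.1.measurable_mk)
      hw.1.measurable_mk measurable_const
  · dsimp only; split_ifs with h
    exacts [h, one_pos]
  · filter_upwards [hw.1.ae_eq_mk, hw.2] with x hx hx0
    rw [← hx, if_pos hx0]

lemma productWeight_congr {p : ℝ} {P : Fin m → ℝ} {w w' : Fin m → (Fin n → ℝ) → ℝ}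
    (h : ∀ i, w i =ᵐ[volume] w' i) : productWeight p P w =ᵐ[volume] productWeight p P w' := by
  filter_upwards [ae_all_iff.2 h] with x hx
  simp only [SparseHormander.productWeight, hx]

lemma multiApConst_congr {r p : ℝ} {P : Fin m → ℝ} {w w' : Fin m → (Fin n → ℝ) → ℝ}
    (h : ∀ i, w i =ᵐ[volume] w' i) : multiApConst r p P w = multiApConst r p P w' := by
  unfold multiApConst
  have h1 : ∀ c l, ⨍⁻ x in cube c l, ENNReal.ofReal (productWeight p P w x) ∂volume =
      ⨍⁻ x in cube c l, ENNReal.ofReal (productWeight p P w' x) ∂volume := fun c l =>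
    laverage_congr (ae_restrict_of_ae ((productWeight_congr h).fun_comp ENNReal.ofReal))
  have h2 : ∀ c l i, ⨍⁻ x in cube c l, ENNReal.ofReal (w i x ^ (-(r / (P i - r)))) ∂volume =
      ⨍⁻ x in cube c l, ENNReal.ofReal (w' i x ^ (-(r / (P i - r)))) ∂volume := fun c l i =>
    laverage_congr (ae_restrict_of_ae
      ((h i).fun_comp fun y => ENNReal.ofReal (y ^ (-(r / (P i - r))))))
  simp only [h1, h2]

variable {T : MultilinearMap ℂ
  (fun _ : Fin m => Lp ℂ (ENNReal.ofReal r) (volume : Measure (Fin n → ℝ)))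
  ((Fin n → ℝ) →ₘ[volume] ℂ)} {K : (Fin n → ℝ) → (Fin m → Fin n → ℝ) → ℂ}

/-- All quantities depend on the weights only almost everywhere, so the weights may be replaced by
measurable, everywhere positive representatives. -/
theorem exists_test_bound (hm : 0 < m) (hr : 1 ≤ r) (hTK : IsSingularIntegral r T K)
    (hT : IsWeakBounded r T) (hK : hormanderConst r K < ∞) {P : Fin m → ℝ} (hP : ∀ i, r < P i)
    {p β : ℝ} (hp0 : 0 < p) (hp : 1 / p = ∑ i, 1 / P i) (hβ1 : 1 ≤ β)
    (hβ : ∀ i, P i / (P i - r) / p ≤ β) :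
    ∃ C : ℝ≥0, ∀ w : Fin m → (Fin n → ℝ) → ℝ, (∀ i, IsWeight (w i)) →
      multiApConst r p P w ≠ ∞ → ∀ f : Fin m → (Fin n → ℝ) → ℂ, (∀ i, IsTest (f i)) →
      eLpNorm (onFun T f) (ENNReal.ofReal p) (weightMeasure (productWeight p P w)) ≤
        C * multiApConst r p P w ^ β *
          ∏ i, eLpNorm (f i) (ENNReal.ofReal (P i)) (weightMeasure (w i)) := by
  obtain ⟨C, hC, h⟩ := exists_test_bound_of_pos hm hr hTK hT hK hP hp0 hp hβ1 hβ
  have hP0 : ∀ i, 0 < P i := fun i => by linarith [hP i]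
  refine ⟨C.toNNReal, fun w hw hwA f hf => ?_⟩
  rw [ENNReal.coe_toNNReal hC]
  choose w' hw'm hw'0 hww' using fun i => exists_pos_measurable_ae_eq (hw i)
  have hwt : ∀ i, IsWeight (w' i) := fun i =>
    ⟨(hw'm i).aemeasurable, Filter.Eventually.of_forall (hw'0 i)⟩
  rw [weightMeasure_congr (productWeight_congr hww'), multiApConst_congr hww']
  rw [multiApConst_congr hww'] at hwA
  simp only [weightMeasure_congr (hww' _)]
  rw [(IsWeight.productWeight hwt p P).eLpNorm_eq hp0 (aestronglyMeasurable_onFun f)]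
  simp only [fun i => (hwt i).eLpNorm_eq (hP0 i) (hf i).1.aestronglyMeasurable]
  refine (ENNReal.rpow_le_rpow (h w' hw'm hw'0 hwA f hf) (by positivity)).trans_eq ?_
  rw [ENNReal.mul_rpow_of_nonneg _ _ (by positivity), ← ENNReal.rpow_mul, mul_one_div_cancel hp0.ne',
    ENNReal.rpow_one, ← ENNReal.prod_rpow_of_nonneg (by positivity)]
  congr 1
  refine Finset.prod_congr rfl fun i _ => ?_
  rw [← ENNReal.rpow_mul]
  congr 1
  field_simp

end SparseHormander

/-! ### Completeness and multilinear continuity -/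

namespace SparseHormander

open Filter Topology

/-- Completeness of `L^p` in terms of functions, for all `0 < p < ∞`. -/
lemma exists_tendsto_eLpNorm_of_cauchy {X E : Type*} [MeasurableSpace X] [NormedAddCommGroup E]
    [CompleteSpace E] {ν : Measure X}
    {p : ℝ≥0∞} (hp0 : p ≠ 0) (hp1 : p ≠ ∞) {f : ℕ → X → E}
    (hf : ∀ k, AEStronglyMeasurable (f k) ν)
    (hc : Tendsto (fun k : ℕ × ℕ => eLpNorm (f k.1 - f k.2) p ν) atTop (𝓝 0)) :
    ∃ h : X → E, StronglyMeasurable h ∧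
      Tendsto (fun k => eLpNorm (f k - h) p ν) atTop (𝓝 0) := by
  have hc' : ∀ ε : ℝ≥0∞, 0 < ε → ∃ N, ∀ k l, N ≤ k → N ≤ l → eLpNorm (f k - f l) p ν ≤ ε := by
    intro ε hε
    obtain ⟨⟨a, b⟩, hab⟩ := eventually_atTop.1 (ENNReal.tendsto_nhds_zero.1 hc ε hε)
    exact ⟨max a b, fun k l hk hl => hab (k, l) ⟨(le_max_left _ _).trans hk, (le_max_right _ _).trans hl⟩⟩
  have hq : 0 < p.toReal := ENNReal.toReal_pos hp0 hp1
  have hc2 : ∀ k : ℕ, ∃ N, ∀ a b, N ≤ a → N ≤ b →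
      ν {x | ENNReal.ofReal ((1 / 2) ^ k) ≤ ‖f a x - f b x‖ₑ} ≤ ENNReal.ofReal ((1 / 2) ^ k) := by
    intro k
    set ε : ℝ≥0∞ := ENNReal.ofReal ((1 / 2) ^ k) with hε
    have hε0 : 0 < ε := ENNReal.ofReal_pos.2 (by positivity)
    have hεt : ε ≠ ∞ := ENNReal.ofReal_ne_top
    have hε2 : ε ^ (1 / p.toReal) ≠ 0 := (ENNReal.rpow_pos hε0 hεt).ne'
    -- With this threshold Chebyshev's inequality bounds the measure where the difference is at
    -- least `ε` by `ε`. Borel–Cantelli then gives a subsequence converging almost everywhere; no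
    -- triangle inequality in `L^p` is used.
    obtain ⟨N, hN⟩ := hc' (ε * ε ^ (1 / p.toReal)) (ENNReal.mul_pos hε0.ne' hε2)
    refine ⟨N, fun a b ha hb => ?_⟩
    have h1 := mul_meas_ge_le_pow_eLpNorm' ν hp0 hp1 ((hf a).sub (hf b)) ε
    have h2 : eLpNorm (f a - f b) p ν ^ p.toReal ≤ ε ^ p.toReal * ε := by
      refine (ENNReal.rpow_le_rpow (hN a b ha hb) hq.le).trans_eq ?_
      rw [ENNReal.mul_rpow_of_nonneg _ _ hq.le, ← ENNReal.rpow_mul, one_div_mul_cancel hq.ne',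
        ENNReal.rpow_one]
    exact (ENNReal.mul_le_mul_iff_right (ENNReal.rpow_pos hε0 hεt).ne'
      (ENNReal.rpow_ne_top_of_nonneg hq.le hεt)).1 (h1.trans h2)
  obtain ⟨φ, hφ, hφ2⟩ := extraction_forall_of_eventually' (P := fun k N => ∀ a b, N ≤ a → N ≤ b →
      ν {x | ENNReal.ofReal ((1 / 2) ^ k) ≤ ‖f a x - f b x‖ₑ} ≤ ENNReal.ofReal ((1 / 2) ^ k))
    (fun k => by
      obtain ⟨N, hN⟩ := hc2 k
      exact ⟨N, fun M hM a b ha hb => hN a b (hM.trans ha) (hM.trans hb)⟩)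
  have hae : ∀ᵐ x ∂ν, ∃ y, Tendsto (fun k => f (φ k) x) atTop (𝓝 y) := by
    have hs : Summable fun k : ℕ => ((1 : ℝ) / 2) ^ k := summable_geometric_two
    have h1 := ae_eventually_notMem (μ := ν)
      (s := fun k => {x | ENNReal.ofReal ((1 / 2) ^ k) ≤ ‖f (φ (k + 1)) x - f (φ k) x‖ₑ})
      (ne_top_of_le_ne_top hs.tsum_ofReal_ne_top
        (ENNReal.tsum_le_tsum fun k => hφ2 k _ _ (hφ.monotone (Nat.le_succ k)) le_rfl))
    filter_upwards [h1] with x hx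
    refine cauchySeq_tendsto_of_complete ?_
    refine cauchySeq_of_summable_dist (Summable.of_norm_bounded_eventually_nat hs ?_)
    filter_upwards [hx] with k hk
    rw [not_le, ← ofReal_norm, ENNReal.ofReal_lt_ofReal_iff (by positivity)] at hk
    rw [Real.norm_of_nonneg dist_nonneg, dist_comm, dist_eq_norm]
    exact hk.le
  obtain ⟨h, hh, hlim⟩ := exists_stronglyMeasurable_limit_of_tendsto_ae (fun k => hf (φ k)) hae
  refine ⟨h, hh, ENNReal.tendsto_nhds_zero.2 fun ε hε => ?_⟩
  obtain ⟨N, hN⟩ := hc' ε hε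
  filter_upwards [eventually_ge_atTop N] with k hk
  refine Lp.eLpNorm_le_of_ae_tendsto (u := atTop) (f := fun l => f k - f (φ l))
    ?_ (fun l => (hf k).sub (hf _)) ?_
  · filter_upwards [hφ.tendsto_atTop.eventually_ge_atTop N] with l hl using hN _ _ hk hl
  · filter_upwards [hlim] with x hx
    exact tendsto_const_nhds.sub hx

lemma tendsto_eLpNorm_add {X E ι : Type*} [MeasurableSpace X] [NormedAddCommGroup E]
    {ν : Measure X} {p : ℝ≥0∞} {l : Filter ι} {u v : ι → X → E}
    (hu : ∀ k, AEStronglyMeasurable (u k) ν) (hv : ∀ k, AEStronglyMeasurable (v k) ν)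
    (hu0 : Tendsto (fun k => eLpNorm (u k) p ν) l (𝓝 0))
    (hv0 : Tendsto (fun k => eLpNorm (v k) p ν) l (𝓝 0)) :
    Tendsto (fun k => eLpNorm (u k + v k) p ν) l (𝓝 0) := by
  have h := ENNReal.Tendsto.const_mul (a := ENNReal.LpAddConst p) (hu0.add hv0)
    (Or.inr (ENNReal.LpAddConst_lt_top p).ne)
  rw [add_zero, mul_zero] at h
  exact tendsto_of_tendsto_of_tendsto_of_le_of_le tendsto_const_nhds h (fun _ => zero_le)
    (fun k => eLpNorm_add_le' (hu k) (hv k) p)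

lemma tendsto_prod_zero {ι κ : Type*} [Fintype κ] {l : Filter ι} {c : ι → κ → ℝ≥0∞} {M : ℝ≥0∞}
    (hM : M ≠ ∞) (i : κ) (hc : ∀ j, j ≠ i → ∀ᶠ k in l, c k j ≤ M)
    (hi : Tendsto (fun k => c k i) l (𝓝 0)) : Tendsto (fun k => ∏ j, c k j) l (𝓝 0) := by
  classical
  have h : Tendsto (fun k => c k i * ∏ _j ∈ Finset.univ.erase i, M) l (𝓝 0) := by
    have := ENNReal.Tendsto.mul_const (b := ∏ _j ∈ Finset.univ.erase i, M) hi
      (Or.inr (by simpa using ENNReal.pow_ne_top hM))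
    rwa [zero_mul] at this
  have hc' : ∀ᶠ k in l, ∀ j, j ≠ i → c k j ≤ M := by
    rw [eventually_all]
    intro j
    by_cases hj : j = i
    · exact Eventually.of_forall fun _ h => (h hj).elim
    · exact (hc j hj).mono fun _ h _ => h
  refine tendsto_of_tendsto_of_tendsto_of_le_of_le' tendsto_const_nhds h
    (Eventually.of_forall fun _ => zero_le) ?_
  filter_upwards [hc'] with k hk
  rw [← Finset.mul_prod_erase _ _ (Finset.mem_univ i)]
  gcongr with j hj
  exact hk j (Finset.ne_of_mem_erase hj)

/-- If a multilinear map sends families with null norm product to null families, then it sends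
bounded, asymptotically equal families to asymptotically equal families. -/
lemma null_map_sub_map {ι : Type*} {l : Filter ι} {m : ℕ} {V : Fin m → Type*} {W : Type*}
    [∀ i, AddCommGroup (V i)] [∀ i, Module ℂ (V i)] [AddCommGroup W] [Module ℂ W]
    (T : MultilinearMap ℂ V W) (Null : (ι → W) → Prop) (h0 : Null 0)
    (hadd : ∀ u v, Null u → Null v → Null (u + v)) (N : ∀ i, V i → ℝ≥0∞)
    (hT : ∀ c : ι → ∀ i, V i, (∀ k i, N i (c k i) ≠ ∞) →
      Tendsto (fun k => ∏ i, N i (c k i)) l (𝓝 0) → Null fun k => T (c k))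
    {a b : ι → ∀ i, V i} (ha : ∀ k i, N i (a k i) ≠ ∞) (hb : ∀ k i, N i (b k i) ≠ ∞)
    (hab : ∀ k i, N i (a k i - b k i) ≠ ∞) {M : ℝ≥0∞} (hM : M ≠ ∞)
    (haM : ∀ i, ∀ᶠ k in l, N i (a k i) ≤ M) (hbM : ∀ i, ∀ᶠ k in l, N i (b k i) ≤ M)
    (hlim : ∀ i, Tendsto (fun k => N i (a k i - b k i)) l (𝓝 0)) :
    Null fun k => T (a k) - T (b k) := by
  have hsum : ∀ (s : Finset (Fin m)) (u : Fin m → ι → W), (∀ i ∈ s, Null (u i)) →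
      Null (∑ i ∈ s, u i) := fun s u hu => Finset.sum_induction u Null hadd h0 hu
  -- Telescoping: entries of `a` before position `i`, the difference at `i`, entries of `b` after
  -- it.
  set c : Fin m → ι → ∀ i, V i := fun i k j =>
    if j < i then a k j
    else if i = j then a k j - b k j else b k j with hc
  have h1 : (fun k => T (a k) - T (b k)) = ∑ i, fun k => T (c i k) := by
    funext k
    rw [Finset.sum_apply]
    simpa [hc] using T.map_sub_map_piecewise (a k) (b k) Finset.univ
  rw [h1]
  refine hsum _ _ fun i _ => hT _ (fun k j => ?_) (tendsto_prod_zero hM i (fun j hj => ?_) ?_)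
  · simp only [hc]; split_ifs
    exacts [ha k j, hab k j, hb k j]
  · simp only [hc, if_neg hj.symm]
    split_ifs
    exacts [haM j, hbM j]
  · simpa [hc] using hlim i

end SparseHormander

/-! ### Truncation and convergence in measure -/

namespace SparseHormander

open Filter Topology

variable {n m : ℕ} {r : ℝ}

/-- Truncation in space and in height. -/
noncomputable def trunc (k : ℕ) (g : (Fin n → ℝ) → ℂ) : (Fin n → ℝ) → ℂ :=
  (Metric.closedBall 0 k ∩ {x | ‖g x‖ ≤ k}).indicator g

lemma isTest_trunc (k : ℕ) {g : (Fin n → ℝ) → ℂ} (hg : Measurable g) : IsTest (trunc k g) := by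
  refine ⟨hg.indicator (measurableSet_closedBall.inter (measurableSet_le hg.norm measurable_const)),
    ⟨k, fun y => ?_⟩, ?_⟩
  · unfold trunc
    by_cases hy : y ∈ Metric.closedBall 0 k ∩ {x | ‖g x‖ ≤ k}
    · rw [Set.indicator_of_mem hy]; exact hy.2
    · rw [Set.indicator_of_notMem hy]; simp
  · refine HasCompactSupport.of_support_subset_isCompact (isCompact_closedBall 0 (k : ℝ)) ?_
    exact Set.support_indicator_subset.trans Set.inter_subset_left

lemma enorm_trunc_le (k : ℕ) (g : (Fin n → ℝ) → ℂ) (x : Fin n → ℝ) : ‖trunc k g x‖ₑ ≤ ‖g x‖ₑ := by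
  unfold trunc
  rw [enorm_indicator_eq_indicator_enorm]
  exact Set.indicator_le_self _ _ _

lemma eLpNorm_trunc_le (k : ℕ) (g : (Fin n → ℝ) → ℂ) (q : ℝ≥0∞) (μ : Measure (Fin n → ℝ)) :
    eLpNorm (trunc k g) q μ ≤ eLpNorm g q μ :=
  eLpNorm_mono_enorm (enorm_trunc_le k g)

lemma eventually_trunc_eq (g : (Fin n → ℝ) → ℂ) (x : Fin n → ℝ) :
    ∀ᶠ k in atTop, trunc k g x = g x := by
  filter_upwards [tendsto_natCast_atTop_atTop.eventually_ge_atTop ‖x‖,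
    tendsto_natCast_atTop_atTop.eventually_ge_atTop ‖g x‖] with k hk1 hk2
  exact Set.indicator_of_mem
    (show x ∈ Metric.closedBall 0 (k : ℝ) ∩ {x | ‖g x‖ ≤ k} from ⟨by simpa using hk1, hk2⟩) _

lemma tendsto_eLpNorm_trunc_sub {g : (Fin n → ℝ) → ℂ} (hg : Measurable g) {q : ℝ} (hq : 0 < q)
    {μ : Measure (Fin n → ℝ)} (hgq : eLpNorm g (ENNReal.ofReal q) μ ≠ ∞) :
    Tendsto (fun k => eLpNorm (trunc k g - g) (ENNReal.ofReal q) μ) atTop (𝓝 0) := by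
  have hle : ∀ k x, ‖(trunc k g - g) x‖ₑ ≤ ‖g x‖ₑ := by
    intro k x
    simp only [Pi.sub_apply, trunc]
    by_cases hx : x ∈ Metric.closedBall 0 k ∩ {x | ‖g x‖ ≤ k}
    · rw [Set.indicator_of_mem hx]; simp
    · rw [Set.indicator_of_notMem hx]; simp
  have hq0 : ENNReal.ofReal q ≠ 0 := by simpa using hq
  have hlim : Tendsto (fun k => ∫⁻ x, ‖(trunc k g - g) x‖ₑ ^ q ∂μ) atTop (𝓝 (∫⁻ _, 0 ∂μ)) := by
    refine tendsto_lintegral_of_dominated_convergence (fun x => ‖g x‖ₑ ^ q)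
      (fun k => (((isTest_trunc k hg).1.sub hg).enorm.pow_const q))
      (fun k => Eventually.of_forall fun x => ENNReal.rpow_le_rpow (hle k x) hq.le) ?_
      (Eventually.of_forall fun x => ?_)
    · have h := (lintegral_rpow_enorm_lt_top_of_eLpNorm_lt_top hq0 ENNReal.ofReal_ne_top
        (lt_top_iff_ne_top.2 hgq)).ne
      rwa [ENNReal.toReal_ofReal hq.le] at h
    · refine tendsto_const_nhds.congr' ?_
      filter_upwards [eventually_trunc_eq g x] with k hk
      simp [hk, hq]
  rw [lintegral_zero] at hlim
  have h2 := ((ENNReal.continuous_rpow_const (y := 1 / q)).tendsto 0).comp hlim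
  rw [ENNReal.zero_rpow_of_pos (by positivity)] at h2
  refine h2.congr fun k => ?_
  rw [eLpNorm_eq_lintegral_rpow_enorm_toReal hq0 ENNReal.ofReal_ne_top, ENNReal.toReal_ofReal hq.le]
  rfl

/-- Convergence to `0` in measure. -/
def NullInMeasure {ι : Type*} (l : Filter ι) (u : ι → (Fin n → ℝ) →ₘ[volume] ℂ) : Prop :=
  ∀ t : ℝ≥0, 0 < t → Tendsto (fun k => volume {x | (t : ℝ≥0∞) < ‖u k x‖ₑ}) l (𝓝 0)

lemma nullInMeasure_zero {ι : Type*} (l : Filter ι) :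
    NullInMeasure (n := n) l (0 : ι → (Fin n → ℝ) →ₘ[volume] ℂ) := by
  intro t _
  have : ∀ k : ι, volume {x | (t : ℝ≥0∞) < ‖(0 : ι → (Fin n → ℝ) →ₘ[volume] ℂ) k x‖ₑ} = 0 := by
    intro k
    refine (measure_eq_zero_iff_ae_notMem).2 ?_
    filter_upwards [AEEqFun.coeFn_zero (α := Fin n → ℝ) (β := ℂ) (μ := volume)] with x hx
    simp only [Pi.zero_apply, hx]
    simp
  simp only [this]
  exact tendsto_const_nhds

lemma NullInMeasure.add {ι : Type*} {l : Filter ι} {u v : ι → (Fin n → ℝ) →ₘ[volume] ℂ}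
    (hu : NullInMeasure l u) (hv : NullInMeasure l v) : NullInMeasure l (u + v) := by
  intro t ht
  have h := (hu (t / 2) (by positivity)).add (hv (t / 2) (by positivity))
  rw [add_zero] at h
  refine tendsto_of_tendsto_of_tendsto_of_le_of_le tendsto_const_nhds h (fun _ => zero_le)
    fun k => ?_
  refine (measure_mono_ae ?_).trans (measure_union_le _ _)
  filter_upwards [AEEqFun.coeFn_add (u k) (v k)] with x hx hxt
  have hxt' : (t : ℝ≥0∞) < ‖((u k + v k : (Fin n → ℝ) →ₘ[volume] ℂ)) x‖ₑ := hxt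
  rw [hx] at hxt'
  by_contra hc
  have h1 : ¬ (((t / 2 : ℝ≥0) : ℝ≥0∞) < ‖u k x‖ₑ ∨ ((t / 2 : ℝ≥0) : ℝ≥0∞) < ‖v k x‖ₑ) := hc
  push Not at h1
  refine absurd hxt' (not_lt.2 ((enorm_add_le _ _).trans ((add_le_add h1.1 h1.2).trans ?_)))
  rw [← ENNReal.coe_add, add_halves]

lemma NullInMeasure.tendstoInMeasure {ι : Type*} {l : Filter ι}
    {u : ι → (Fin n → ℝ) →ₘ[volume] ℂ} {v : (Fin n → ℝ) →ₘ[volume] ℂ}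
    (h : NullInMeasure l fun k => u k - v) : TendstoInMeasure volume (fun k => u k) l v := by
  refine tendstoInMeasure_of_ne_top fun ε hε hεt => ?_
  have hε2 : 0 < (ε / 2).toNNReal :=
    ENNReal.toNNReal_pos (ENNReal.half_pos hε.ne').ne' (ENNReal.div_ne_top hεt (by simp))
  refine tendsto_of_tendsto_of_tendsto_of_le_of_le tendsto_const_nhds (h _ hε2) (fun _ => zero_le)
    fun k => measure_mono_ae ?_
  filter_upwards [AEEqFun.coeFn_sub (u k) v] with x hx hxε
  have hxε' : ε ≤ edist (u k x) (v x) := hxε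
  show _ < ‖(u k - v : (Fin n → ℝ) →ₘ[volume] ℂ) x‖ₑ
  rw [hx, ENNReal.coe_toNNReal (ENNReal.div_ne_top hεt (by simp)), Pi.sub_apply,
    ← edist_eq_enorm_sub]
  exact (ENNReal.half_lt_self hε.ne' hεt).trans_le hxε'

variable {T : MultilinearMap ℂ
  (fun _ : Fin m => Lp ℂ (ENNReal.ofReal r) (volume : Measure (Fin n → ℝ)))
  ((Fin n → ℝ) →ₘ[volume] ℂ)}

/-- The weak type bound at a fixed height `t` bounds the measure by `(B ∏ ‖c_i‖ / t)^{r/m}`. -/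
lemma IsWeakBounded.nullInMeasure (hm : 0 < m) (hr : 0 < r) (hT : IsWeakBounded r T) {ι : Type*}
    {l : Filter ι}
    {c : ι → Fin m → Lp ℂ (ENNReal.ofReal r) (volume : Measure (Fin n → ℝ))}
    (hc : Tendsto (fun k => ∏ i, eLpNorm (c k i) (ENNReal.ofReal r) volume) l (𝓝 0)) :
    NullInMeasure l fun k => T (c k) := by
  obtain ⟨B, hB⟩ := hT
  intro t ht
  have hm' : (0 : ℝ) < m := by exact_mod_cast hm
  have ht0 : (t : ℝ≥0∞) ≠ 0 := by exact_mod_cast ht.ne'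
  have hrm : 0 < r / m := by positivity
  have h1 : Tendsto (fun k => (B * ∏ i, eLpNorm (c k i) (ENNReal.ofReal r) volume) / t) l (𝓝 0) := by
    have := ENNReal.Tendsto.div_const (ENNReal.Tendsto.const_mul (a := (B : ℝ≥0∞)) hc
      (Or.inr ENNReal.coe_ne_top)) (b := t) (Or.inr ht0)
    simpa using this
  have h2 := ((ENNReal.continuous_rpow_const (y := r / m)).tendsto 0).comp h1
  rw [ENNReal.zero_rpow_of_pos hrm] at h2
  refine tendsto_of_tendsto_of_tendsto_of_le_of_le tendsto_const_nhds h2 (fun _ => zero_le)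
    fun k => ?_
  have h3 : (t : ℝ≥0∞) * volume {x | (t : ℝ≥0∞) < ‖T (c k) x‖ₑ} ^ (1 / (r / m)) ≤
      B * ∏ i, eLpNorm (c k i) (ENNReal.ofReal r) volume := by
    refine le_trans ?_ (hB (c k))
    refine le_trans (le_of_eq ?_) (le_iSup _ t)
    simp only [enorm, ENNReal.coe_lt_coe]
  have h4 : volume {x | (t : ℝ≥0∞) < ‖T (c k) x‖ₑ} ^ (1 / (r / m)) ≤
      (B * ∏ i, eLpNorm (c k i) (ENNReal.ofReal r) volume) / t := by
    rw [ENNReal.le_div_iff_mul_le (Or.inl ht0) (Or.inl ENNReal.coe_ne_top), mul_comm]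
    exact h3
  refine le_trans (le_of_eq ?_) (ENNReal.rpow_le_rpow h4 hrm.le)
  rw [← ENNReal.rpow_mul, one_div_mul_cancel hrm.ne', ENNReal.rpow_one]

end SparseHormander

/-! ### From test functions to `L^r`, and stability of images -/

namespace SparseHormander

open Filter Topology

variable {n m : ℕ} {r : ℝ} {T : MultilinearMap ℂ
  (fun _ : Fin m => Lp ℂ (ENNReal.ofReal r) (volume : Measure (Fin n → ℝ)))
  ((Fin n → ℝ) →ₘ[volume] ℂ)} {P : Fin m → ℝ} {p : ℝ} {μ : Fin m → Measure (Fin n → ℝ)}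
  {ν : Measure (Fin n → ℝ)}

/-- Truncation as a map into `L^r`. -/
noncomputable def truncLp (r : ℝ) (k : ℕ) {g : (Fin n → ℝ) → ℂ} (hg : Measurable g) :
    Lp ℂ (ENNReal.ofReal r) (volume : Measure (Fin n → ℝ)) :=
  ((isTest_trunc k hg).memLp (ENNReal.ofReal r) volume).toLp (trunc k g)

lemma coeFn_truncLp (k : ℕ) {g : (Fin n → ℝ) → ℂ} (hg : Measurable g) :
    truncLp r k hg =ᵐ[volume] trunc k g := MemLp.coeFn_toLp _

lemma map_truncLp (k : ℕ) {g : Fin m → (Fin n → ℝ) → ℂ} (hg : ∀ i, Measurable (g i)) :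
    T (fun i => truncLp r k (hg i)) = onFun T fun i => trunc k (g i) :=
  (onFun_eq fun i => (isTest_trunc k (hg i)).memLp (ENNReal.ofReal r) volume).symm

lemma eLpNorm_truncLp_le (k : ℕ) {g : (Fin n → ℝ) → ℂ} (hg : Measurable g) (q : ℝ≥0∞)
    {σ : Measure (Fin n → ℝ)} (hσ : σ ≪ volume) :
    eLpNorm (truncLp r k hg) q σ ≤ eLpNorm g q σ := by
  rw [eLpNorm_congr_ae (hσ.ae_eq (coeFn_truncLp k hg))]
  exact eLpNorm_trunc_le k g q σ

lemma tendsto_truncLp {g : (Fin n → ℝ) → ℂ} (hg : Measurable g) {q : ℝ} (hq : 0 < q)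
    {σ : Measure (Fin n → ℝ)} (hσ : σ ≪ volume) (hgq : eLpNorm g (ENNReal.ofReal q) σ ≠ ∞) :
    Tendsto (fun k => eLpNorm (⇑(truncLp r k hg) - g) (ENNReal.ofReal q) σ) atTop (𝓝 0) := by
  refine (tendsto_eLpNorm_trunc_sub hg hq hgq).congr fun k => eLpNorm_congr_ae ?_
  exact ((hσ.ae_eq (coeFn_truncLp k hg)).symm).sub (ae_eq_refl _)

/-- A bound for test functions extends to all of `L^r ∩ L^{p_i}(μ_i)`. -/
lemma eLpNorm_map_le (hm : 0 < m) (hr : 1 ≤ r) (hT : IsWeakBounded r T)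
    (hν : ν ≪ volume) {D : ℝ≥0∞}
    (hD : ∀ f : Fin m → (Fin n → ℝ) → ℂ, (∀ i, IsTest (f i)) →
      eLpNorm (onFun T f) (ENNReal.ofReal p) ν ≤
        D * ∏ i, eLpNorm (f i) (ENNReal.ofReal (P i)) (μ i))
    (f : Fin m → Lp ℂ (ENNReal.ofReal r) (volume : Measure (Fin n → ℝ))) :
    eLpNorm (T f) (ENNReal.ofReal p) ν ≤
      D * ∏ i, eLpNorm (f i) (ENNReal.ofReal (P i)) (μ i) := by
  have hr0 : 0 < r := by linarith
  have hfm : ∀ i, Measurable (f i) := fun i => (Lp.stronglyMeasurable (f i)).measurable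
  have hfin : ∀ g : Lp ℂ (ENNReal.ofReal r) (volume : Measure (Fin n → ℝ)),
    eLpNorm g (ENNReal.ofReal r) volume ≠ ∞ := Lp.eLpNorm_ne_top
  set M : ℝ≥0∞ := ∑ i, eLpNorm (f i) (ENNReal.ofReal r) volume with hM
  have hMi : ∀ i, eLpNorm (f i) (ENNReal.ofReal r) volume ≤ M := fun i =>
    Finset.single_le_sum (f := fun i => eLpNorm (f i) (ENNReal.ofReal r) volume)
      (fun _ _ => zero_le) (Finset.mem_univ i)
  -- Truncations converge in `L^r`, so their images converge in measure and, along a subsequence,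
  -- almost everywhere. Fatou's lemma passes the bound to the limit, since truncation does not
  -- increase the norms on the right.
  have hnull : NullInMeasure atTop fun k : ℕ => T (fun i => truncLp r k (hfm i)) - T f := by
    refine null_map_sub_map (l := atTop) T (NullInMeasure atTop) (nullInMeasure_zero _)
      (fun u v hu hv => hu.add hv) (fun i g => eLpNorm g (ENNReal.ofReal r) volume)
      (fun c _ hc => hT.nullInMeasure hm hr0 hc) (a := fun k i => truncLp r k (hfm i))
      (b := fun _ => f) (fun k i => hfin _) (fun _ i => hfin _) (fun k i => hfin _) (M := M)
      (ENNReal.sum_ne_top.2 fun i _ => hfin _)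
      (fun i => Eventually.of_forall fun k => ?_) (fun i => Eventually.of_forall fun _ => hMi i)
      (fun i => ?_)
    · exact (eLpNorm_truncLp_le k (hfm i) _ Measure.AbsolutelyContinuous.rfl).trans (hMi i)
    · refine (tendsto_truncLp (r := r) (hfm i) hr0 Measure.AbsolutelyContinuous.rfl
        (hfin (f i))).congr fun k => eLpNorm_congr_ae ?_
      exact (Lp.coeFn_sub _ _).symm
  obtain ⟨φ, hφ, hlim⟩ := hnull.tendstoInMeasure.exists_seq_tendsto_ae
  refine Lp.eLpNorm_le_of_ae_tendsto (u := atTop)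
    (f := fun k x => T (fun i => truncLp r (φ k) (hfm i)) x)
    (Eventually.of_forall fun k => ?_)
    (fun k => (AEEqFun.aestronglyMeasurable _).mono_ac hν) (hν.ae_le hlim)
  show eLpNorm (T fun i => truncLp r (φ k) (hfm i)) _ _ ≤ _
  rw [map_truncLp]
  refine (hD _ fun i => isTest_trunc _ (hfm i)).trans ?_
  gcongr with i
  exact eLpNorm_trunc_le _ _ _ _

/-- `h` is the limit of `T f` as `f` tends to `g`. -/
def IsExtensionAt (T : MultilinearMap ℂ
    (fun _ : Fin m => Lp ℂ (ENNReal.ofReal r) (volume : Measure (Fin n → ℝ)))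
    ((Fin n → ℝ) →ₘ[volume] ℂ)) (P : Fin m → ℝ) (p : ℝ) (μ : Fin m → Measure (Fin n → ℝ))
    (ν : Measure (Fin n → ℝ)) (g : Fin m → (Fin n → ℝ) → ℂ) (h : (Fin n → ℝ) → ℂ) : Prop :=
  ∀ f : ℕ → Fin m → Lp ℂ (ENNReal.ofReal r) (volume : Measure (Fin n → ℝ)),
    (∀ k i, eLpNorm (f k i) (ENNReal.ofReal (P i)) (μ i) ≠ ∞) →
    (∀ i, Tendsto (fun k => eLpNorm (⇑(f k i) - g i) (ENNReal.ofReal (P i)) (μ i)) atTop (𝓝 0)) →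
    Tendsto (fun k => eLpNorm (⇑(T (f k)) - h) (ENNReal.ofReal p) ν) atTop (𝓝 0)

/-- Asymptotically equal bounded families have asymptotically equal images. -/
lemma tendsto_map_sub_map (hμ : ∀ i, μ i ≪ volume)
    (hν : ν ≪ volume) {D : ℝ≥0∞} (hDt : D ≠ ∞)
    (hD : ∀ f : Fin m → Lp ℂ (ENNReal.ofReal r) (volume : Measure (Fin n → ℝ)),
      eLpNorm (T f) (ENNReal.ofReal p) ν ≤
        D * ∏ i, eLpNorm (f i) (ENNReal.ofReal (P i)) (μ i))
    {ι : Type*} {l : Filter ι}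
    {a b : ι → Fin m → Lp ℂ (ENNReal.ofReal r) (volume : Measure (Fin n → ℝ))}
    (ha : ∀ k i, eLpNorm (a k i) (ENNReal.ofReal (P i)) (μ i) ≠ ∞)
    (hb : ∀ k i, eLpNorm (b k i) (ENNReal.ofReal (P i)) (μ i) ≠ ∞)
    {g : Fin m → (Fin n → ℝ) → ℂ} (hg : ∀ i, MemLp (g i) (ENNReal.ofReal (P i)) (μ i))
    (hag : ∀ i, Tendsto (fun k => eLpNorm (⇑(a k i) - g i) (ENNReal.ofReal (P i)) (μ i)) l (𝓝 0))
    (hbg : ∀ i, Tendsto (fun k => eLpNorm (⇑(b k i) - g i) (ENNReal.ofReal (P i)) (μ i)) l (𝓝 0)) :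
    Tendsto (fun k => eLpNorm (T (a k) - T (b k) : (Fin n → ℝ) →ₘ[volume] ℂ)
      (ENNReal.ofReal p) ν) l (𝓝 0) := by
  have hLm : ∀ (f : Lp ℂ (ENNReal.ofReal r) (volume : Measure (Fin n → ℝ))) (i : Fin m),
      AEStronglyMeasurable f (μ i) := fun f i => (Lp.aestronglyMeasurable f).mono_ac (hμ i)
  have hTm : ∀ u : (Fin n → ℝ) →ₘ[volume] ℂ, AEStronglyMeasurable u ν := fun u =>
    u.aestronglyMeasurable.mono_ac hν
  have hsub : ∀ (f f' : Lp ℂ (ENNReal.ofReal r) (volume : Measure (Fin n → ℝ))) (i : Fin m),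
      eLpNorm (f - f' : Lp ℂ (ENNReal.ofReal r) (volume : Measure (Fin n → ℝ)))
        (ENNReal.ofReal (P i)) (μ i) = eLpNorm (⇑f - ⇑f') (ENNReal.ofReal (P i)) (μ i) :=
    fun f f' i => eLpNorm_congr_ae ((hμ i).ae_eq (Lp.coeFn_sub f f'))
  -- Eventual boundedness by the quasi-triangle inequality, whose constant covers exponents below 1.
  have hbd : ∀ (c : ι → Fin m → Lp ℂ (ENNReal.ofReal r) (volume : Measure (Fin n → ℝ))),
      (∀ i, Tendsto (fun k => eLpNorm (⇑(c k i) - g i) (ENNReal.ofReal (P i)) (μ i)) l (𝓝 0)) →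
      ∀ i, ∀ᶠ k in l, eLpNorm (c k i) (ENNReal.ofReal (P i)) (μ i) ≤
        ∑ i, ENNReal.LpAddConst (ENNReal.ofReal (P i)) *
          (1 + eLpNorm (g i) (ENNReal.ofReal (P i)) (μ i)) := by
    intro c hc i
    filter_upwards [ENNReal.tendsto_nhds_zero.1 (hc i) 1 one_pos] with k hk
    have h1 := eLpNorm_add_le' ((hLm (c k i) i).sub (hg i).1) (hg i).1 (ENNReal.ofReal (P i))
    rw [sub_add_cancel] at h1
    refine h1.trans (le_trans ?_ (Finset.single_le_sum (f := fun i =>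
      ENNReal.LpAddConst (ENNReal.ofReal (P i)) *
          (1 + eLpNorm (g i) (ENNReal.ofReal (P i)) (μ i))) (fun _ _ => zero_le)
          (Finset.mem_univ i)))
    gcongr
  refine null_map_sub_map (l := l) T
    (fun u => Tendsto (fun k => eLpNorm (u k) (ENNReal.ofReal p) ν) l (𝓝 0)) ?_ ?_
    (fun i f => eLpNorm f (ENNReal.ofReal (P i)) (μ i)) ?_ ha hb ?_
    (M := ∑ i, ENNReal.LpAddConst (ENNReal.ofReal (P i)) *
          (1 + eLpNorm (g i) (ENNReal.ofReal (P i)) (μ i))) ?_ (hbd a hag) (hbd b hbg) ?_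
  · have : eLpNorm (0 : (Fin n → ℝ) →ₘ[volume] ℂ) (ENNReal.ofReal p) ν = 0 := by
      rw [eLpNorm_congr_ae (hν.ae_eq AEEqFun.coeFn_zero), eLpNorm_zero]
    simp only [Pi.zero_apply, this]
    exact tendsto_const_nhds
  · intro u v hu hv
    refine (tendsto_eLpNorm_add (fun k => hTm (u k)) (fun k => hTm (v k)) hu hv).congr fun k => ?_
    exact eLpNorm_congr_ae (hν.ae_eq (AEEqFun.coeFn_add (u k) (v k)).symm)
  · intro c _ hc
    have h := ENNReal.Tendsto.const_mul hc (Or.inr hDt)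
    rw [mul_zero] at h
    exact tendsto_of_tendsto_of_tendsto_of_le_of_le tendsto_const_nhds h (fun _ => zero_le)
      fun k => hD (c k)
  · intro k i
    rw [hsub]
    exact ((MemLp.sub ⟨hLm _ i, (ha k i).lt_top⟩ ⟨hLm _ i, (hb k i).lt_top⟩).2).ne
  · refine ENNReal.sum_ne_top.2 fun i _ => ENNReal.mul_ne_top (ENNReal.LpAddConst_lt_top _).ne ?_
    exact ENNReal.add_ne_top.2 ⟨ENNReal.one_ne_top, (hg i).2.ne⟩
  · intro i
    have h1 : Tendsto (fun k => eLpNorm (g i - ⇑(b k i)) (ENNReal.ofReal (P i)) (μ i)) l (𝓝 0) := by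
      refine (hbg i).congr fun k => ?_
      exact eLpNorm_sub_comm _ _ _ _
    refine (tendsto_eLpNorm_add (fun k => (hLm (a k i) i).sub (hg i).1)
      (fun k => (hg i).1.sub (hLm (b k i) i)) (hag i) h1).congr fun k => ?_
    rw [sub_add_sub_cancel, hsub]

end SparseHormander

/-! ### The bounded multilinear extension -/

namespace SparseHormander

open Filter Topology

variable {n m : ℕ} {r : ℝ} {T : MultilinearMap ℂ
  (fun _ : Fin m => Lp ℂ (ENNReal.ofReal r) (volume : Measure (Fin n → ℝ)))
  ((Fin n → ℝ) →ₘ[volume] ℂ)} {P : Fin m → ℝ} {p : ℝ} {μ : Fin m → Measure (Fin n → ℝ)}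
  {ν : Measure (Fin n → ℝ)}

lemma exists_approximation (r : ℝ) {q : ℝ} (hq : 0 < q) {σ : Measure (Fin n → ℝ)} (hσ : σ ≪ volume)
    (g : Lp ℂ (ENNReal.ofReal q) σ) :
    ∃ f : ℕ → Lp ℂ (ENNReal.ofReal r) (volume : Measure (Fin n → ℝ)),
      (∀ k, eLpNorm (f k) (ENNReal.ofReal q) σ ≤ eLpNorm g (ENNReal.ofReal q) σ) ∧
      Tendsto (fun k => eLpNorm (⇑(f k) - ⇑g) (ENNReal.ofReal q) σ) atTop (𝓝 0) :=
  ⟨fun k => truncLp r k (Lp.stronglyMeasurable g).measurable,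
    fun k => eLpNorm_truncLp_le k _ _ hσ,
    tendsto_truncLp _ hq hσ (Lp.eLpNorm_ne_top g)⟩

/-- Images of truncations form a Cauchy sequence. Any other approximating sequence is asymptotically
equal to the truncations, hence has the same limit. -/
lemma exists_isExtensionAt (hP : ∀ i, 0 < P i) (hp : 0 < p) (hμ : ∀ i, μ i ≪ volume)
    (hν : ν ≪ volume) {D : ℝ≥0∞} (hDt : D ≠ ∞)
    (hD : ∀ f : Fin m → Lp ℂ (ENNReal.ofReal r) (volume : Measure (Fin n → ℝ)),
      eLpNorm (T f) (ENNReal.ofReal p) ν ≤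
        D * ∏ i, eLpNorm (f i) (ENNReal.ofReal (P i)) (μ i))
    (g : ∀ i, Lp ℂ (ENNReal.ofReal (P i)) (μ i)) :
    ∃ h : Lp ℂ (ENNReal.ofReal p) ν, IsExtensionAt T P p μ ν (fun i => g i) h ∧
      eLpNorm h (ENNReal.ofReal p) ν ≤ D * ∏ i, eLpNorm (g i) (ENNReal.ofReal (P i)) (μ i) := by
  have hp0 : ENNReal.ofReal p ≠ 0 := by simpa using hp
  have hTm : ∀ u : (Fin n → ℝ) →ₘ[volume] ℂ, AEStronglyMeasurable u ν := fun u =>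
    u.aestronglyMeasurable.mono_ac hν
  choose a hale hag using fun i => exists_approximation r (hP i) (hμ i) (g i)
  have hafin : ∀ k i, eLpNorm (a i k) (ENNReal.ofReal (P i)) (μ i) ≠ ∞ := fun k i =>
    ne_top_of_le_ne_top (Lp.eLpNorm_ne_top (g i)) (hale i k)
  have hTsub : ∀ u v : (Fin n → ℝ) →ₘ[volume] ℂ, eLpNorm (u - v : (Fin n → ℝ) →ₘ[volume] ℂ)
      (ENNReal.ofReal p) ν = eLpNorm (⇑u - ⇑v) (ENNReal.ofReal p) ν := fun u v =>
    eLpNorm_congr_ae (hν.ae_eq (AEEqFun.coeFn_sub u v))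
  have hfst : Tendsto Prod.fst (atTop : Filter (ℕ × ℕ)) atTop := by
    rw [← prod_atTop_atTop_eq]; exact tendsto_fst
  have hsnd : Tendsto Prod.snd (atTop : Filter (ℕ × ℕ)) atTop := by
    rw [← prod_atTop_atTop_eq]; exact tendsto_snd
  have hcauchy := tendsto_map_sub_map (T := T) (p := p) hμ hν hDt hD (l := (atTop : Filter (ℕ × ℕ)))
    (a := fun k i => a i k.1) (b := fun k i => a i k.2) (fun k i => hafin k.1 i)
    (fun k i => hafin k.2 i) (g := fun i => g i) (fun i => Lp.memLp (g i))
    (fun i => (hag i).comp hfst) (fun i => (hag i).comp hsnd)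
  obtain ⟨h, hhm, hlim⟩ := exists_tendsto_eLpNorm_of_cauchy hp0 ENNReal.ofReal_ne_top
    (f := fun k => ⇑(T fun i => a i k)) (fun k => hTm _) (by simpa only [hTsub] using hcauchy)
  have hbound : eLpNorm h (ENNReal.ofReal p) ν ≤
      D * ∏ i, eLpNorm (g i) (ENNReal.ofReal (P i)) (μ i) := by
    refine eLpNorm_le_of_tendstoInMeasure (u := atTop) (f := fun k => ⇑(T fun i => a i k))
      (Eventually.of_forall fun k => ?_)
      (tendstoInMeasure_of_tendsto_eLpNorm hp0 (fun k => hTm _) hhm.aestronglyMeasurable hlim)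
      (fun k => hTm _)
    refine (hD _).trans ?_
    gcongr with i
    exact hale i k
  have hmem : MemLp h (ENNReal.ofReal p) ν := ⟨hhm.aestronglyMeasurable, hbound.trans_lt
    (ENNReal.mul_lt_top hDt.lt_top (ENNReal.prod_lt_top fun i _ => (Lp.memLp (g i)).2))⟩
  refine ⟨hmem.toLp h, fun f hf hfg => ?_, ?_⟩
  · have h1 := tendsto_map_sub_map (T := T) (p := p) hμ hν hDt hD (l := (atTop : Filter ℕ))
      (a := f) (b := fun k i => a i k) hf hafin (g := fun i => g i) (fun i => Lp.memLp (g i)) hfg hag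
    simp only [hTsub] at h1
    refine (tendsto_eLpNorm_add (fun k => (hTm _).sub (hTm _))
      (fun k => (hTm _).sub hhm.aestronglyMeasurable) h1 hlim).congr fun k => ?_
    rw [sub_add_sub_cancel]
    exact eLpNorm_congr_ae ((ae_eq_refl _).sub hmem.coeFn_toLp.symm)
  · rwa [eLpNorm_congr_ae hmem.coeFn_toLp]

/-- A multilinear operator on `L^r` that is bounded from `∏ L^{p_i}(μ_i)` to `L^p(ν)` on test
functions has a bounded multilinear extension. -/
theorem exists_extension (hm : 0 < m) (hr : 1 ≤ r) (hT : IsWeakBounded r T)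
    (hP : ∀ i, 0 < P i) (hp : 0 < p) (hμ : ∀ i, μ i ≪ volume) (hν : ν ≪ volume)
    (hν' : volume ≪ ν) {D : ℝ≥0∞} (hDt : D ≠ ∞)
    (hD : ∀ f : Fin m → (Fin n → ℝ) → ℂ, (∀ i, IsTest (f i)) →
      eLpNorm (onFun T f) (ENNReal.ofReal p) ν ≤
        D * ∏ i, eLpNorm (f i) (ENNReal.ofReal (P i)) (μ i)) :
    ∃ Tw : MultilinearMap ℂ (fun i : Fin m => Lp ℂ (ENNReal.ofReal (P i)) (μ i))
        (Lp ℂ (ENNReal.ofReal p) ν),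
      (∀ (f : Fin m → Lp ℂ (ENNReal.ofReal r) (volume : Measure (Fin n → ℝ)))
          (g : ∀ i, Lp ℂ (ENNReal.ofReal (P i)) (μ i)),
          (∀ i, f i =ᵐ[volume] g i) → T f =ᵐ[volume] Tw g) ∧
      ∀ g : ∀ i, Lp ℂ (ENNReal.ofReal (P i)) (μ i),
        eLpNorm (Tw g) (ENNReal.ofReal p) ν ≤
          D * ∏ i, eLpNorm (g i) (ENNReal.ofReal (P i)) (μ i) := by
  have hp0 : ENNReal.ofReal p ≠ 0 := by simpa using hp
  have hTm : ∀ u : (Fin n → ℝ) →ₘ[volume] ℂ, AEStronglyMeasurable u ν := fun u =>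
    u.aestronglyMeasurable.mono_ac hν
  have hLm : ∀ (f : Lp ℂ (ENNReal.ofReal r) (volume : Measure (Fin n → ℝ))) (i : Fin m),
      AEStronglyMeasurable f (μ i) := fun f i => (Lp.aestronglyMeasurable f).mono_ac (hμ i)
  choose H hH hHle using exists_isExtensionAt (T := T) hP hp hμ hν hDt
    (eLpNorm_map_le hm hr hT hν hD)
  choose a hale hag using fun i => fun g => exists_approximation r (hP i) (hμ i) g
  have hafin : ∀ i g k, eLpNorm (a i g k) (ENNReal.ofReal (P i)) (μ i) ≠ ∞ := fun i g k =>
    ne_top_of_le_ne_top (Lp.eLpNorm_ne_top g) (hale i g k)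
  -- Limits are unique because quasi-norm convergence implies convergence in measure.
  have huniq : ∀ {u : ℕ → (Fin n → ℝ) → ℂ} {h h' : (Fin n → ℝ) → ℂ},
      (∀ k, AEStronglyMeasurable (u k) ν) → AEStronglyMeasurable h ν →
      AEStronglyMeasurable h' ν →
      Tendsto (fun k => eLpNorm (u k - h) (ENNReal.ofReal p) ν) atTop (𝓝 0) →
      Tendsto (fun k => eLpNorm (u k - h') (ENNReal.ofReal p) ν) atTop (𝓝 0) → h =ᵐ[ν] h' :=
    fun hu hh hh' h1 h2 => tendstoInMeasure_ae_unique
      (tendstoInMeasure_of_tendsto_eLpNorm hp0 hu hh h1)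
      (tendstoInMeasure_of_tendsto_eLpNorm hp0 hu hh' h2)
  -- the image of the approximating sequence with the `i`-th entry replaced
  have hseq : ∀ (g : ∀ i, Lp ℂ (ENNReal.ofReal (P i)) (μ i)) (i : Fin m)
      (z : Lp ℂ (ENNReal.ofReal (P i)) (μ i))
      (b : ℕ → Lp ℂ (ENNReal.ofReal r) (volume : Measure (Fin n → ℝ))),
      (∀ k, eLpNorm (b k) (ENNReal.ofReal (P i)) (μ i) ≠ ∞) →
      Tendsto (fun k => eLpNorm (⇑(b k) - ⇑z) (ENNReal.ofReal (P i)) (μ i)) atTop (𝓝 0) →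
      Tendsto (fun k => eLpNorm (⇑(T (Function.update (fun j => a j (g j) k) i (b k))) -
        ⇑(H (Function.update g i z))) (ENNReal.ofReal p) ν) atTop (𝓝 0) := by
    intro g i z b hb hbz
    refine hH (Function.update g i z) (fun k => Function.update (fun j => a j (g j) k) i (b k))
      (fun k j => ?_) (fun j => ?_)
    · rcases eq_or_ne j i with rfl | hj
      · simpa using hb k
      · simpa [hj] using hafin j (g j) k
    · rcases eq_or_ne j i with rfl | hj
      · simpa using hbz
      · simpa [hj] using hag j (g j)
  refine ⟨MultilinearMap.mk' H (fun g i x y => ?_) (fun g i c x => ?_), fun f g hfg => ?_, hHle⟩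
  · refine Lp.ext (EventuallyEq.trans ?_ (Lp.coeFn_add _ _).symm)
    have h1 := hseq g i x (a i x) (hafin i x) (hag i x)
    have h2 := hseq g i y (a i y) (hafin i y) (hag i y)
    -- The sum of the approximations of `x` and `y` approximates `x + y`; additivity of `T` and
    -- uniqueness of limits give additivity in slot `i`.
    have h3 := hseq g i (x + y) (fun k => a i x k + a i y k) (fun k => ?_) ?_
    · refine huniq (fun k => hTm _) (Lp.aestronglyMeasurable _)
        ((Lp.aestronglyMeasurable _).add (Lp.aestronglyMeasurable _)) h3 ?_
      refine (tendsto_eLpNorm_add (fun k => (hTm _).sub (Lp.aestronglyMeasurable _))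
        (fun k => (hTm _).sub (Lp.aestronglyMeasurable _)) h1 h2).congr fun k => ?_
      refine eLpNorm_congr_ae ?_
      rw [T.map_update_add, sub_add_sub_comm]
      exact (hν.ae_eq (AEEqFun.coeFn_add _ _)).symm.sub (ae_eq_refl _)
    · rw [eLpNorm_congr_ae ((hμ i).ae_eq (Lp.coeFn_add _ _))]
      exact (MemLp.add ⟨hLm _ i, (hafin i x k).lt_top⟩ ⟨hLm _ i, (hafin i y k).lt_top⟩).2.ne
    · refine (tendsto_eLpNorm_add (fun k => (hLm _ i).sub (Lp.aestronglyMeasurable _))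
        (fun k => (hLm _ i).sub (Lp.aestronglyMeasurable _)) (hag i x) (hag i y)).congr fun k => ?_
      refine eLpNorm_congr_ae ?_
      rw [sub_add_sub_comm]
      exact ((hμ i).ae_eq (Lp.coeFn_add _ _)).symm.sub (Lp.coeFn_add _ _).symm
  · refine Lp.ext (EventuallyEq.trans ?_ (Lp.coeFn_smul _ _).symm)
    have h1 := hseq g i x (a i x) (hafin i x) (hag i x)
    have h2 := hseq g i (c • x) (fun k => c • a i x k) (fun k => ?_) ?_
    · refine huniq (fun k => hTm _) (Lp.aestronglyMeasurable _)
        ((Lp.aestronglyMeasurable _).const_smul c) h2 ?_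
      have h3 := ENNReal.Tendsto.const_mul (a := ‖c‖ₑ) h1 (Or.inr enorm_ne_top)
      rw [mul_zero] at h3
      refine h3.congr fun k => ?_
      rw [← eLpNorm_const_smul, smul_sub]
      refine eLpNorm_congr_ae ?_
      rw [T.map_update_smul]
      exact (hν.ae_eq (AEEqFun.coeFn_smul _ _)).symm.sub (ae_eq_refl _)
    · rw [eLpNorm_congr_ae ((hμ i).ae_eq (Lp.coeFn_smul _ _))]
      exact (MemLp.const_smul ⟨hLm _ i, (hafin i x k).lt_top⟩ c).2.ne
    · have h3 := ENNReal.Tendsto.const_mul (a := ‖c‖ₑ) (hag i x) (Or.inr enorm_ne_top)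
      rw [mul_zero] at h3
      refine h3.congr fun k => ?_
      rw [← eLpNorm_const_smul, smul_sub]
      exact eLpNorm_congr_ae
        (((hμ i).ae_eq (Lp.coeFn_smul _ _)).symm.sub (Lp.coeFn_smul _ _).symm)
  -- Agreement with `T`: the constant sequence `f` is admissible, so `T f` is itself the limit.
  -- Since the volume is absolutely continuous with respect to `ν`, equality `ν`-almost everywhere
  -- suffices.
  · have hfg' : ∀ i, f i =ᵐ[μ i] g i := fun i => (hμ i).ae_eq (hfg i)
    refine hν'.ae_eq (huniq (u := fun _ => T f) (fun _ => hTm _) (hTm _)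
      (Lp.aestronglyMeasurable _) ?_ (hH g (fun _ => f) (fun _ i => ?_) fun i => ?_))
    · simp only [sub_self, eLpNorm_zero]
      exact tendsto_const_nhds
    · rw [eLpNorm_congr_ae (hfg' i)]
      exact Lp.eLpNorm_ne_top _
    · have : eLpNorm (⇑(f i) - ⇑(g i)) (ENNReal.ofReal (P i)) (μ i) = 0 := by
        rw [eLpNorm_congr_ae ((hfg' i).sub (ae_eq_refl _)), sub_self, eLpNorm_zero]
      simp only [this]
      exact tendsto_const_nhds

end SparseHormander

/-! ### Conclusion -/

theorem theorem3p5 {n m : ℕ} (hn : 0 < n) (hm : 0 < m) (r : ℝ) (hr : 1 ≤ r)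
    (T : MultilinearMap ℂ
      (fun _ : Fin m => Lp ℂ (ENNReal.ofReal r) (volume : Measure (Fin n → ℝ)))
      ((Fin n → ℝ) →ₘ[volume] ℂ))
    (K : (Fin n → ℝ) → (Fin m → Fin n → ℝ) → ℂ)
    (hTK : IsSingularIntegral r T K)
    (hT : IsWeakBounded r T)
    (hK : hormanderConst r K < ⊤)
    (P : Fin m → ℝ) (hP : ∀ i, r < P i) (p : ℝ) (hp : 1 / p = ∑ i, 1 / P i) :
    ∃ C : ℝ≥0, ∀ w : Fin m → (Fin n → ℝ) → ℝ, (∀ i, IsWeight (w i)) →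
      multiApConst r p P w < ⊤ →
      ∃ Tw : MultilinearMap ℂ
          (fun i : Fin m => Lp ℂ (ENNReal.ofReal (P i)) (weightMeasure (w i)))
          (Lp ℂ (ENNReal.ofReal p) (weightMeasure (productWeight p P w))),
        (∀ (f : Fin m → Lp ℂ (ENNReal.ofReal r) (volume : Measure (Fin n → ℝ)))
            (g : (i : Fin m) → Lp ℂ (ENNReal.ofReal (P i)) (weightMeasure (w i))),
            (∀ i, f i =ᵐ[volume] g i) → T f =ᵐ[volume] Tw g) ∧
        ∀ g : (i : Fin m) → Lp ℂ (ENNReal.ofReal (P i)) (weightMeasure (w i)),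
          eLpNorm (Tw g) (ENNReal.ofReal p) (weightMeasure (productWeight p P w)) ≤
            C * multiApConst r p P w ^ max 1 (⨆ i, (P i / r).conjExponent / p) *
              ∏ i, eLpNorm (g i) (ENNReal.ofReal (P i)) (weightMeasure (w i)) := by
  have hr0 : 0 < r := by linarith
  have hP0 : ∀ i, 0 < P i := fun i => hr0.trans (hP i)
  have : Nonempty (Fin m) := ⟨⟨0, hm⟩⟩
  have hp0 : 0 < p := by
    have : 0 < 1 / p := by
      rw [hp]; exact Finset.sum_pos (fun i _ => one_div_pos.2 (hP0 i)) Finset.univ_nonempty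
    exact one_div_pos.1 this
  -- Here `(p_i/r)' = p_i/(p_i - r)`, and the supremum over the finite index set is attained among
  -- bounded values.
  have hβ : ∀ i, P i / (P i - r) / p ≤ max 1 (⨆ i, (P i / r).conjExponent / p) := by
    intro i
    refine le_trans (le_of_eq ?_) ((le_ciSup (f := fun i => (P i / r).conjExponent / p)
      (Set.finite_range _).bddAbove i).trans (le_max_right _ _))
    have : P i - r ≠ 0 := by linarith [hP i]
    rw [Real.conjExponent]
    field_simp
  obtain ⟨C, hC⟩ := exists_test_bound hm hr hTK hT hK hP hp0 hp (le_max_left _ _) hβ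
  refine ⟨C, fun w hw hwA => ?_⟩
  exact exists_extension hm hr hT hP0 hp0 (fun i => weightMeasure_absolutelyContinuous (w i))
    (weightMeasure_absolutelyContinuous _) (IsWeight.productWeight hw p P).absolutelyContinuous
    (ENNReal.mul_ne_top ENNReal.coe_ne_top
      (ENNReal.rpow_ne_top_of_nonneg (zero_le_one.trans (le_max_left _ _)) hwA.ne))
    (hC w hw hwA.ne)
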